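/- Let $G$ be a complex Lie group whose Lie algebra $\mathfrak g$ is semisimple. Let $\mathfrak g_0\subset\mathfrak g$ be a real form, with complex conjugation $\sigma$, and let $\theta$ be a Cartan involution of $\mathfrak g$ (regarded as a real Lie algebra), i.e. the conjugation of $\mathfrak g$ over a compact real form $\mathfrak g_u$, with $\sigma\theta=\theta\sigma$. Put $\mathfrak k_0=\mathfrak g_u\cap\mathfrak g_0$ and $\mathfrak s_0=\{\xi\in\mathfrak g_0:\theta\xi=-\xi\}$, so that $\mathfrak g_0=\mathfrak k_0\oplus\mathfrak s_0$. Let $G_0$, $K_0$ and $K$ be the connected Lie subgroups of $G$ with Lie algebras $\mathfrak g_0$, $\mathfrak k_0$ and $\mathfrak k_0\otimes\mathbb C=\mathfrak k_0+i\mathfrak k_0$. Let $M=G_0/K_0$ be the associated Riemannian symmetric space, $x_0=1K\in G/K$, and identify the tangent bundle $TM$ with $G_0\times_{K_0}\mathfrak s_0$, the quotient of $G_0\times\mathfrak s_0$ by $(g,\xi)\sim(gk,\mathrm{Ad}(k)^{-1}\xi)$, $k\in K_0$. Let $\mathfrak a_0$ be a maximal abelian subspace of $\mathfrak s_0$. A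 restricted root is a nonzero $\alpha\in\mathfrak a_0^*$ for which there is $0\neq X\in\mathfrak g_0$ with $[\xi,X]=\alpha(\xi)X$ for all $\xi\in\mathfrak a_0$. Let $$V=\{\xi\in\mathfrak a_0 : |\alpha(\xi)|<\tfrac{\pi}{2}\text{ for all restricted roots }\alpha\},\qquad \mathcal U=G_0\cdot\exp(iV)\cdot x_0\subset G/K .$$ Then the universal domain $\mathcal U$ is contractible. More precisely: 1. The polar coordinate map $\Pi:TM\to G/K$, $\Pi([g,\xi])=g\exp(i\xi)\cdot x_0$, is well defined and continuous, and restricts to a homeomorphism of $\mathcal V=\{[g,\xi]: g\in G_0,\ \xi\in V\}\subset TM$ onto $\mathcal U$. 2. The zero section of $TM$ lies in $\mathcal V$. The fibrewise scalings $\varphi_t([g,\xi])=[g,t\xi]$, $0\le t\le 1$, map $\mathcal V$ into itself, depend continuously on $(t,v)\in[0,1]\times\mathcal V$, and form a strong deformation retraction of $\mathcal V$ onto the zero section ($\varphi_1=\mathrm{id}$, $\varphi_0$ maps $\mathcal V$ into the zero section, and every $\varphi_t$ fixes the zero section pointwise). 3. The map $gK_0\mapsto[g,0]$ is a homeomorphism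 of $M$ onto the zero section, and $M$ is contractible. -/

import Mathlib

open scoped Manifold ContDiff

noncomputable section

namespace UniversalDomain

/-! ### Complex semisimple Lie algebras: real forms, Cartan involutions, restricted roots -/

section Algebra

variable {𝔤 : Type*} [LieRing 𝔤] [LieAlgebra ℂ 𝔤]

/-- `τ` is the complex conjugation of `𝔤` over a real form: a conjugate-linear involutive
automorphism of the Lie algebra. The real form is the fixed point set of `τ`. -/
structure IsConjugation (τ : 𝔤 →ₛₗ[starRingEnd ℂ] 𝔤) : Prop where
  involutive : ∀ X, τ (τ X) = X
  map_lie : ∀ X Y, τ ⁅X, Y⁆ = ⁅τ X, τ Y⁆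

/-- `θ` is a Cartan involution of the complex semisimple Lie algebra `𝔤` (regarded as a real Lie
algebra, whose Killing form is twice the real part of the complex one): it is the conjugation over
a compact real form, i.e. the form `-Re B(X, θ Y)` is positive definite. -/
structure IsCartanInvolution (θ : 𝔤 →ₛₗ[starRingEnd ℂ] 𝔤) : Prop extends IsConjugation θ where
  neg_re_killing : ∀ X, X ≠ 0 → (killingForm ℂ 𝔤 X (θ X)).re < 0

/-- The real form `𝔤₀` of `𝔤` determined by the conjugation `σ`. -/
def realForm (σ : 𝔤 →ₛₗ[starRingEnd ℂ] 𝔤) : Submodule ℝ 𝔤 where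
  carrier := {X | σ X = X}
  add_mem' {X Y} hX hY := by
    change σ X = X at hX
    change σ Y = Y at hY
    change σ (X + Y) = X + Y
    rw [map_add, hX, hY]
  zero_mem' := map_zero σ
  smul_mem' r X hX := by
    change σ X = X at hX
    change σ (r • X) = r • X
    rw [← Complex.coe_smul, map_smulₛₗ, hX, Complex.conj_ofReal]

/-- `𝔨₀ = 𝔤ᵤ ∩ 𝔤₀`, where `𝔤ᵤ` is the compact real form of `𝔤` fixed by `θ`. -/
def compactPart (σ θ : 𝔤 →ₛₗ[starRingEnd ℂ] 𝔤) : Submodule ℝ 𝔤 := realForm θ ⊓ realForm σ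

/-- `𝔰₀`, the `(-1)`-eigenspace of `θ` in `𝔤₀`, so that `𝔤₀ = 𝔨₀ ⊕ 𝔰₀`. -/
def noncompactPart (σ θ : 𝔤 →ₛₗ[starRingEnd ℂ] 𝔤) : Submodule ℝ 𝔤 := realForm (-θ) ⊓ realForm σ

/-- `𝔞₀` is a maximal abelian subspace of `𝔰₀`. -/
def IsMaximalAbelian (σ θ : 𝔤 →ₛₗ[starRingEnd ℂ] 𝔤) (𝔞₀ : Submodule ℝ 𝔤) : Prop :=
  Maximal (fun 𝔟 : Submodule ℝ 𝔤 =>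
    𝔟 ≤ noncompactPart σ θ ∧ ∀ X ∈ 𝔟, ∀ Y ∈ 𝔟, ⁅X, Y⁆ = 0) 𝔞₀

/-- `α` is a restricted root: a nonzero joint eigenvalue of `ad 𝔞₀` acting on `𝔤₀`. -/
def IsRestrictedRoot (σ : 𝔤 →ₛₗ[starRingEnd ℂ] 𝔤) (𝔞₀ : Submodule ℝ 𝔤)
    (α : Module.Dual ℝ 𝔞₀) : Prop :=
  α ≠ 0 ∧ ∃ X ∈ realForm σ, X ≠ 0 ∧ ∀ ξ : 𝔞₀, ⁅(ξ : 𝔤), X⁆ = α ξ • X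

/-- The polyhedron `V = {ξ ∈ 𝔞₀ : |α(ξ)| < π / 2 for all restricted roots α}`. -/
def polyhedron (σ : 𝔤 →ₛₗ[starRingEnd ℂ] 𝔤) (𝔞₀ : Submodule ℝ 𝔤) : Set 𝔤 :=
  {X | ∃ ξ : 𝔞₀, (ξ : 𝔤) = X ∧
    ∀ α : Module.Dual ℝ 𝔞₀, IsRestrictedRoot σ 𝔞₀ α → |α ξ| < Real.pi / 2}

end Algebra

/-! ### The groups -/

section Group

variable {E : Type*} [NormedAddCommGroup E] [NormedSpace ℂ E]
  {G : Type*} [TopologicalSpace G] [ChartedSpace E G] [Group G]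

/-- `γ : ℂ → G` is the holomorphic one-parameter subgroup with initial velocity `X`. A homomorphism
that is complex differentiable at `0` is holomorphic everywhere. -/
structure IsOneParameter (γ : ℂ → G) (X : GroupLieAlgebra 𝓘(ℂ, E) G) : Prop where
  map_add : ∀ s t, γ (s + t) = γ s * γ t
  hasMFDerivAt : HasMFDerivAt 𝓘(ℂ, ℂ) 𝓘(ℂ, E) γ 0
    ((ContinuousLinearMap.toSpanSingleton ℂ X : ℂ →L[ℂ] GroupLieAlgebra 𝓘(ℂ, E) G))

open Classical in
/-- The exponential map of the complex Lie group `G`: `exp X = γ 1` for the one-parameter subgroup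
`γ` with initial velocity `X` (in a complex Lie group it exists and is unique for every `X`). -/
def lieExp (X : GroupLieAlgebra 𝓘(ℂ, E) G) : G :=
  if h : ∃ γ : ℂ → G, IsOneParameter γ X then h.choose 1 else 1

/-- The adjoint representation: `Ad g` is the derivative at `1` of `h ↦ g * h * g⁻¹`. -/
def lieAd (g : G) : GroupLieAlgebra 𝓘(ℂ, E) G → GroupLieAlgebra 𝓘(ℂ, E) G :=
  fun X => mfderiv 𝓘(ℂ, E) 𝓘(ℂ, E) (fun h : G => g * h * g⁻¹) 1 X

/-- The subgroup of `G` generated by `exp W`. If `W` is a real Lie subalgebra of the Lie algebra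
of `G`, this is the connected (analytic) subgroup of `G` with Lie algebra `W`. -/
def analyticSubgroup (W : Set (GroupLieAlgebra 𝓘(ℂ, E) G)) : Subgroup G :=
  Subgroup.closure (lieExp '' W)

variable [CompleteSpace E] [LieGroup 𝓘(ℂ, E) ω G]
  (σ θ : GroupLieAlgebra 𝓘(ℂ, E) G →ₛₗ[starRingEnd ℂ] GroupLieAlgebra 𝓘(ℂ, E) G)

/-- `G₀`, the connected real form of `G` with Lie algebra `𝔤₀`. -/
abbrev G₀ : Subgroup G := analyticSubgroup (realForm σ : Set (GroupLieAlgebra 𝓘(ℂ, E) G))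

/-- `K₀`, the connected subgroup of `G₀` with Lie algebra `𝔨₀`. -/
abbrev K₀ : Subgroup G := analyticSubgroup (compactPart σ θ : Set (GroupLieAlgebra 𝓘(ℂ, E) G))

/-- `K`, the complexification of `K₀`: the connected subgroup of `G` whose Lie algebra is the
complex span of `𝔨₀`. -/
abbrev K : Subgroup G :=
  analyticSubgroup (Submodule.span ℂ (compactPart σ θ : Set (GroupLieAlgebra 𝓘(ℂ, E) G)) :
    Set (GroupLieAlgebra 𝓘(ℂ, E) G))

/-! ### The symmetric space, its tangent bundle, and the universal domain -/

/-- The Riemannian symmetric space `M = G₀ / K₀`, with the quotient topology. -/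
abbrev SymmetricSpace : Type _ := G₀ σ ⧸ (K₀ σ θ).subgroupOf (G₀ σ)

/-- `(g, ξ) ∼ (g', ξ')` on `G₀ × 𝔰₀` iff `(g', ξ') = (g k, Ad(k)⁻¹ ξ)` for some `k ∈ K₀`. -/
def tangentRel (v w : G₀ σ × noncompactPart σ θ) : Prop :=
  ∃ k ∈ K₀ σ θ, (w.1 : G) = v.1 * k ∧
    (v.2 : GroupLieAlgebra 𝓘(ℂ, E) G) = lieAd k (w.2 : GroupLieAlgebra 𝓘(ℂ, E) G)

/-- The tangent bundle of `M` as the homogeneous bundle `TM = G₀ ×_{K₀} 𝔰₀`, with the quotient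
topology. -/
abbrev TangentM : Type _ := Quot (tangentRel σ θ)

variable {σ θ} in
/-- The class `[g, ξ] ∈ TM`. -/
def tangentMk (g : G₀ σ) (ξ : noncompactPart σ θ) : TangentM σ θ := Quot.mk _ (g, ξ)

/-- The zero section of `TM`. -/
def zeroSection : Set (TangentM σ θ) := {v | ∃ g : G₀ σ, v = tangentMk g 0}

variable (𝔞₀ : Submodule ℝ (GroupLieAlgebra 𝓘(ℂ, E) G))

/-- The subset `{[g, ξ] : g ∈ G₀, ξ ∈ V}` of `TM`. -/
def tube : Set (TangentM σ θ) :=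
  {v | ∃ (g : G₀ σ) (ξ : noncompactPart σ θ),
    (ξ : GroupLieAlgebra 𝓘(ℂ, E) G) ∈ polyhedron σ 𝔞₀ ∧ v = tangentMk g ξ}

/-- The point `g exp(i ξ) x₀` of `G / K`, where `x₀ = 1 K` is the base point. -/
def polarPoint (g : G) (ξ : GroupLieAlgebra 𝓘(ℂ, E) G) : G ⧸ K σ θ :=
  QuotientGroup.mk (g * lieExp (Complex.I • ξ))

/-- The universal domain `U = G₀ exp(i V) x₀ ⊆ G / K`. -/
def universalDomain : Set (G ⧸ K σ θ) :=
  {x | ∃ g ∈ G₀ σ, ∃ ξ ∈ polyhedron σ 𝔞₀, x = polarPoint σ θ g ξ}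

end Group

/-- `φ` is a strong deformation retraction of `X` onto `A`: it starts (at time `1`) at the identity,
ends (at time `0`) in `A`, and fixes `A` pointwise at all times. -/
structure IsStrongDeformationRetraction {X : Type*} [TopologicalSpace X] (A : Set X)
    (φ : unitInterval × X → X) : Prop where
  continuous : Continuous φ
  map_one : ∀ x, φ (1, x) = x
  map_zero_mem : ∀ x, φ (0, x) ∈ A
  map_of_mem : ∀ t, ∀ a ∈ A, φ (t, a) = a

end UniversalDomain

end

noncomputable section

namespace UniversalDomain

open NormedSpace Filter Topology

/-!
The form `⟨X, Y⟩ = -B(X, θ Y)` makes `𝔤` a Hilbert space on which `ad X` and `Ad g` have adjoints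
`-ad (θ X)` and `θ (Ad g)⁻¹ θ`. Every derivation of `𝔤` is inner, so `Ad : G → Aut 𝔤` is a local
homeomorphism; lifting `X ↦ e^{ad X}` along it and taking powers gives the exponential map of `G`.

The polar decomposition of `Ad g` for `g ∈ G₀` lifts to the Cartan decomposition
`G₀ = exp(𝔰₀) K₀`. Hence `[e^η k, ξ] ↦ (η, Ad(k) ξ)` is a homeomorphism `TM ≃ 𝔰₀ × 𝔰₀`, so that `M`
and the tube, which is star-shaped in these coordinates, are contractible.

To see that `Π` is an embedding on the tube it suffices to compose it with the Cartan immersion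
`g K ↦ Ad(g) τ Ad(g)⁻¹ τ`, where `τ = σ θ`. In the coordinates `(η, ξ)` the composite is `p u p`
with `p = e^{ad η}` positive and `u = e^{2 i ad ξ}` unitary. The operator `ad ξ` is self-adjoint and
its nonzero eigenvalues are values of restricted roots, so on the tube `‖ad ξ‖ < π / 2` and `-1` is
not an eigenvalue of `u`. If `pᵢ uᵢ pᵢ → q v q`, write `q⁻¹ pᵢ = e^{Zᵢ} kᵢ` by the polar
decomposition; then `e^Z w e^Z → v` for `w = k u k⁻¹`, and multiplication by the adjoint gives
`e^Z e^{2R} e^Z → 1` for `R = w Z w⁻¹`. Since the logarithm is operator monotone, `Z + R → 0`, and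
since the square root is, `e^Z e^R → 1`. The latter means `w → v`, and then `Z → 0` because `-1` is
not an eigenvalue of `v`. Thus `pᵢ → q` and `uᵢ → v`, and logarithms recover the convergence of `η`
and `ξ`.
-/

section ExpApply

variable {V : Type*} [NormedAddCommGroup V] [NormedSpace ℂ V]

lemma hasSum_exp_apply [CompleteSpace V] (a : V →L[ℂ] V) (x : V) :
    HasSum (fun n : ℕ ↦ (n.factorial : ℂ)⁻¹ • (a ^ n) x) (exp a x) :=
  (exp_series_hasSum_exp' (𝕂 := ℂ) a).mapL (ContinuousLinearMap.apply ℂ V x)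

lemma exp_apply_of_apply_eq_smul [CompleteSpace V] {a : V →L[ℂ] V} {x : V} {μ : ℂ}
    (h : a x = μ • x) : exp a x = Complex.exp μ • x := by
  have hpow (n : ℕ) : (a ^ n) x = μ ^ n • x := by
    induction n with
    | zero => simp only [pow_zero, one_apply_eq_self, one_smul]
    | succ n ih => rw [pow_succ, mul_apply_eq_comp, h, map_smul, ih, smul_smul, pow_succ, mul_comm]
  have hsum : HasSum (fun n : ℕ ↦ ((n.factorial : ℂ)⁻¹ • μ ^ n) • x) (Complex.exp μ • x) := by
    rw [Complex.exp_eq_exp_ℂ]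
    exact (exp_series_hasSum_exp' (𝕂 := ℂ) μ).smul_const x
  refine (hasSum_exp_apply a x).unique (hsum.congr_fun fun n ↦ ?_)
  rw [hpow, smul_smul, smul_eq_mul]

variable [FiniteDimensional ℂ V]

lemma continuous_antilinear (τ : V →ₛₗ[starRingEnd ℂ] V) : Continuous τ :=
  let τ' : V →ₗ[ℝ] V :=
    { toFun := τ
      map_add' := map_add τ
      map_smul' := fun r x ↦ by
        rw [← Complex.coe_smul, map_smulₛₗ, Complex.conj_ofReal, Complex.coe_smul,
          RingHom.id_apply] }
  τ'.continuous_of_finiteDimensional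

lemma antilinear_exp {τ : V →ₛₗ[starRingEnd ℂ] V} {a b : V →L[ℂ] V}
    (h : Function.Semiconj τ a b) :
    Function.Semiconj τ (exp a : V →L[ℂ] V) (exp b : V →L[ℂ] V) := by
  intro x
  have := FiniteDimensional.complete ℂ V
  have hpow (n : ℕ) : τ ((a ^ n) x) = (b ^ n) (τ x) := by
    simpa only [FunLike.coe_pow_eq_iterate] using h.iterate_right n x
  refine ((hasSum_exp_apply a x).map τ.toAddMonoidHom (continuous_antilinear τ)).unique
    ((hasSum_exp_apply b (τ x)).congr_fun fun n ↦ ?_)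
  simp only [Function.comp_apply, LinearMap.toAddMonoidHom_coe, map_smulₛₗ, map_inv₀,
    map_natCast, hpow]

end ExpApply

section BanachAlgebra

variable {A : Type*} [NormedRing A] [NormedAlgebra ℂ A]

/-- A complex normed algebra as a rational one: Mathlib states the rules of calculation with the
exponential for Banach algebras over `ℚ`. -/
abbrev ratNormedAlgebra : NormedAlgebra ℚ A := NormedAlgebra.restrictScalars ℚ ℂ A

attribute [local instance] ratNormedAlgebra

lemma hasDerivAt_of_map_add {f : ℂ → A} (hadd : ∀ s t, f (s + t) = f s * f t) {a : A}
    (ha : HasDerivAt f a 0) (t : ℂ) : HasDerivAt f (f t * a) t := by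
  have hshift : HasDerivAt (fun s ↦ f (s - t)) a t :=
    HasDerivAt.comp_sub_const t t (by simpa only [sub_self] using ha)
  refine (hshift.const_mul (f t)).congr_of_eventuallyEq (Eventually.of_forall fun s ↦ ?_)
  simp only [← hadd, add_sub_cancel]

variable [CompleteSpace A]

lemma exp_mul_exp_neg (x : A) : exp x * exp (-x) = 1 := by
  rw [← exp_add_of_commute (Commute.refl x).neg_right, add_neg_cancel, exp_zero]

lemma exp_neg_mul_exp (x : A) : exp (-x) * exp x = 1 := by
  simpa only [neg_neg] using exp_mul_exp_neg (-x)

/-- The exponential with values in the group of units, so that `exp (-x)` is its inverse. -/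
def expUnit (x : A) : Aˣ := ⟨exp x, exp (-x), exp_mul_exp_neg x, exp_neg_mul_exp x⟩

@[simp] lemma val_expUnit (x : A) : (expUnit x : A) = exp x := rfl

lemma exp_add_self (x : A) : exp (x + x) = exp x * exp x :=
  exp_add_of_commute (Commute.refl x)

lemma eq_exp_smul_of_map_add {f : ℂ → A} (hadd : ∀ s t, f (s + t) = f s * f t) (h0 : f 0 = 1)
    {a : A} (ha : HasDerivAt f a 0) (t : ℂ) : f t = exp (t • a) := by
  have hderiv (t : ℂ) : HasDerivAt (fun s ↦ f s * exp (s • -a)) 0 t := by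
    refine ((hasDerivAt_of_map_add hadd ha t).mul
      (hasDerivAt_exp_smul_const' (-a) t)).congr_deriv ?_
    noncomm_ring
  have hconst : f t * exp (t • -a) = 1 := by
    simpa only [h0, zero_smul, exp_zero, mul_one] using is_const_of_deriv_eq_zero
      (fun t ↦ (hderiv t).differentiableAt) (fun t ↦ (hderiv t).deriv) t 0
  calc f t = f t * (exp (t • -a) * exp (t • a)) := by rw [smul_neg, exp_neg_mul_exp, mul_one]
    _ = exp (t • a) := by rw [← mul_assoc, hconst, one_mul]

end BanachAlgebra

attribute [local instance] ratNormedAlgebra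

section CStarAlgebra

variable {A : Type*} [CStarAlgebra A]

lemma isSelfAdjoint_conj {p a : A} (hp : IsSelfAdjoint p) (ha : IsSelfAdjoint a) :
    IsSelfAdjoint (p * a * p) := by
  simpa only [hp.star_eq] using ha.conjugate p

lemma exp_unitary_conj {v : A} (hv : v ∈ unitary A) (x : A) :
    exp (v * x * star v) = v * exp x * star v :=
  exp_units_conj (Unitary.toUnits ⟨v, hv⟩) x

variable [PartialOrder A] [StarOrderedRing A]

lemma norm_le_iff_mem_Icc_algebraMap {a : A} (ha : IsSelfAdjoint a) {δ : ℝ} (hδ : 0 ≤ δ) :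
    ‖a‖ ≤ δ ↔ -algebraMap ℝ A δ ≤ a ∧ a ≤ algebraMap ℝ A δ := by
  refine ⟨fun h ↦ ⟨?_, ?_⟩, fun ⟨h₁, h₂⟩ ↦ ?_⟩
  · exact (neg_le_neg (algebraMap_mono A h)).trans ha.neg_algebraMap_norm_le_self
  · exact ha.le_algebraMap_norm_self.trans (algebraMap_mono A h)
  · rw [← map_neg, algebraMap_le_iff_le_spectrum] at h₁
    rw [le_algebraMap_iff_spectrum_le] at h₂
    rw [← cfc_id ℝ a]
    exact norm_cfc_le hδ fun x hx ↦ abs_le.mpr ⟨h₁ x hx, h₂ x hx⟩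

lemma norm_sub_one_le_iff {a : A} (ha : IsSelfAdjoint a) {δ : ℝ} (hδ : 0 ≤ δ) :
    ‖a - 1‖ ≤ δ ↔ (1 - δ) • 1 ≤ a ∧ a ≤ (1 + δ) • (1 : A) := by
  rw [norm_le_iff_mem_Icc_algebraMap (ha.sub (IsSelfAdjoint.one A)) hδ, neg_le_sub_iff_le_add,
    sub_le_iff_le_add', Algebra.algebraMap_eq_smul_one, sub_smul, add_smul, one_smul,
    sub_le_iff_le_add]

lemma isStrictlyPositive_exp {S : A} (hS : IsSelfAdjoint S) : IsStrictlyPositive (exp S) :=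
  (isUnit_exp S).isStrictlyPositive hS.exp_nonneg

lemma sqrt_smul_exp_add_self {T : A} (hT : IsSelfAdjoint T) {c : ℝ} (hc : 0 ≤ c) :
    CFC.sqrt (c • exp (T + T)) = √c • exp T := by
  refine CFC.sqrt_unique ?_ (smul_nonneg (Real.sqrt_nonneg c) hT.exp_nonneg)
  rw [smul_mul_smul_comm, Real.mul_self_sqrt hc, exp_add_self]

section

variable {S R : A} {δ : ℝ} (hS : IsSelfAdjoint S) (hR : IsSelfAdjoint R) (hδ₀ : 0 ≤ δ)
  (h : ‖exp S * exp (R + R) * exp S - 1‖ ≤ δ)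

include hS hR hδ₀ h

lemma exp_add_self_mem_Icc_of_norm_le :
    (1 - δ) • exp (-S + -S) ≤ exp (R + R) ∧ exp (R + R) ≤ (1 + δ) • exp (-S + -S) := by
  have hsandwich := (norm_sub_one_le_iff (isSelfAdjoint_conj hS.exp (hR.add hR).exp) hδ₀).mp h
  have hcancel : exp (-S) * (exp S * exp (R + R) * exp S) * exp (-S) = exp (R + R) := by
    calc _ = (exp (-S) * exp S) * exp (R + R) * (exp S * exp (-S)) := by noncomm_ring
      _ = _ := by rw [exp_neg_mul_exp, exp_mul_exp_neg, one_mul, mul_one]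
  have hconj (c : ℝ) : exp (-S) * (c • 1) * exp (-S) = c • exp (-S + -S) := by
    rw [mul_smul_comm, mul_one, smul_mul_assoc, exp_add_self]
  have hlower := hS.neg.exp.conjugate_le_conjugate hsandwich.1
  have hupper := hS.neg.exp.conjugate_le_conjugate hsandwich.2
  rw [hcancel, hconj] at hlower hupper
  exact ⟨hlower, hupper⟩

-- The logarithm is operator monotone.
lemma norm_add_le_of_norm_exp_conj_sub_one_le (hδ₁ : δ < 1) :
    ‖R + S‖ ≤ -Real.log (1 - δ) / 2 := by
  obtain ⟨hlower, hupper⟩ := exp_add_self_mem_Icc_of_norm_le hS hR hδ₀ h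
  have hpos : IsStrictlyPositive (exp (-S + -S)) := isStrictlyPositive_exp (hS.neg.add hS.neg)
  have hsub : 0 < 1 - δ := by linarith
  have hadd : 0 < 1 + δ := by linarith
  have hlog : Real.log (1 + δ) ≤ -Real.log (1 - δ) := by
    rw [← Real.log_inv]
    refine Real.log_le_log hadd ?_
    rw [le_inv_comm₀ hadd hsub, ← one_div, le_div_iff₀ hadd]
    nlinarith
  have hlog₀ : 0 ≤ -Real.log (1 - δ) := (Real.log_nonneg (by linarith)).trans hlog
  replace hlower := CFC.log_le_log hlower (hpos.smul hsub)
  replace hupper := CFC.log_le_log hupper (isStrictlyPositive_exp (hR.add hR))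
  rw [CFC.log_smul' _ hsub hpos, CFC.log_exp _ (hS.neg.add hS.neg),
    CFC.log_exp _ (hR.add hR)] at hlower
  rw [CFC.log_smul' _ hadd hpos, CFC.log_exp _ (hS.neg.add hS.neg),
    CFC.log_exp _ (hR.add hR)] at hupper
  have hdouble : ‖R + S + (R + S)‖ ≤ -Real.log (1 - δ) := by
    rw [norm_le_iff_mem_Icc_algebraMap ((hR.add hS).add (hR.add hS)) hlog₀, map_neg, neg_neg]
    constructor
    · calc algebraMap ℝ A (Real.log (1 - δ))
          = algebraMap ℝ A (Real.log (1 - δ)) + (-S + -S) + (S + S) := by abel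
        _ ≤ R + R + (S + S) := by gcongr
        _ = R + S + (R + S) := by abel
    · calc R + S + (R + S) = R + R + (S + S) := by abel
        _ ≤ algebraMap ℝ A (Real.log (1 + δ)) + (-S + -S) + (S + S) := by gcongr
        _ = algebraMap ℝ A (Real.log (1 + δ)) := by abel
        _ ≤ -algebraMap ℝ A (Real.log (1 - δ)) := by
          rw [← map_neg]; exact algebraMap_mono A hlog
  rw [← two_smul ℝ, norm_smul, Real.norm_ofNat] at hdouble
  linarith

-- The square root is operator monotone.
lemma norm_exp_half_conj_sub_one_le (hδ₁ : δ < 1) {T : A} (hT : IsSelfAdjoint T)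
    (hTS : T + T = S) : ‖exp T * exp R * exp T - 1‖ ≤ δ := by
  obtain ⟨hlower, hupper⟩ := exp_add_self_mem_Icc_of_norm_le hS hR hδ₀ h
  replace hlower := CFC.sqrt_le_sqrt _ _ hlower
  replace hupper := CFC.sqrt_le_sqrt _ _ hupper
  have hsqrtR : CFC.sqrt (exp (R + R)) = exp R := by
    simpa only [one_smul, Real.sqrt_one] using sqrt_smul_exp_add_self hR zero_le_one
  rw [sqrt_smul_exp_add_self hS.neg (by linarith), hsqrtR] at hlower hupper
  have hcancel : exp T * exp (-S) * exp T = 1 := by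
    rw [← hTS, neg_add, exp_add_self]
    calc _ = (exp T * exp (-T)) * (exp (-T) * exp T) := by noncomm_ring
      _ = 1 := by rw [exp_mul_exp_neg, exp_neg_mul_exp, one_mul]
  replace hlower := hT.exp.conjugate_le_conjugate hlower
  replace hupper := hT.exp.conjugate_le_conjugate hupper
  rw [mul_smul_comm, smul_mul_assoc, hcancel] at hlower hupper
  have hsqrt_sub : 1 - δ ≤ √(1 - δ) := Real.le_sqrt_of_sq_le (by nlinarith)
  have hsqrt_add : √(1 + δ) ≤ 1 + δ := (Real.sqrt_le_left (by linarith)).mpr (by nlinarith)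
  refine (norm_sub_one_le_iff (isSelfAdjoint_conj hT.exp hR.exp) hδ₀).mpr
    ⟨le_trans ?_ hlower, hupper.trans ?_⟩
  · exact smul_le_smul_of_nonneg_right hsqrt_sub zero_le_one
  · exact smul_le_smul_of_nonneg_right hsqrt_add zero_le_one

end

lemma tendsto_add_of_tendsto_exp_conj {ι : Type*} {l : Filter ι} {S R : ι → A}
    (hS : ∀ i, IsSelfAdjoint (S i)) (hR : ∀ i, IsSelfAdjoint (R i))
    (h : Tendsto (fun i ↦ exp (S i) * exp (R i + R i) * exp (S i)) l (𝓝 1)) :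
    Tendsto (fun i ↦ R i + S i) l (𝓝 0) := by
  have hδ := tendsto_iff_norm_sub_tendsto_zero.mp h
  have hlog : ContinuousAt (fun x : ℝ ↦ -Real.log (1 - x) / 2) 0 := by
    have : (1 : ℝ) - 0 ≠ 0 := by norm_num
    fun_prop (disch := assumption)
  have hbound := hlog.tendsto.comp hδ
  simp only [sub_zero, Real.log_one, neg_zero, zero_div] at hbound
  refine tendsto_zero_iff_norm_tendsto_zero.mpr
    (squeeze_zero' (Eventually.of_forall fun i ↦ norm_nonneg _) ?_ hbound)
  filter_upwards [hδ.eventually (gt_mem_nhds zero_lt_one)] with i hi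
  exact norm_add_le_of_norm_exp_conj_sub_one_le (hS i) (hR i) (norm_nonneg _) le_rfl hi

lemma tendsto_exp_half_conj {ι : Type*} {l : Filter ι} {T R : ι → A}
    (hT : ∀ i, IsSelfAdjoint (T i)) (hR : ∀ i, IsSelfAdjoint (R i))
    (h : Tendsto (fun i ↦ exp (T i + T i) * exp (R i + R i) * exp (T i + T i)) l (𝓝 1)) :
    Tendsto (fun i ↦ exp (T i) * exp (R i) * exp (T i)) l (𝓝 1) := by
  have hδ := tendsto_iff_norm_sub_tendsto_zero.mp h
  refine tendsto_iff_norm_sub_tendsto_zero.mpr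
    (squeeze_zero' (Eventually.of_forall fun i ↦ norm_nonneg _) ?_ hδ)
  filter_upwards [hδ.eventually (gt_mem_nhds zero_lt_one)] with i hi
  exact norm_exp_half_conj_sub_one_le ((hT i).add (hT i)) (hR i) (norm_nonneg _) le_rfl hi
    (hT i) rfl

end CStarAlgebra

section Hilbert

variable {H : Type*} [NormedAddCommGroup H] [InnerProductSpace ℂ H] [FiniteDimensional ℂ H]

section Trace

/-- The trace of operators on a finite-dimensional Hilbert space, as a continuous functional. -/
def traceL : (H →L[ℂ] H) →L[ℂ] ℂ :=
  LinearMap.toContinuousLinearMap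
    (LinearMap.trace ℂ H ∘ₗ (ContinuousLinearMap.coeLM ℂ : (H →L[ℂ] H) →ₗ[ℂ] (H →ₗ[ℂ] H)))

lemma traceL_mul_comm (X Y : H →L[ℂ] H) : traceL (X * Y) = traceL (Y * X) :=
  LinearMap.trace_mul_comm ℂ (X : H →ₗ[ℂ] H) (Y : H →ₗ[ℂ] H)

lemma traceL_eq_sum_inner {ι : Type*} [Fintype ι] (X : H →L[ℂ] H) (b : OrthonormalBasis ι ℂ H) :
    traceL X = ∑ i, inner ℂ (b i) (X (b i)) :=
  LinearMap.trace_eq_sum_inner _ b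

lemma traceL_star (X : H →L[ℂ] H) : traceL (star X) = (starRingEnd ℂ) (traceL X) := by
  simp only [traceL_eq_sum_inner _ (stdOrthonormalBasis ℂ H), map_sum, inner_conj_symm,
    ContinuousLinearMap.star_eq_adjoint, ContinuousLinearMap.adjoint_inner_right]

lemma re_traceL_mul_star {ι : Type*} [Fintype ι] (X : H →L[ℂ] H) (b : OrthonormalBasis ι ℂ H) :
    (traceL (X * star X)).re = ∑ i, ‖star X (b i)‖ ^ 2 := by
  rw [traceL_eq_sum_inner _ b, Complex.re_sum]
  refine Finset.sum_congr rfl fun i _ ↦ ?_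
  have hadj : inner ℂ (b i) ((X * star X) (b i)) = inner ℂ (star X (b i)) (star X (b i)) := by
    rw [ContinuousLinearMap.star_eq_adjoint, ContinuousLinearMap.adjoint_inner_left]
    rfl
  rw [hadj, inner_self_eq_norm_sq_to_K]
  norm_cast

lemma norm_le_finrank_mul_sqrt_re_traceL (X : H →L[ℂ] H) :
    ‖X‖ ≤ Module.finrank ℂ H * √(traceL (X * star X)).re := by
  set b := stdOrthonormalBasis ℂ H
  have hb (i) : ‖star X (b i)‖ ≤ √(traceL (X * star X)).re := by
    refine Real.le_sqrt_of_sq_le ?_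
    rw [re_traceL_mul_star X b]
    exact Finset.single_le_sum (f := fun i ↦ ‖star X (b i)‖ ^ 2) (fun i _ ↦ sq_nonneg _)
      (Finset.mem_univ i)
  rw [← norm_star]
  refine ContinuousLinearMap.opNorm_le_bound _ (by positivity) fun x ↦ ?_
  calc ‖star X x‖ = ‖∑ i, inner ℂ (b i) x • star X (b i)‖ := by
        conv_lhs => rw [← b.sum_repr' x]
        simp only [map_sum, map_smul]
    _ ≤ ∑ i, ‖inner ℂ (b i) x • star X (b i)‖ := norm_sum_le _ _
    _ ≤ ∑ _i : Fin (Module.finrank ℂ H), ‖x‖ * √(traceL (X * star X)).re := by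
        refine Finset.sum_le_sum fun i _ ↦ ?_
        rw [norm_smul]
        have hinner := norm_inner_le_norm (𝕜 := ℂ) (b i) x
        rw [b.orthonormal.norm_eq_one, one_mul] at hinner
        exact mul_le_mul hinner (hb i) (norm_nonneg _) (norm_nonneg _)
    _ = Module.finrank ℂ H * √(traceL (X * star X)).re * ‖x‖ := by
        rw [Finset.sum_const, Finset.card_univ, Fintype.card_fin, nsmul_eq_mul]
        ring

variable {ι : Type*} {l : Filter ι}

lemma tendsto_zero_of_tendsto_traceL {X : ι → H →L[ℂ] H}
    (h : Tendsto (fun i ↦ traceL (X i * star (X i))) l (𝓝 0)) : Tendsto X l (𝓝 0) := by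
  have hbound := ((Real.continuous_sqrt.comp Complex.continuous_re).tendsto 0 |>.comp h).const_mul
    (Module.finrank ℂ H : ℝ)
  simp only [Function.comp_apply, Complex.zero_re, Real.sqrt_zero, mul_zero] at hbound
  exact squeeze_zero_norm (fun i ↦ norm_le_finrank_mul_sqrt_re_traceL (X i)) hbound

lemma tendsto_one_of_tendsto_mul_star {w : ι → H →L[ℂ] H}
    (hw : Tendsto (fun i ↦ w i * star (w i)) l (𝓝 1))
    (htr : Tendsto (fun i ↦ traceL (w i)) l (𝓝 (traceL (1 : H →L[ℂ] H)))) : Tendsto w l (𝓝 1) := by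
  have hexpand (i) : traceL ((w i - 1) * star (w i - 1)) =
      traceL (w i * star (w i)) - traceL (w i) - starRingEnd ℂ (traceL (w i)) +
        traceL (1 : H →L[ℂ] H) := by
    rw [← traceL_star, ← map_sub, ← map_sub, ← map_add, star_sub, star_one]
    congr 1
    noncomm_ring
  have hlim := ((((traceL.continuous.tendsto 1).comp hw).sub htr).sub
    ((Complex.continuous_conj.tendsto _).comp htr)).add_const (traceL (1 : H →L[ℂ] H))
  rw [← traceL_star, star_one, sub_self, zero_sub, neg_add_cancel] at hlim
  refine tendsto_sub_nhds_zero_iff.mp (tendsto_zero_of_tendsto_traceL ?_)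
  simpa only [hexpand, Function.comp_apply] using hlim

end Trace

section Limits

variable {ι : Type*} {l : Filter ι} {S : ι → H →L[ℂ] H}

-- The operator `exp S * exp R` is conjugate to `exp (S / 2) * exp R * exp (S / 2)`, so its trace
-- tends to the trace of `1`.
lemma tendsto_exp_mul_exp {R : ι → H →L[ℂ] H} (hS : ∀ i, IsSelfAdjoint (S i))
    (hR : ∀ i, IsSelfAdjoint (R i))
    (h : Tendsto (fun i ↦ exp (S i) * exp (R i + R i) * exp (S i)) l (𝓝 1)) :
    Tendsto (fun i ↦ exp (S i) * exp (R i)) l (𝓝 1) := by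
  obtain ⟨T, hT, hTS⟩ : ∃ T : ι → H →L[ℂ] H, (∀ i, IsSelfAdjoint (T i)) ∧ ∀ i, T i + T i = S i :=
    ⟨fun i ↦ (2⁻¹ : ℝ) • S i, fun i ↦ (IsSelfAdjoint.all _).smul (hS i), fun i ↦ by module⟩
  have hhalf : Tendsto (fun i ↦ exp (T i) * exp (R i) * exp (T i)) l (𝓝 1) :=
    tendsto_exp_half_conj hT hR (by simpa only [hTS] using h)
  refine tendsto_one_of_tendsto_mul_star (h.congr fun i ↦ ?_)
    (((traceL.continuous.tendsto 1).comp hhalf).congr fun i ↦ ?_)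
  · rw [star_mul, (hS i).exp.star_eq, (hR i).exp.star_eq, exp_add_self]
    noncomm_ring
  · rw [Function.comp_apply, traceL_mul_comm, ← mul_assoc, ← exp_add_self, hTS]

variable {u : ι → H →L[ℂ] H} {u₀ : H →L[ℂ] H}

lemma tendsto_exp_conj_of_tendsto_exp_unitary_exp (hS : ∀ i, IsSelfAdjoint (S i))
    (hu : ∀ i, u i ∈ unitary (H →L[ℂ] H)) (hu₀ : u₀ ∈ unitary (H →L[ℂ] H))
    (h : Tendsto (fun i ↦ exp (S i) * u i * exp (S i)) l (𝓝 u₀)) :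
    Tendsto (fun i ↦ exp (S i) * exp (u i * S i * star (u i) + u i * S i * star (u i)) *
      exp (S i)) l (𝓝 1) := by
  have hlim := h.mul ((continuous_star.tendsto _).comp h)
  rw [Unitary.mul_star_self_of_mem hu₀] at hlim
  refine hlim.congr fun i ↦ ?_
  rw [← add_mul, ← mul_add, exp_unitary_conj (hu i), exp_add_self]
  simp only [Function.comp_apply, star_mul, (hS i).exp.star_eq]
  noncomm_ring

lemma tendsto_of_tendsto_exp_unitary_exp (hS : ∀ i, IsSelfAdjoint (S i))
    (hu : ∀ i, u i ∈ unitary (H →L[ℂ] H)) (hu₀ : u₀ ∈ unitary (H →L[ℂ] H))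
    (h : Tendsto (fun i ↦ exp (S i) * u i * exp (S i)) l (𝓝 u₀)) :
    Tendsto u l (𝓝 u₀) ∧ Tendsto (fun i ↦ u i * S i * star (u i) + S i) l (𝓝 0) := by
  have hR (i) : IsSelfAdjoint (u i * S i * star (u i)) := (hS i).conjugate _
  have hconj := tendsto_exp_conj_of_tendsto_exp_unitary_exp hS hu hu₀ h
  refine ⟨?_, tendsto_add_of_tendsto_exp_conj hS hR hconj⟩
  have hfactor (i) : exp (S i) * u i * exp (S i) =
      exp (S i) * exp (u i * S i * star (u i)) * u i := by
    rw [exp_unitary_conj (hu i)]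
    simp only [mul_assoc, Unitary.star_mul_self_of_mem (hu i), mul_one]
  have hsub : Tendsto (fun i ↦ exp (S i) * u i * exp (S i) - u i) l (𝓝 0) := by
    refine squeeze_zero_norm (fun i ↦ ?_)
      (tendsto_iff_norm_sub_tendsto_zero.mp (tendsto_exp_mul_exp hS hR hconj))
    rw [hfactor, ← sub_one_mul, CStarRing.norm_mul_mem_unitary _ (hu i)]
  simpa only [sub_sub_cancel, sub_zero] using h.sub hsub

end Limits

end Hilbert

section Hilbert

variable {H : Type*} [NormedAddCommGroup H] [InnerProductSpace ℂ H]

section Units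

variable (a : (H →L[ℂ] H)ˣ) (X : H)

lemma unit_apply_inv_apply : (a : H →L[ℂ] H) ((↑a⁻¹ : H →L[ℂ] H) X) = X :=
  congrArg (fun b : H →L[ℂ] H ↦ b X) a.mul_inv

lemma unit_inv_apply_apply : (↑a⁻¹ : H →L[ℂ] H) ((a : H →L[ℂ] H) X) = X :=
  congrArg (fun b : H →L[ℂ] H ↦ b X) a.inv_mul

variable {a} in
lemma commute_unit_inv {τ : H → H} (h : Function.Commute (a : H →L[ℂ] H) τ) :
    Function.Commute (↑a⁻¹ : H →L[ℂ] H) τ :=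
  Function.Semiconj.inverse_left h (unit_inv_apply_apply a) (unit_apply_inv_apply a)

end Units

/-- `a` is an endomorphism of the algebra with multiplication `(X, Y) ↦ L X Y`. -/
def IsBracketHom (L : H →ₗ[ℂ] (H →L[ℂ] H)) (a : H →L[ℂ] H) : Prop :=
  ∀ X Y, a (L X Y) = L (a X) (a Y)

variable {L : H →ₗ[ℂ] (H →L[ℂ] H)}

namespace IsBracketHom

variable {a b : H →L[ℂ] H}

lemma mul (ha : IsBracketHom L a) (hb : IsBracketHom L b) : IsBracketHom L (a * b) := fun X Y ↦ by
  simp only [mul_apply_eq_comp, hb X Y, ha (b X) (b Y)]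

lemma mul_L (ha : IsBracketHom L a) (X : H) : a * L X = L (a X) * a :=
  ContinuousLinearMap.ext (ha X)

lemma inv {a : (H →L[ℂ] H)ˣ} (ha : IsBracketHom L a) :
    IsBracketHom L (↑a⁻¹ : H →L[ℂ] H) := fun X Y ↦ by
  have h := congrArg (↑a⁻¹ : H →L[ℂ] H) (ha ((↑a⁻¹ : H →L[ℂ] H) X) ((↑a⁻¹ : H →L[ℂ] H) Y))
  rwa [unit_inv_apply_apply, unit_apply_inv_apply, unit_apply_inv_apply, eq_comm] at h

lemma conj_L {a : (H →L[ℂ] H)ˣ} (ha : IsBracketHom L a) (X : H) :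
    (a : H →L[ℂ] H) * L X * ↑a⁻¹ = L ((a : H →L[ℂ] H) X) := by
  rw [ha.mul_L, Units.mul_inv_cancel_right]

end IsBracketHom

variable [FiniteDimensional ℂ H]

section Eigenvectors

variable {S : H →L[ℂ] H} (hS : IsSelfAdjoint S)

include hS

lemma exists_eigenbasis :
    ∃ (b : OrthonormalBasis (Fin (Module.finrank ℂ H)) ℂ H) (μ : Fin (Module.finrank ℂ H) → ℝ),
      ∀ i, S (b i) = (μ i : ℂ) • b i :=
  have hsymm : (S : H →ₗ[ℂ] H).IsSymmetric :=
    ContinuousLinearMap.isSelfAdjoint_iff_isSymmetric.mp hS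
  ⟨hsymm.eigenvectorBasis rfl, hsymm.eigenvalues rfl, hsymm.apply_eigenvectorBasis rfl⟩

lemma apply_eq_smul_of_exp_apply {x : H} {r : ℝ} (h : exp S x = (Real.exp r : ℂ) • x) :
    S x = (r : ℂ) • x := by
  obtain ⟨b, μ, hb⟩ := exists_eigenbasis hS
  have hcoord {T : H →L[ℂ] H} {ν : Fin (Module.finrank ℂ H) → ℝ}
      (hT : ∀ i, T (b i) = (ν i : ℂ) • b i) (i) : b.repr (T x) i = (ν i : ℂ) * b.repr x i := by
    conv_lhs => rw [← b.sum_repr x]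
    simp [hT, -Complex.coe_smul, Pi.single_apply, mul_comm]
  have hexp (i) : exp S (b i) = (Real.exp (μ i) : ℂ) • b i := by
    rw [exp_apply_of_apply_eq_smul (hb i), Complex.ofReal_exp]
  refine b.repr.injective (PiLp.ext fun i ↦ ?_)
  have hi : (Real.exp (μ i) : ℂ) * b.repr x i = (Real.exp r : ℂ) * b.repr x i := by
    rw [← hcoord hexp, h, map_smul, PiLp.smul_apply, smul_eq_mul]
  rw [hcoord hb, map_smul, PiLp.smul_apply, smul_eq_mul]
  rcases eq_or_ne (b.repr x i) 0 with hx | hx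
  · rw [hx, mul_zero, mul_zero]
  · rw [Real.exp_injective (Complex.ofReal_injective (mul_right_cancel₀ hx hi))]

lemma commute_of_commute_exp {τ : H →ₛₗ[starRingEnd ℂ] H}
    (h : Function.Commute (exp S : H →L[ℂ] H) τ) :
    Function.Commute S τ := by
  obtain ⟨b, μ, hb⟩ := exists_eigenbasis hS
  suffices (S : H →ₗ[ℂ] H).comp τ = τ.comp (S : H →ₗ[ℂ] H) from LinearMap.congr_fun this
  refine b.toBasis.ext fun i ↦ ?_
  simp only [OrthonormalBasis.coe_toBasis, LinearMap.comp_apply, ContinuousLinearMap.coe_coe]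
  rw [hb, map_smulₛₗ, Complex.conj_ofReal]
  refine apply_eq_smul_of_exp_apply hS ?_
  rw [h, exp_apply_of_apply_eq_smul (hb i), map_smulₛₗ, ← Complex.ofReal_exp,
    Complex.conj_ofReal]

end Eigenvectors

/-- A complex semisimple Lie algebra on a Hilbert space `H`, given by its adjoint representation
`L`, with the conjugation `σ` over a real form and a Cartan involution `θ` commuting with it. That
the inner product is `-B(X, θ Y)`, for the Killing form `B`, is expressed by the formulas `star_L`
and `star_aut` for the adjoints of inner derivations and of automorphisms. -/
structure CartanData (L : H →ₗ[ℂ] (H →L[ℂ] H)) (σ θ : H →ₛₗ[starRingEnd ℂ] H) : Prop where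
  skew : ∀ X Y, L X Y = -L Y X
  lie : ∀ X Y, L (L X Y) = L X * L Y - L Y * L X
  injective : Function.Injective L
  inner_derivation : ∀ D : H →L[ℂ] H, (∀ X Y, D (L X Y) = L (D X) Y + L X (D Y)) → ∃ X, L X = D
  σ_invol : Function.Involutive σ
  θ_invol : Function.Involutive θ
  σ_θ : Function.Commute σ θ
  σ_lie : ∀ X Y, σ (L X Y) = L (σ X) (σ Y)
  θ_lie : ∀ X Y, θ (L X Y) = L (θ X) (θ Y)
  star_L : ∀ X, star (L X) = -L (θ X)
  star_aut : ∀ a : (H →L[ℂ] H)ˣ, IsBracketHom L a →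
    ∀ X, star (a : H →L[ℂ] H) X = θ ((↑a⁻¹ : H →L[ℂ] H) (θ X))

lemma exists_continuous_leftInverse {L : H →ₗ[ℂ] (H →L[ℂ] H)} (hL : Function.Injective L) :
    ∃ Λ : (H →L[ℂ] H) →L[ℂ] H, Function.LeftInverse Λ L := by
  obtain ⟨Λ, hΛ⟩ := L.exists_leftInverse_of_injective (LinearMap.ker_eq_bot.mpr hL)
  exact ⟨LinearMap.toContinuousLinearMap Λ, LinearMap.congr_fun hΛ⟩

lemma exp_mul_map_one {A : Type*} [NormedRing A] [NormedAlgebra ℂ A] [CompleteSpace A]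
    (φ : A →L[ℂ] A) (D : A) (hφ : ∀ a, φ (D * a) = D * φ a - φ a * D) :
    exp D * φ 1 = φ (exp D) * exp D := by
  have hderiv (t : ℂ) :
      HasDerivAt (fun t : ℂ ↦ exp (t • -D) * φ (exp (t • D)) * exp (t • D)) 0 t := by
    have hφexp : HasDerivAt (fun t : ℂ ↦ φ (exp (t • D))) (φ (D * exp (t • D))) t :=
      φ.hasFDerivAt.comp_hasDerivAt t (hasDerivAt_exp_smul_const' D t)
    refine (((hasDerivAt_exp_smul_const (-D) t).mul hφexp).mul
      (hasDerivAt_exp_smul_const' D t)).congr_deriv ?_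
    simp only [Pi.mul_apply, hφ]
    noncomm_ring
  have hconst := is_const_of_deriv_eq_zero (fun t ↦ (hderiv t).differentiableAt)
    (fun t ↦ (hderiv t).deriv) 1 0
  simp only [one_smul, zero_smul, exp_zero, one_mul, mul_one] at hconst
  rw [← hconst, ← mul_assoc, ← mul_assoc, exp_mul_exp_neg, one_mul]

variable {σ θ : H →ₛₗ[starRingEnd ℂ] H}

namespace CartanData

variable (C : CartanData L σ θ)

include C

lemma isBracketHom_exp (X : H) : IsBracketHom L (exp (L X)) := fun Y Z ↦ by
  let φ : (H →L[ℂ] H) →L[ℂ] (H →L[ℂ] H) :=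
    (LinearMap.toContinuousLinearMap L).comp (ContinuousLinearMap.apply ℂ H Y)
  exact congrArg (fun T : H →L[ℂ] H ↦ T Z) (exp_mul_map_one φ (L X) fun a ↦ C.lie X (a Y))

lemma commute_exp_σ {X : H} (hX : σ X = X) : Function.Commute (exp (L X) : H →L[ℂ] H) σ :=
  Function.Semiconj.commute (antilinear_exp fun Y ↦ by rw [C.σ_lie, hX])|>.symm

lemma commute_exp_θ {X : H} (hX : θ X = X) : Function.Commute (exp (L X) : H →L[ℂ] H) θ :=
  Function.Semiconj.commute (antilinear_exp fun Y ↦ by rw [C.θ_lie, hX])|>.symm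

lemma isSelfAdjoint {X : H} (hX : θ X = -X) : IsSelfAdjoint (L X) := by
  rw [isSelfAdjoint_iff, C.star_L, hX, map_neg, neg_neg]

end CartanData

lemma map_L_of_isBracketHom_exp {S : H →L[ℂ] H} (hS : IsSelfAdjoint S)
    (h : IsBracketHom L (exp S)) (X Y : H) : S (L X Y) = L (S X) Y + L X (S Y) := by
  obtain ⟨b, μ, hb⟩ := exists_eigenbasis hS
  have hbasis (i j) : S (L (b i) (b j)) = L (S (b i)) (b j) + L (b i) (S (b j)) := by
    rw [hb, hb, map_smul, map_smul, smul_apply, ← add_smul, ← Complex.ofReal_add]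
    refine apply_eq_smul_of_exp_apply hS ?_
    rw [h, exp_apply_of_apply_eq_smul (hb i), exp_apply_of_apply_eq_smul (hb j), map_smul,
      map_smul, smul_apply, smul_smul, Complex.ofReal_exp, Complex.ofReal_add,
      add_comm (μ i : ℂ), Complex.exp_add]
  have hleft (i) : S * L (b i) = L (S (b i)) + L (b i) * S :=
    ContinuousLinearMap.coe_injective (b.toBasis.ext fun j ↦ by simpa using hbasis i j)
  have hboth : (S : H →ₗ[ℂ] H) ∘ₗ ((ContinuousLinearMap.apply ℂ H Y : _ →ₗ[ℂ] H) ∘ₗ L) =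
      (ContinuousLinearMap.apply ℂ H Y : _ →ₗ[ℂ] H) ∘ₗ L ∘ₗ (S : H →ₗ[ℂ] H) +
        (ContinuousLinearMap.apply ℂ H (S Y) : _ →ₗ[ℂ] H) ∘ₗ L :=
    b.toBasis.ext fun i ↦ by simpa using congrArg (fun T : H →L[ℂ] H ↦ T Y) (hleft i)
  exact LinearMap.congr_fun hboth X

namespace CartanData

variable (C : CartanData L σ θ)

include C

lemma exists_L_eq_of_isBracketHom_exp {S : H →L[ℂ] H} (hS : IsSelfAdjoint S)
    (h : IsBracketHom L (exp S)) : ∃ X, L X = S ∧ θ X = -X := by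
  obtain ⟨X, hX⟩ := C.inner_derivation S (map_L_of_isBracketHom_exp hS h)
  refine ⟨X, hX, C.injective ?_⟩
  rw [map_neg, hX, ← neg_eq_iff_eq_neg, ← C.star_L, hX, hS.star_eq]

lemma σ_eq_of_commute_exp {X : H} (hX : θ X = -X) (h : Function.Commute (exp (L X) : H →L[ℂ] H) σ) :
    σ X = X := by
  refine C.injective (ContinuousLinearMap.ext fun Y ↦ ?_)
  have hcomm := commute_of_commute_exp (C.isSelfAdjoint hX) h (σ Y)
  rw [C.σ_lie, C.σ_invol] at hcomm
  exact hcomm.symm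

end CartanData

section Polar

/-- The logarithm of the positive part of an operator `a`, pulled back along a left inverse `Λ` of
the adjoint representation: the vector `η` in the polar decomposition `a = exp (L η) * k` of an
automorphism `a`. -/
def polarLog (Λ : (H →L[ℂ] H) →L[ℂ] H) (a : H →L[ℂ] H) : H :=
  Λ ((1 / 2 : ℝ) • CFC.log (a * star a))

lemma tendsto_polarLog (Λ : (H →L[ℂ] H) →L[ℂ] H) {a : H →L[ℂ] H} (ha : IsUnit a) {ι : Type*}
    {l : Filter ι} {f : ι → H →L[ℂ] H} (hf : ∀ i, IsUnit (f i)) (h : Tendsto f l (𝓝 a)) :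
    Tendsto (fun i ↦ polarLog Λ (f i)) l (𝓝 (polarLog Λ a)) := by
  have hlog := CFC.continuousOn_log (A := H →L[ℂ] H) (a * star a)
    ⟨IsSelfAdjoint.mul_star_self a, ha.mul ha.star⟩
  have hmem : Tendsto (fun i ↦ f i * star (f i)) l
      (𝓝[{b | IsSelfAdjoint b ∧ IsUnit b}] (a * star a)) :=
    tendsto_nhdsWithin_iff.mpr ⟨h.mul ((continuous_star.tendsto a).comp h),
      Eventually.of_forall fun i ↦ ⟨IsSelfAdjoint.mul_star_self _, (hf i).mul (hf i).star⟩⟩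
  exact (Λ.continuous.tendsto _).comp ((hlog.tendsto.comp hmem).const_smul (1 / 2 : ℝ))

/-- `k` is a unitary automorphism of the Lie algebra with involutions `(L, σ, θ)`. -/
structure IsUnitaryAut (L : H →ₗ[ℂ] (H →L[ℂ] H)) (σ θ : H →ₛₗ[starRingEnd ℂ] H)
    (k : H →L[ℂ] H) : Prop where
  mem_unitary : k ∈ unitary (H →L[ℂ] H)
  isBracketHom : IsBracketHom L k
  commute_σ : Function.Commute k σ
  commute_θ : Function.Commute k θ

namespace CartanData

variable (C : CartanData L σ θ) {Λ : (H →L[ℂ] H) →L[ℂ] H} (hΛ : Function.LeftInverse Λ L)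

include C

lemma isBracketHom_star {a : (H →L[ℂ] H)ˣ} (ha : IsBracketHom L a) :
    IsBracketHom L (star (a : H →L[ℂ] H)) := fun X Y ↦ by
  simp only [C.star_aut a ha, C.θ_lie, ha.inv _ _]

lemma commute_star_σ {a : (H →L[ℂ] H)ˣ} (ha : IsBracketHom L a)
    (haσ : Function.Commute (a : H →L[ℂ] H) σ) :
    Function.Commute (star (a : H →L[ℂ] H) : H →L[ℂ] H) σ := fun X ↦ by
  rw [C.star_aut a ha, C.star_aut a ha, ← C.σ_θ, commute_unit_inv haσ, C.σ_θ]

lemma exists_L_eq_log_mul_star {a : (H →L[ℂ] H)ˣ} (ha : IsBracketHom L a)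
    (haσ : Function.Commute (a : H →L[ℂ] H) σ) :
    ∃ X, σ X = X ∧ θ X = -X ∧ L X = CFC.log ((a : H →L[ℂ] H) * star (a : H →L[ℂ] H)) := by
  have hexp := CFC.exp_log _ ((a.isUnit.mul a.isUnit.star).isStrictlyPositive
    (mul_star_self_nonneg (a : H →L[ℂ] H)))
  obtain ⟨X, hX, hθX⟩ := C.exists_L_eq_of_isBracketHom_exp IsSelfAdjoint.log
    (by rw [hexp]; exact ha.mul (C.isBracketHom_star ha))
  refine ⟨X, C.σ_eq_of_commute_exp hθX ?_, hθX, hX⟩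
  rw [hX, hexp]
  exact haσ.comp_left (C.commute_star_σ ha haσ)

lemma commute_θ_of_mem_unitary {k : H →L[ℂ] H} (hk : k ∈ unitary (H →L[ℂ] H))
    (hL : IsBracketHom L k) : Function.Commute k θ := by
  let u : (H →L[ℂ] H)ˣ := Unitary.toUnits ⟨k, hk⟩
  have hinv (X : H) : (↑u⁻¹ : H →L[ℂ] H) X = θ ((↑u⁻¹ : H →L[ℂ] H) (θ X)) :=
    C.star_aut u hL X
  refine commute_unit_inv (a := u⁻¹) fun X ↦ ?_
  rw [hinv X, C.θ_invol]

include hΛ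

lemma polarLog_exp_mul {X : H} (hX : θ X = -X) {k : H →L[ℂ] H} (hk : k * star k = 1) :
    polarLog Λ (exp (L X) * k) = X := by
  have hS := C.isSelfAdjoint hX
  have hmul : exp (L X) * k * star (exp (L X) * k) = exp (L X + L X) := by
    rw [star_mul, hS.exp.star_eq, exp_add_self, mul_assoc, ← mul_assoc k, hk, one_mul]
  rw [polarLog, hmul, CFC.log_exp _ (hS.add hS), ← two_smul ℝ, smul_smul, one_div,
    inv_mul_cancel₀ two_ne_zero, one_smul, hΛ]

lemma polarLog_spec {a : (H →L[ℂ] H)ˣ} (ha : IsBracketHom L a)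
    (haσ : Function.Commute (a : H →L[ℂ] H) σ) :
    σ (polarLog Λ a) = polarLog Λ a ∧ θ (polarLog Λ a) = -polarLog Λ a ∧
      exp (L (polarLog Λ a) + L (polarLog Λ a)) = (a : H →L[ℂ] H) * star (a : H →L[ℂ] H) := by
  obtain ⟨X, hσX, hθX, hX⟩ := C.exists_L_eq_log_mul_star ha haσ
  have hη : polarLog Λ (a : H →L[ℂ] H) = ((1 / 2 : ℝ) : ℂ) • X := by
    rw [polarLog, ← hX, ← Complex.coe_smul, map_smul, hΛ]
  refine ⟨by rw [hη, map_smulₛₗ, Complex.conj_ofReal, hσX],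
    by rw [hη, map_smulₛₗ, Complex.conj_ofReal, hθX, smul_neg], ?_⟩
  rw [← map_add, hη, ← add_smul, ← Complex.ofReal_add, add_halves, Complex.ofReal_one, one_smul,
    hX]
  exact CFC.exp_log _ ((a.isUnit.mul a.isUnit.star).isStrictlyPositive (mul_star_self_nonneg _))

lemma isUnitaryAut_polar {a : (H →L[ℂ] H)ˣ} (ha : IsBracketHom L a)
    (haσ : Function.Commute (a : H →L[ℂ] H) σ) :
    IsUnitaryAut L σ θ (exp (-L (polarLog Λ a)) * a) := by
  obtain ⟨hση, hθη, hexp⟩ := C.polarLog_spec hΛ ha haσ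
  set η := polarLog Λ (a : H →L[ℂ] H)
  have hstar : exp (-L η) * a * star (exp (-L η) * a) = 1 := by
    rw [star_mul, (C.isSelfAdjoint hθη).neg.exp.star_eq]
    calc _ = exp (-L η) * (a * star (a : H →L[ℂ] H)) * exp (-L η) := by noncomm_ring
      _ = (exp (-L η) * exp (L η)) * (exp (L η) * exp (-L η)) := by
        rw [← hexp, exp_add_self]; noncomm_ring
      _ = 1 := by rw [exp_mul_exp_neg, exp_neg_mul_exp, one_mul]
  have hunit : IsUnit (exp (-L η) * a) := (isUnit_exp _).mul a.isUnit
  obtain ⟨b, hb⟩ := hunit.exists_left_inv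
  have hmem : exp (-L η) * a ∈ unitary (H →L[ℂ] H) :=
    Unitary.mem_iff.mpr ⟨left_inv_eq_right_inv hb hstar ▸ hb, hstar⟩
  have hnegη : IsBracketHom L (exp (-L η)) ∧ Function.Commute (exp (-L η) : H →L[ℂ] H) σ := by
    rw [← map_neg]
    exact ⟨C.isBracketHom_exp _, C.commute_exp_σ (by rw [map_neg, hση])⟩
  have hL := hnegη.1.mul ha
  exact ⟨hmem, hL, hnegη.2.comp_left haσ, C.commute_θ_of_mem_unitary hmem hL⟩

end CartanData

end Polar

end Hilbert

section CStarAlgebra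

variable {A : Type*} [CStarAlgebra A]

lemma expUnitary_mem_ball {x : selfAdjoint A} (hx : ‖x‖ < Real.pi) :
    selfAdjoint.expUnitary x ∈ Metric.ball (1 : unitary A) 2 :=
  Unitary.openPartialHomeomorph.map_target (mem_ball_zero_iff.mpr hx)

lemma tendsto_of_tendsto_expUnitary {ι : Type*} {l : Filter ι} {x : ι → selfAdjoint A}
    {x₀ : selfAdjoint A} (hx : ∀ i, ‖x i‖ < Real.pi) (hx₀ : ‖x₀‖ < Real.pi)
    (h : Tendsto (fun i ↦ selfAdjoint.expUnitary (x i)) l (𝓝 (selfAdjoint.expUnitary x₀))) :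
    Tendsto x l (𝓝 x₀) := by
  have harg := (Unitary.continuousOn_argSelfAdjoint.continuousAt
    (Metric.isOpen_ball.mem_nhds (expUnitary_mem_ball hx₀))).tendsto.comp h
  rw [argSelfAdjoint_expUnitary hx₀] at harg
  exact harg.congr fun i ↦ argSelfAdjoint_expUnitary (hx i)

lemma isUnit_add_one_of_norm_sub_one_lt {u : A} (hu : u ∈ unitary A) (h : ‖u - 1‖ < 2) :
    IsUnit (u + 1) := by
  have hspec := (Unitary.norm_sub_one_lt_two_iff hu).mp h
  rw [spectrum.notMem_iff, map_neg, map_one, ← IsUnit.neg_iff, neg_sub, sub_neg_eq_add] at hspec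
  exact hspec

end CStarAlgebra

section Operators

variable {V : Type*} [NormedAddCommGroup V] [NormedSpace ℂ V] {ι : Type*} {l : Filter ι}
  {T : ι → V →L[ℂ] V} {T₀ : V →L[ℂ] V} {x : ι → V} {x₀ : V}

lemma tendsto_clm_apply (hT : Tendsto T l (𝓝 T₀)) (hx : Tendsto x l (𝓝 x₀)) :
    Tendsto (fun i ↦ T i (x i)) l (𝓝 (T₀ x₀)) :=
  (isBoundedBilinearMap_apply (𝕜 := ℂ) (E := V) (F := V)).continuous.tendsto (T₀, x₀) |>.comp
    (hT.prodMk_nhds hx)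

lemma tendsto_zero_of_tendsto_clm_apply [CompleteSpace V]
    (hT₀ : IsUnit T₀) (hT : Tendsto T l (𝓝 T₀)) (h : Tendsto (fun i ↦ T i (x i)) l (𝓝 0)) :
    Tendsto x l (𝓝 0) := by
  obtain ⟨v, rfl⟩ := hT₀
  have hTinv : Tendsto (fun i ↦ Ring.inverse (T i)) l (𝓝 (Ring.inverse ↑v)) :=
    (NormedRing.inverse_continuousAt v).tendsto.comp hT
  have hinv := tendsto_clm_apply hTinv h
  rw [map_zero] at hinv
  refine hinv.congr' ?_
  filter_upwards [hT.eventually (Units.isOpen.mem_nhds v.isUnit)] with i hi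
  rw [← mul_apply_eq_comp, Ring.inverse_mul_cancel _ hi, one_apply_eq_self]

end Operators

section Hilbert

variable {H : Type*} [NormedAddCommGroup H] [InnerProductSpace ℂ H] [FiniteDimensional ℂ H]
  {L : H →ₗ[ℂ] (H →L[ℂ] H)} {σ θ : H →ₛₗ[starRingEnd ℂ] H}

lemma continuous_exp_L (L : H →ₗ[ℂ] (H →L[ℂ] H)) : Continuous fun X ↦ exp (L X) :=
  exp_continuous.comp L.continuous_of_finiteDimensional

lemma IsUnitaryAut.norm_L_apply {k : H →L[ℂ] H} (hk : IsUnitaryAut L σ θ k) (X : H) :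
    ‖L (k X)‖ = ‖L X‖ := by
  have hunit : L (k X) * k = k * L X := (hk.isBracketHom.mul_L X).symm
  rw [← CStarRing.norm_mul_mem_unitary (L (k X)) hk.mem_unitary, hunit,
    CStarRing.norm_mem_unitary_mul _ hk.mem_unitary]

variable (C : CartanData L σ θ)

namespace CartanData

/-- The self-adjoint operator `2 • L X`, for `X` in the `(-1)`-eigenspace of `θ`. -/
def twiceL {X : H} (hX : θ X = -X) : selfAdjoint (H →L[ℂ] H) :=
  ⟨(2 : ℝ) • L X, (IsSelfAdjoint.all _).smul (C.isSelfAdjoint hX)⟩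

lemma norm_twiceL_lt {X : H} (hX : θ X = -X) (h : ‖L X‖ < Real.pi / 2) :
    ‖C.twiceL hX‖ < Real.pi := by
  change ‖(2 : ℝ) • L X‖ < Real.pi
  rw [norm_smul, Real.norm_ofNat]
  linarith

lemma expUnitary_twiceL {X : H} (hX : θ X = -X) :
    (selfAdjoint.expUnitary (C.twiceL hX) : H →L[ℂ] H) = exp (L ((2 * Complex.I) • X)) := by
  have hsmul : Complex.I • (2 : ℝ) • L X = L ((2 * Complex.I) • X) := by
    rw [← Complex.coe_smul, smul_smul, map_smul, Complex.ofReal_ofNat, mul_comm]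
  rw [selfAdjoint.expUnitary_coe, ← hsmul, twiceL]

include C

lemma exp_two_I_mem_unitary {X : H} (hX : θ X = -X) :
    exp (L ((2 * Complex.I) • X)) ∈ unitary (H →L[ℂ] H) :=
  C.expUnitary_twiceL hX ▸ (selfAdjoint.expUnitary (C.twiceL hX)).2

variable {ι : Type*} {l : Filter ι} {η ξ : ι → H} {η₀ ξ₀ : H}

lemma tendsto_of_tendsto_exp_two_I (hξ : ∀ i, θ (ξ i) = -ξ i)
    (hξn : ∀ i, ‖L (ξ i)‖ < Real.pi / 2) (hξ₀ : θ ξ₀ = -ξ₀) (hξ₀n : ‖L ξ₀‖ < Real.pi / 2)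
    (h : Tendsto (fun i ↦ exp (L ((2 * Complex.I) • ξ i))) l
      (𝓝 (exp (L ((2 * Complex.I) • ξ₀))))) : Tendsto ξ l (𝓝 ξ₀) := by
  obtain ⟨Λ, hΛ⟩ := exists_continuous_leftInverse C.injective
  have hcancel (X : H) : Λ ((1 / 2 : ℝ) • (2 : ℝ) • L X) = X := by
    rw [smul_smul, one_div, inv_mul_cancel₀ two_ne_zero, one_smul, hΛ]
  rw [← C.expUnitary_twiceL hξ₀] at h
  simp only [← C.expUnitary_twiceL (hξ _)] at h
  have htwice := tendsto_of_tendsto_expUnitary (fun i ↦ C.norm_twiceL_lt (hξ i) (hξn i))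
    (C.norm_twiceL_lt hξ₀ hξ₀n) (tendsto_subtype_rng.mpr h)
  have hΛlim := (Λ.continuous.tendsto _).comp
    (((continuous_subtype_val.tendsto _).comp htwice).const_smul (1 / 2 : ℝ))
  simpa only [Function.comp_def, twiceL, hcancel] using hΛlim

lemma isUnit_exp_two_I_add_one {X : H} (hX : θ X = -X) (h : ‖L X‖ < Real.pi / 2) :
    IsUnit (exp (L ((2 * Complex.I) • X)) + 1) := by
  refine isUnit_add_one_of_norm_sub_one_lt (C.exp_two_I_mem_unitary hX) ?_
  have hball := expUnitary_mem_ball (C.norm_twiceL_lt hX h)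
  rwa [Metric.mem_ball, Subtype.dist_eq, dist_eq_norm, C.expUnitary_twiceL] at hball

lemma tendsto_of_tendsto_polar_base (hη : ∀ i, θ (η i) = -η i)
    (hξ : ∀ i, θ (ξ i) = -ξ i) (hξn : ∀ i, ‖L (ξ i)‖ < Real.pi / 2) (hξ₀ : θ ξ₀ = -ξ₀)
    (hξ₀n : ‖L ξ₀‖ < Real.pi / 2)
    (h : Tendsto (fun i ↦ exp (L (η i)) * exp (L ((2 * Complex.I) • ξ i)) * exp (L (η i))) l
      (𝓝 (exp (L ((2 * Complex.I) • ξ₀))))) : Tendsto η l (𝓝 0) ∧ Tendsto ξ l (𝓝 ξ₀) := by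
  obtain ⟨Λ, hΛ⟩ := exists_continuous_leftInverse C.injective
  have hunitary (i) := C.exp_two_I_mem_unitary (hξ i)
  obtain ⟨hu, hconj⟩ := tendsto_of_tendsto_exp_unitary_exp
    (fun i ↦ C.isSelfAdjoint (hη i)) hunitary (C.exp_two_I_mem_unitary hξ₀) h
  refine ⟨?_, C.tendsto_of_tendsto_exp_two_I hξ hξn hξ₀ hξ₀n hu⟩
  refine tendsto_zero_of_tendsto_clm_apply (C.isUnit_exp_two_I_add_one hξ₀ hξ₀n)
    (hu.add_const 1) ?_
  have hΛlim := (Λ.continuous.tendsto _).comp hconj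
  rw [map_zero] at hΛlim
  refine hΛlim.congr fun i ↦ ?_
  rw [Function.comp_apply, (C.isBracketHom_exp _).mul_L, mul_assoc,
    Unitary.mul_star_self_of_mem (hunitary i), mul_one, ← map_add, hΛ, add_apply,
    one_apply_eq_self]

lemma exists_exp_eq_exp_mul_exp_mul {X Y : H} (hσX : σ X = X) (hσY : σ Y = Y) :
    ∃ Z k, θ Z = -Z ∧ IsUnitaryAut L σ θ k ∧ exp (L Y) = exp (L X) * exp (L Z) * k := by
  obtain ⟨Λ, hΛ⟩ := exists_continuous_leftInverse C.injective
  let a : (H →L[ℂ] H)ˣ := expUnit (L (-X)) * expUnit (L Y)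
  have ha : IsBracketHom L a := (C.isBracketHom_exp (-X)).mul (C.isBracketHom_exp Y)
  have haσ : Function.Commute (a : H →L[ℂ] H) σ :=
    (C.commute_exp_σ (by rw [map_neg, hσX])).comp_left (C.commute_exp_σ hσY)
  refine ⟨polarLog Λ (a : H →L[ℂ] H), exp (-L (polarLog Λ (a : H →L[ℂ] H))) * a,
    (C.polarLog_spec hΛ ha haσ).2.1, C.isUnitaryAut_polar hΛ ha haσ, ?_⟩
  calc exp (L Y) = exp (L X) * exp (-L X) * exp (L Y) := by rw [exp_mul_exp_neg, one_mul]
    _ = exp (L X) * a := by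
      rw [Units.val_mul, val_expUnit, val_expUnit, map_neg, mul_assoc]
    _ = _ := by rw [mul_assoc, ← mul_assoc (exp (L (polarLog Λ _))), exp_mul_exp_neg, one_mul]

lemma exp_mul_exp_two_I_mul_exp {X Y Z ξ : H} {k : H →L[ℂ] H} (hX : θ X = -X) (hY : θ Y = -Y)
    (hZ : θ Z = -Z) (hk : IsUnitaryAut L σ θ k) (h : exp (L Y) = exp (L X) * exp (L Z) * k) :
    exp (L Y) * exp (L ((2 * Complex.I) • ξ)) * exp (L Y) =
      exp (L X) * (exp (L Z) * exp (L ((2 * Complex.I) • k ξ)) * exp (L Z)) * exp (L X) := by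
  have hstar : exp (L Y) = star k * exp (L Z) * exp (L X) := by
    rw [← (C.isSelfAdjoint hY).exp.star_eq, h, star_mul, star_mul,
      (C.isSelfAdjoint hX).exp.star_eq, (C.isSelfAdjoint hZ).exp.star_eq, mul_assoc]
  have hconj : L ((2 * Complex.I) • k ξ) = k * L ((2 * Complex.I) • ξ) * star k := by
    rw [hk.isBracketHom.mul_L, mul_assoc, Unitary.mul_star_self_of_mem hk.mem_unitary, mul_one,
      map_smul k]
  calc _ = exp (L X) * exp (L Z) * k * exp (L ((2 * Complex.I) • ξ)) *
        (star k * exp (L Z) * exp (L X)) := by rw [← h, ← hstar]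
    _ = _ := by
      rw [hconj, exp_unitary_conj hk.mem_unitary]
      noncomm_ring

lemma tendsto_of_exp_eq_exp_mul_exp_mul {Z : ι → H} {k : ι → H →L[ℂ] H}
    (hη : ∀ i, θ (η i) = -η i) (hη₀ : θ η₀ = -η₀) (hk : ∀ i, IsUnitaryAut L σ θ (k i))
    (h : ∀ i, exp (L (η i)) = exp (L η₀) * exp (L (Z i)) * k i) (hZ : Tendsto Z l (𝓝 0)) :
    Tendsto η l (𝓝 η₀) ∧ Tendsto k l (𝓝 1) := by
  obtain ⟨Λ, hΛ⟩ := exists_continuous_leftInverse C.injective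
  have hexp : Tendsto (fun i ↦ exp (L (Z i))) l (𝓝 1) := by
    simpa only [Function.comp_def, map_zero, exp_zero] using
      ((continuous_exp_L L).tendsto 0).comp hZ
  have hprod : Tendsto (fun i ↦ exp (L η₀) * exp (L (Z i))) l (𝓝 (exp (L η₀))) := by
    simpa only [mul_one] using hexp.const_mul (exp (L η₀))
  have hlog (i) : polarLog Λ (exp (L η₀) * exp (L (Z i))) = η i := by
    rw [← mul_one (exp (L η₀) * _), ← Unitary.mul_star_self_of_mem (hk i).mem_unitary, ← mul_assoc,
      ← h]
    exact C.polarLog_exp_mul hΛ (hη i)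
      (by rw [star_star, Unitary.star_mul_self_of_mem (hk i).mem_unitary])
  have hlog₀ : polarLog Λ (exp (L η₀)) = η₀ := by
    simpa only [mul_one] using C.polarLog_exp_mul hΛ hη₀ (k := 1) (by rw [star_one, one_mul])
  have hηlim : Tendsto η l (𝓝 η₀) := by
    simpa only [hlog, hlog₀] using tendsto_polarLog Λ (isUnit_exp (L η₀))
      (fun i ↦ (isUnit_exp (L η₀)).mul (isUnit_exp (L (Z i)))) hprod
  refine ⟨hηlim, ?_⟩
  have hkinv (i) : Ring.inverse (exp (L η₀) * exp (L (Z i))) * exp (L (η i)) = k i := by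
    rw [h, Ring.inverse_mul_cancel_left _ _ ((isUnit_exp _).mul (isUnit_exp _))]
  obtain ⟨v, hv⟩ := isUnit_exp (L η₀)
  have hinv := NormedRing.inverse_continuousAt v
  rw [hv] at hinv
  have hklim := (hinv.tendsto.comp hprod).mul (((continuous_exp_L L).tendsto η₀).comp hηlim)
  rw [Ring.inverse_mul_cancel _ (isUnit_exp _)] at hklim
  exact hklim.congr hkinv

lemma tendsto_of_tendsto_polar (hησ : ∀ i, σ (η i) = η i) (hη : ∀ i, θ (η i) = -η i)
    (hξ : ∀ i, θ (ξ i) = -ξ i) (hξn : ∀ i, ‖L (ξ i)‖ < Real.pi / 2)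
    (hη₀σ : σ η₀ = η₀) (hη₀ : θ η₀ = -η₀) (hξ₀ : θ ξ₀ = -ξ₀) (hξ₀n : ‖L ξ₀‖ < Real.pi / 2)
    (h : Tendsto (fun i ↦ exp (L (η i)) * exp (L ((2 * Complex.I) • ξ i)) * exp (L (η i))) l
      (𝓝 (exp (L η₀) * exp (L ((2 * Complex.I) • ξ₀)) * exp (L η₀)))) :
    Tendsto η l (𝓝 η₀) ∧ Tendsto ξ l (𝓝 ξ₀) := by
  choose Z k hZ hk hexp using fun i ↦ C.exists_exp_eq_exp_mul_exp_mul hη₀σ (hησ i)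
  have hcancel (T : H →L[ℂ] H) :
      exp (-L η₀) * (exp (L η₀) * T * exp (L η₀)) * exp (-L η₀) = T := by
    calc _ = exp (-L η₀) * exp (L η₀) * T * (exp (L η₀) * exp (-L η₀)) := by noncomm_ring
      _ = T := by rw [exp_neg_mul_exp, exp_mul_exp_neg, one_mul, mul_one]
  have hbase := (h.const_mul (exp (-L η₀))).mul_const (exp (-L η₀))
  simp only [C.exp_mul_exp_two_I_mul_exp hη₀ (hη _) (hZ _) (hk _) (hexp _), hcancel] at hbase
  obtain ⟨hZlim, hkξ⟩ := C.tendsto_of_tendsto_polar_base hZ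
    (fun i ↦ by rw [← (hk i).commute_θ, hξ, map_neg])
    (fun i ↦ by rw [(hk i).norm_L_apply]; exact hξn i) hξ₀ hξ₀n hbase
  obtain ⟨hηlim, hklim⟩ := C.tendsto_of_exp_eq_exp_mul_exp_mul hη hη₀ hk hexp hZlim
  refine ⟨hηlim, ?_⟩
  have hξlim := tendsto_clm_apply ((continuous_star.tendsto (1 : H →L[ℂ] H)).comp hklim) hkξ
  rw [star_one, one_apply_eq_self] at hξlim
  refine hξlim.congr fun i ↦ ?_
  rw [Function.comp_apply, ← mul_apply_eq_comp, Unitary.star_mul_self_of_mem (hk i).mem_unitary,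
    one_apply_eq_self]

end CartanData

end Hilbert

section Slice

variable {A : Type*} [NormedRing A] [NormedAlgebra ℂ A]
  {P : Type*} [NormedAddCommGroup P] [NormedSpace ℂ P]
  {F : Type*} [NormedAddCommGroup F] [NormedSpace ℂ F]
  {Φ : P → A} {p₀ : P} {e : (P × F) ≃L[ℂ] A}

lemma hasStrictFDerivAt_mul_one_add
    (hΦ : HasStrictFDerivAt Φ ((e : P × F →L[ℂ] A).comp (.inl ℂ P F)) p₀) (hp₀ : Φ p₀ = 1) :
    HasStrictFDerivAt (fun x : P × F ↦ Φ x.1 * (1 + e (0, x.2))) (e : P × F →L[ℂ] A) (p₀, 0) := by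
  let j : F →L[ℂ] A := (e : P × F →L[ℂ] A).comp (.inr ℂ P F)
  have hfst : HasStrictFDerivAt (fun x : P × F ↦ Φ x.1) _ (p₀, 0) :=
    HasStrictFDerivAt.comp (p₀, (0 : F)) (g := Φ) (f := Prod.fst) hΦ hasStrictFDerivAt_fst
  have hsnd : HasStrictFDerivAt (fun x : P × F ↦ 1 + e (0, x.2)) _ (p₀, 0) :=
    (j.comp (ContinuousLinearMap.snd ℂ P F)).hasStrictFDerivAt.const_add 1
  refine (hfst.mul' hsnd).congr_fderiv (ContinuousLinearMap.ext fun x ↦ ?_)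
  have hzero : e ((0 : P), (0 : F)) = 0 := map_zero e
  simp [hp₀, hzero, j, ← map_add, add_comm]

lemma exists_slice_inverse
    (hΦ : HasStrictFDerivAt Φ ((e : P × F →L[ℂ] A).comp (.inl ℂ P F)) p₀) (hp₀ : Φ p₀ = 1)
    [CompleteSpace P] [CompleteSpace F] :
    ∃ g : A → P × F, g 1 = (p₀, 0) ∧ HasFDerivAt g (e.symm : A →L[ℂ] P × F) 1 ∧
      (∀ᶠ p in 𝓝 p₀, g (Φ p) = (p, 0)) ∧
      (∀ᶠ a in 𝓝 1, Φ (g a).1 * (1 + e (0, (g a).2)) = a) ∧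
      (∀ᶠ a in 𝓝 1, ContinuousAt g a) := by
  let M (x : P × F) : A := Φ x.1 * (1 + e (0, x.2))
  have hM : HasStrictFDerivAt M (e : P × F →L[ℂ] A) (p₀, 0) :=
    hasStrictFDerivAt_mul_one_add hΦ hp₀
  have hM_zero (p : P) : M (p, 0) = Φ p := by
    change Φ p * (1 + e 0) = Φ p
    rw [map_zero, add_zero, mul_one]
  have hM_one : M (p₀, 0) = 1 := (hM_zero p₀).trans hp₀
  let g := hM.localInverse M e (p₀, 0)
  let hom := hM.toOpenPartialHomeomorph M
  have hg_one : g 1 = (p₀, 0) := hM_one ▸ hM.localInverse_apply_image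
  have hg_deriv : HasStrictFDerivAt g (e.symm : A →L[ℂ] P × F) 1 := hM_one ▸ hM.to_localInverse
  have hleft : Tendsto (fun p : P ↦ (p, (0 : F))) (𝓝 p₀) (𝓝 (p₀, 0)) :=
    (Continuous.prodMk_left (0 : F)).tendsto p₀
  have htarget : hom.target ∈ 𝓝 1 :=
    hom.open_target.mem_nhds (hM_one ▸ hM.image_mem_toOpenPartialHomeomorph_target)
  have hright : ∀ᶠ a in 𝓝 1, M (g a) = a := hM_one ▸ hM.eventually_right_inverse
  refine ⟨g, hg_one, hg_deriv.hasFDerivAt, ?_, hright, ?_⟩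
  · filter_upwards [hleft.eventually hM.eventually_left_inverse] with p hp
    rwa [hM_zero] at hp
  · filter_upwards [htarget] with a ha
    exact hom.continuousAt_symm ha

end Slice

lemma eventually_eq_zero_of_norm_le_mul_sq {V W Z : Type*} [NormedAddCommGroup V]
    [NormedSpace ℂ V] [FiniteDimensional ℂ V] [NormedAddCommGroup W] [NormedSpace ℂ W]
    [FiniteDimensional ℂ W] [NormedAddCommGroup Z] [NormedSpace ℂ Z] {δ : V →ₗ[ℂ] W →ₗ[ℂ] Z}
    (hδ : ∀ f, δ f = 0 → f = 0) {c : ℝ} (hc : 0 ≤ c) :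
    ∀ᶠ f in 𝓝 (0 : V), (∀ x, ‖δ f x‖ ≤ c * ‖f‖ ^ 2 * ‖x‖) → f = 0 := by
  let δ' : V →ₗ[ℂ] (W →L[ℂ] Z) := LinearMap.toContinuousLinearMap.toLinearMap ∘ₗ δ
  obtain ⟨K, -, hK⟩ := δ'.exists_antilipschitzWith <| LinearMap.ker_eq_bot'.mpr fun f hf ↦
    hδ f (LinearMap.toContinuousLinearMap.injective hf)
  have hlim : Tendsto (fun f : V ↦ K * c * ‖f‖) (𝓝 0) (𝓝 0) := by
    simpa only [norm_zero, mul_zero] using (continuous_norm.tendsto (0 : V)).const_mul (K * c)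
  filter_upwards [hlim.eventually (gt_mem_nhds one_pos)] with f hf hdefect
  by_contra hne
  refine lt_irrefl ‖f‖ ?_
  calc ‖f‖ ≤ K * ‖δ' f‖ := ZeroHomClass.bound_of_antilipschitz δ' hK f
    _ ≤ K * (c * ‖f‖ ^ 2) := by
      gcongr
      exact ContinuousLinearMap.opNorm_le_bound _ (by positivity) hdefect
    _ = K * c * ‖f‖ * ‖f‖ := by ring
    _ < 1 * ‖f‖ := mul_lt_mul_of_pos_right hf (norm_pos_iff.mpr hne)
    _ = ‖f‖ := one_mul _

section LocalInverse

variable {H : Type*} [NormedAddCommGroup H] [InnerProductSpace ℂ H]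
  {L : H →ₗ[ℂ] (H →L[ℂ] H)} {σ θ : H →ₛₗ[starRingEnd ℂ] H}

/-- `derivationDefect L f X = [f, L X] - L (f X)` vanishes for all `X` iff `f` is a derivation of
the algebra with multiplication `(X, Y) ↦ L X Y`. -/
def derivationDefect (L : H →ₗ[ℂ] (H →L[ℂ] H)) : (H →L[ℂ] H) →ₗ[ℂ] H →ₗ[ℂ] (H →L[ℂ] H) :=
  LinearMap.mk₂ ℂ (fun f X ↦ f * L X - L X * f - L (f X))
    (fun f f' X ↦ by simp only [add_mul, mul_add, add_apply, map_add]; abel)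
    (fun c f X ↦ by
      simp only [smul_mul_assoc, mul_smul_comm, smul_apply, map_smul, smul_sub])
    (fun f X X' ↦ by simp only [map_add, add_mul, mul_add]; abel)
    (fun c f X ↦ by simp only [map_smul, smul_mul_assoc, mul_smul_comm, smul_sub])

lemma IsBracketHom.derivationDefect_eq {f : H →L[ℂ] H} (hf : IsBracketHom L (1 + f)) (X : H) :
    derivationDefect L f X = L (f X) * f := by
  have h := hf.mul_L X
  rw [add_apply, one_apply_eq_self, map_add, add_mul, one_mul, mul_add, mul_one, add_mul] at h
  rw [derivationDefect, LinearMap.mk₂_apply, sub_sub, sub_eq_iff_eq_add, ← add_right_inj (L X), h]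
  abel

variable [FiniteDimensional ℂ H]

variable {T : Type*} [NormedAddCommGroup T] [NormedSpace ℂ T] (j : T →L[ℂ] (H →L[ℂ] H))

lemma IsBracketHom.norm_derivationDefect_le {t : T} (ht : IsBracketHom L (1 + j t)) (X : H) :
    ‖derivationDefect L (j t) X‖ ≤
      ‖LinearMap.toContinuousLinearMap L‖ * ‖j‖ ^ 2 * ‖t‖ ^ 2 * ‖X‖ := by
  have hjt : ‖j t‖ ≤ ‖j‖ * ‖t‖ := j.le_opNorm t
  calc _ = ‖L (j t X) * j t‖ := congrArg norm (ht.derivationDefect_eq X)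
    _ ≤ ‖L (j t X)‖ * ‖j t‖ := norm_mul_le _ _
    _ ≤ ‖LinearMap.toContinuousLinearMap L‖ * (‖j t‖ * ‖X‖) * ‖j t‖ := by
      gcongr
      exact ((LinearMap.toContinuousLinearMap L).le_opNorm _).trans
        (by gcongr; exact (j t).le_opNorm X)
    _ ≤ ‖LinearMap.toContinuousLinearMap L‖ * (‖j‖ * ‖t‖ * ‖X‖) * (‖j‖ * ‖t‖) := by gcongr
    _ = _ := by ring

variable (C : CartanData L σ θ)

namespace CartanData

include C

lemma exists_L_eq_of_derivationDefect_eq_zero {f : H →L[ℂ] H} (hf : derivationDefect L f = 0) :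
    ∃ X, L X = f := by
  refine C.inner_derivation f fun X Y ↦ ?_
  have h : f (L X Y) - L X (f Y) - L (f X) Y = 0 :=
    congrArg (fun T : H →L[ℂ] H ↦ T Y) (LinearMap.congr_fun hf X)
  rw [sub_sub, sub_eq_zero, add_comm] at h
  exact h

lemma eventually_eq_zero_of_isBracketHom_one_add [FiniteDimensional ℂ T]
    (hj : ∀ t X, L X = j t → t = 0) :
    ∀ᶠ t in 𝓝 (0 : T), IsBracketHom L (1 + j t) → t = 0 := by
  have hinj (t) (ht : (derivationDefect L ∘ₗ (j : T →ₗ[ℂ] (H →L[ℂ] H))) t = 0) : t = 0 := by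
    obtain ⟨X, hX⟩ := C.exists_L_eq_of_derivationDefect_eq_zero ht
    exact hj t X hX
  exact (eventually_eq_zero_of_norm_le_mul_sq hinj (by positivity)).mono
    fun t h ht ↦ h (ht.norm_derivationDefect_le j)

end CartanData

variable {P : Type*} [NormedAddCommGroup P] [NormedSpace ℂ P] (e : P ≃L[ℂ] H)
  {Φ : P → H →L[ℂ] H} {p₀ : P}

lemma exists_prod_equiv (hL : Function.Injective L) :
    ∃ (n : ℕ) (j : (Fin n → ℂ) →L[ℂ] (H →L[ℂ] H)) (ε : (P × (Fin n → ℂ)) ≃L[ℂ] (H →L[ℂ] H)),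
      ∀ p t, ε (p, t) = L (e p) + j t := by
  have : FiniteDimensional ℂ P := Module.Finite.equiv e.symm.toLinearEquiv
  obtain ⟨F, hF⟩ := Submodule.exists_isCompl (LinearMap.range L)
  let b := Module.finBasis ℂ F
  let ε := ((e.toLinearEquiv.trans (LinearEquiv.ofInjective L hL)).prodCongr
    b.equivFun.symm).trans (Submodule.prodEquivOfIsCompl _ F hF)
  exact ⟨_, LinearMap.toContinuousLinearMap (F.subtype ∘ₗ b.equivFun.symm.toLinearMap),
    ε.toContinuousLinearEquiv, fun p t ↦ rfl⟩

namespace CartanData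

include C

lemma exists_local_inverse
    (hΦ : HasStrictFDerivAt Φ ((LinearMap.toContinuousLinearMap L).comp (e : P →L[ℂ] H)) p₀)
    (hp₀ : Φ p₀ = 1) (haut : ∀ᶠ p in 𝓝 p₀, IsBracketHom L (Φ p)) :
    ∃ (Ψ : (H →L[ℂ] H) → P) (D : (H →L[ℂ] H) →L[ℂ] P), Ψ 1 = p₀ ∧ HasFDerivAt Ψ D 1 ∧
      (∀ X, D (L X) = e.symm X) ∧ (∀ᶠ p in 𝓝 p₀, Ψ (Φ p) = p) ∧
      (∀ᶠ a in 𝓝 1, IsBracketHom L a → Φ (Ψ a) = a) ∧ (∀ᶠ a in 𝓝 1, ContinuousAt Ψ a) := by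
  have : FiniteDimensional ℂ P := Module.Finite.equiv e.symm.toLinearEquiv
  have : CompleteSpace P := FiniteDimensional.complete ℂ P
  obtain ⟨n, j, ε, hε⟩ := exists_prod_equiv e C.injective
  have hε_L (X : H) : ε (e.symm X, 0) = L X := by
    rw [hε, ContinuousLinearEquiv.apply_symm_apply, map_zero, add_zero]
  have hε_j (t) : ε (0, t) = j t := by rw [hε, map_zero, map_zero, zero_add]
  have hj (t X) (h : L X = j t) : t = 0 :=
    (congrArg Prod.snd (ε.injective ((hε_L X).trans (h.trans (hε_j t).symm)))).symm
  have hderiv : HasStrictFDerivAt Φ ((ε : P × (Fin n → ℂ) →L[ℂ] _).comp (.inl ℂ P _)) p₀ :=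
    hΦ.congr_fderiv (ContinuousLinearMap.ext fun p ↦ by
      have h := hε_L (e p)
      rw [e.symm_apply_apply] at h
      exact h.symm)
  obtain ⟨g, hg_one, hg_deriv, hleft, hright, hcont⟩ := exists_slice_inverse hderiv hp₀
  have hg : Tendsto g (𝓝 1) (𝓝 (p₀, 0)) := hg_one ▸ hg_deriv.continuousAt.tendsto
  have hunit : ∀ᶠ p in 𝓝 p₀, IsUnit (Φ p) :=
    hΦ.continuousAt.eventually (hp₀ ▸ Units.isOpen.mem_nhds isUnit_one)
  refine ⟨fun a ↦ (g a).1, (ContinuousLinearMap.fst ℂ P _).comp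
    (ε.symm : (H →L[ℂ] H) →L[ℂ] P × (Fin n → ℂ)),
    congrArg Prod.fst hg_one,
    (ContinuousLinearMap.fst ℂ P (Fin n → ℂ)).hasFDerivAt.comp 1 hg_deriv,
    fun X ↦ congrArg Prod.fst (ε.symm_apply_eq.mpr (hε_L X).symm),
    hleft.mono fun p hp ↦ congrArg Prod.fst hp, ?_,
    hcont.mono fun a ha ↦ continuous_fst.continuousAt.comp ha⟩
  filter_upwards [hright, hg.fst_nhds.eventually haut, hg.fst_nhds.eventually hunit,
    hg.snd_nhds.eventually (C.eventually_eq_zero_of_isBracketHom_one_add j hj)]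
    with a hfact hΦaut ⟨v, hv⟩ hzero ha
  rw [hε_j, ← hv] at hfact
  rw [← hv] at hΦaut
  have hquot : 1 + j (g a).2 = ↑v⁻¹ * a := by rw [Units.eq_inv_mul_iff_mul_eq, hfact]
  have hcomp : (g a).2 = 0 := hzero (hquot ▸ hΦaut.inv.mul ha)
  rw [hcomp, map_zero, add_zero, mul_one] at hfact
  rw [← hv, hfact]

end CartanData

end LocalInverse

section Extend

lemma norm_lt_floor_add_one_mul {V : Type*} [NormedAddCommGroup V] {r : ℝ} (hr : 0 < r) (X : V) :
    ‖X‖ < (⌊‖X‖ / r⌋₊ + 1 : ℕ) * r := by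
  rw [← div_lt_iff₀ hr, Nat.cast_add_one]
  exact Nat.lt_floor_add_one _

variable {V : Type*} [NormedAddCommGroup V] [NormedSpace ℂ V] {G : Type*} [Group G]

/-- The extension `X ↦ e (X / n) ^ n`, for `n > ‖X‖ / r`, of a map `e` given on the ball of
radius `r` about the origin. -/
def extendPow (e : V → G) (r : ℝ) (X : V) : G :=
  e (((⌊‖X‖ / r⌋₊ + 1 : ℕ) : ℂ)⁻¹ • X) ^ (⌊‖X‖ / r⌋₊ + 1)

lemma norm_inv_natCast_smul_lt {r : ℝ} {n : ℕ} (hn : 0 < n) {X : V} (hX : ‖X‖ < n * r) :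
    ‖(n : ℂ)⁻¹ • X‖ < r := by
  rwa [norm_smul, norm_inv, Complex.norm_natCast, inv_mul_lt_iff₀ (Nat.cast_pos.mpr hn)]

variable {e : V → G} {r : ℝ} (hr : 0 < r)
  (he : ∀ (n : ℕ) (X : V), ‖n • X‖ < r → e (n • X) = e X ^ n)

include he in
lemma pow_inv_natCast_smul {n m : ℕ} (hn : 0 < n) (hm : 0 < m) {X : V} (hX : ‖X‖ < n * r) :
    e ((n : ℂ)⁻¹ • X) ^ n = e (((n * m : ℕ) : ℂ)⁻¹ • X) ^ (n * m) := by
  have hm' : (m : ℂ) ≠ 0 := Nat.cast_ne_zero.mpr hm.ne'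
  have hdiv : (n : ℂ)⁻¹ • X = m • (((n * m : ℕ) : ℂ)⁻¹ • X) := by
    rw [← Nat.cast_smul_eq_nsmul ℂ, smul_smul, Nat.cast_mul, mul_inv_rev,
      mul_inv_cancel_left₀ hm']
  have hsmall := norm_inv_natCast_smul_lt hn hX
  rw [hdiv] at hsmall ⊢
  rw [he m _ hsmall, ← pow_mul, mul_comm]

include hr he

lemma extendPow_eq {n : ℕ} (hn : 0 < n) {X : V} (hX : ‖X‖ < n * r) :
    extendPow e r X = e ((n : ℂ)⁻¹ • X) ^ n := by
  rw [extendPow, pow_inv_natCast_smul he (Nat.succ_pos _) hn (norm_lt_floor_add_one_mul hr X),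
    mul_comm, ← pow_inv_natCast_smul he hn (Nat.succ_pos _) hX]

lemma extendPow_eq_of_norm_lt {X : V} (hX : ‖X‖ < r) : extendPow e r X = e X := by
  simpa only [Nat.cast_one, inv_one, one_smul, pow_one] using
    extendPow_eq hr he one_pos (by rwa [Nat.cast_one, one_mul])

lemma continuous_extendPow [TopologicalSpace G] [ContinuousMul G]
    (hcont : ∀ X, ‖X‖ < r → ContinuousAt e X) : Continuous (extendPow e r) := by
  refine continuous_iff_continuousAt.mpr fun X ↦ ?_
  have hn : 0 < ⌊‖X‖ / r⌋₊ + 1 := Nat.succ_pos _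
  have hX := norm_lt_floor_add_one_mul hr X
  have hpow : ContinuousAt (fun Y ↦ e (((⌊‖X‖ / r⌋₊ + 1 : ℕ) : ℂ)⁻¹ • Y) ^ (⌊‖X‖ / r⌋₊ + 1)) X :=
    (ContinuousAt.comp (f := fun Y : V ↦ ((⌊‖X‖ / r⌋₊ + 1 : ℕ) : ℂ)⁻¹ • Y)
      (hcont _ (norm_inv_natCast_smul_lt hn hX)) (continuous_const_smul _).continuousAt).pow _
  refine hpow.congr ?_
  filter_upwards [(continuous_norm.tendsto X).eventually (gt_mem_nhds hX)] with Y hY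
  exact (extendPow_eq hr he hn hY).symm

end Extend

section GroupExp

variable {H : Type*} [NormedAddCommGroup H] [InnerProductSpace ℂ H] [FiniteDimensional ℂ H]
  {L : H →ₗ[ℂ] (H →L[ℂ] H)} {σ θ : H →ₛₗ[starRingEnd ℂ] H}
  {G : Type*} [Group G] [TopologicalSpace G]

/-- `s` is a local inverse near `1` of the adjoint representation `ρ` of a Lie group, viewed as a
map into the automorphism group of the Lie algebra. -/
structure IsLocalSection (L : H →ₗ[ℂ] (H →L[ℂ] H)) (ρ : G →* (H →L[ℂ] H))
    (s : (H →L[ℂ] H) → G) : Prop where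
  map_one : s 1 = 1
  left_inv : ∀ᶠ g in 𝓝 1, s (ρ g) = g
  right_inv : ∀ᶠ a in 𝓝 1, IsBracketHom L a → ρ (s a) = a
  continuousAt : ∀ᶠ a in 𝓝 1, ContinuousAt s a

/-- `e` is a lift of `X ↦ exp (L X)` along `ρ` to the ball of radius `r`, used as an exponential
map of `G` near the origin. -/
structure IsLocalExp (L : H →ₗ[ℂ] (H →L[ℂ] H)) (ρ : G →* (H →L[ℂ] H)) (e : H → G) (r : ℝ) :
    Prop where
  continuousAt : ∀ X, ‖X‖ < r → ContinuousAt e X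
  map_apply : ∀ X, ‖X‖ < r → ρ (e X) = exp (L X)
  map_add : ∀ X Y, ‖X‖ < r → ‖Y‖ < r → ‖X + Y‖ < r → L X Y = 0 → e (X + Y) = e X * e Y
  unique : ∀ᶠ g in 𝓝 1, ∀ X, ‖X‖ < r → ρ g = exp (L X) → e X = g

/-- `E` is an exponential map for the group `G` with adjoint representation `ρ`. -/
structure IsExpMap (L : H →ₗ[ℂ] (H →L[ℂ] H)) (ρ : G →* (H →L[ℂ] H)) (E : H → G) : Prop where
  continuous : Continuous E
  map_apply : ∀ X, ρ (E X) = exp (L X)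
  map_add : ∀ X Y, L X Y = 0 → E (X + Y) = E X * E Y
  conj : ∀ g X, g * E X * g⁻¹ = E (ρ g X)
  exists_mem_eq : ∀ U ∈ 𝓝 (0 : H), ∀ᶠ g in 𝓝 (1 : G), ∃ X ∈ U, E X = g
  unique : ∀ (γ : ℂ → G) X, (∀ s t, γ (s + t) = γ s * γ t) → ContinuousAt γ 0 →
    (∀ t, ρ (γ t) = exp (t • L X)) → γ 1 = E X

lemma tendsto_exp_L (L : H →ₗ[ℂ] (H →L[ℂ] H)) : Tendsto (fun X ↦ exp (L X)) (𝓝 0) (𝓝 1) := by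
  simpa only [map_zero, exp_zero] using (continuous_exp_L L).tendsto 0

variable (C : CartanData L σ θ)

namespace CartanData

include C

lemma commute_L {X Y : H} (h : L X Y = 0) : Commute (L X) (L Y) :=
  sub_eq_zero.mp (by rw [← C.lie, h, map_zero])

lemma L_smul_smul (s t : ℂ) (X : H) : L (s • X) (t • X) = 0 := by
  have hself : (2 : ℂ) • L X X = 0 := by
    rw [two_smul]
    exact add_eq_zero_iff_eq_neg.mpr (C.skew X X)
  rw [map_smul, map_smul, smul_apply,
    (smul_eq_zero.mp hself).resolve_left two_ne_zero, smul_zero, smul_zero]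

end CartanData

variable {ρ : G →* (H →L[ℂ] H)}

include C

lemma IsLocalSection.exists_isLocalExp [IsTopologicalGroup G] {s : (H →L[ℂ] H) → G}
    (hs : IsLocalSection L ρ s) : ∃ r > 0, IsLocalExp L ρ (fun X ↦ s (exp (L X))) r := by
  have hmul : Tendsto (fun p : G × G ↦ p.1 * p.2) (𝓝 1 ×ˢ 𝓝 1) (𝓝 1) := by
    simpa only [nhds_prod_eq, mul_one] using (continuous_mul (M := G)).tendsto (1, 1)
  obtain ⟨W, hW, hWsub⟩ := mem_prod_self_iff.mp (hmul.eventually hs.left_inv)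
  have hWmul {g h : G} (hg : g ∈ W) (hh : h ∈ W) : s (ρ (g * h)) = g * h :=
    hWsub (Set.mk_mem_prod hg hh)
  have hs_one : Tendsto s (𝓝 1) (𝓝 1) := by
    simpa only [hs.map_one] using hs.continuousAt.self_of_nhds.tendsto
  have hexp := tendsto_exp_L L
  obtain ⟨r, hr, hball⟩ := Metric.eventually_nhds_iff.mp ((hexp.eventually hs.continuousAt).and
    ((hexp.eventually hs.right_inv).and (hexp.eventually (hs_one.eventually hW))))
  simp only [dist_zero_right] at hball
  have hρ {X : H} (hX : ‖X‖ < r) : ρ (s (exp (L X))) = exp (L X) :=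
    (hball hX).2.1 (C.isBracketHom_exp X)
  refine ⟨r, hr, fun X hX ↦ ContinuousAt.comp (f := fun X ↦ exp (L X)) (hball hX).1
    (continuous_exp_L L).continuousAt, fun X hX ↦ hρ hX, fun X Y hX hY _ h ↦ ?_, ?_⟩
  · rw [_root_.map_add, exp_add_of_commute (C.commute_L h), ← hρ hX, ← hρ hY, ← map_mul,
      hWmul (hball hX).2.2 (hball hY).2.2, hρ hX, hρ hY]
  · exact hs.left_inv.mono fun g hg X _ hX ↦ by rw [← hX, hg]

namespace IsLocalExp

variable {e : H → G} {r : ℝ} (he : IsLocalExp L ρ e r) (hr : 0 < r)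

include he

omit C in
include hr in
lemma map_zero : e 0 = 1 := by
  have h := he.map_add 0 0 (by rwa [norm_zero]) (by rwa [norm_zero]) (by rwa [add_zero, norm_zero])
    (_root_.map_zero _)
  rw [add_zero] at h
  exact left_eq_mul.mp h

lemma map_nsmul (n : ℕ) (X : H) (hX : ‖n • X‖ < r) : e (n • X) = e X ^ n := by
  have hr : 0 < r := (norm_nonneg _).trans_lt hX
  induction n with
  | zero => rw [zero_smul, he.map_zero hr, pow_zero]
  | succ n ih =>
    have hle {k : ℕ} (hk : k ≤ n + 1) : ‖k • X‖ < r := by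
      refine lt_of_le_of_lt ?_ hX
      simp only [← Nat.cast_smul_eq_nsmul ℂ, norm_smul, Complex.norm_natCast]
      gcongr
    have hn := hle n.le_succ
    have hone : ‖X‖ < r := by simpa only [one_smul] using hle (Nat.le_add_left 1 n)
    rw [succ_nsmul] at hX ⊢
    have hL : L (n • X) X = 0 := by
      simpa only [one_smul, Nat.cast_smul_eq_nsmul] using C.L_smul_smul n 1 X
    rw [he.map_add _ _ hn hone hX hL, ih hn, pow_succ]

include hr

omit C in
lemma apply_extendPow (X : H) : ρ (extendPow e r X) = exp (L X) := by
  have hn : ((⌊‖X‖ / r⌋₊ + 1 : ℕ) : ℂ) ≠ 0 := Nat.cast_ne_zero.mpr (Nat.succ_ne_zero _)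
  rw [extendPow, map_pow, he.map_apply _
    (norm_inv_natCast_smul_lt (Nat.succ_pos _) (norm_lt_floor_add_one_mul hr X)), ← exp_nsmul,
    ← _root_.map_nsmul, ← Nat.cast_smul_eq_nsmul ℂ, smul_inv_smul₀ hn]

lemma extendPow_add {X Y : H} (h : L X Y = 0) :
    extendPow e r (X + Y) = extendPow e r X * extendPow e r Y := by
  obtain ⟨n, hlt⟩ := exists_nat_gt ((‖X‖ + ‖Y‖) / r)
  have hn : 0 < n := Nat.cast_pos.mp ((by positivity : 0 ≤ (‖X‖ + ‖Y‖) / r).trans_lt hlt)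
  rw [div_lt_iff₀ hr] at hlt
  have hX : ‖X‖ < n * r := (le_add_of_nonneg_right (norm_nonneg Y)).trans_lt hlt
  have hY : ‖Y‖ < n * r := (le_add_of_nonneg_left (norm_nonneg X)).trans_lt hlt
  have hXY : ‖X + Y‖ < n * r := (norm_add_le _ _).trans_lt hlt
  have hpow := he.map_nsmul C
  rw [extendPow_eq hr hpow hn hX, extendPow_eq hr hpow hn hY, extendPow_eq hr hpow hn hXY,
    smul_add]
  have hsmall := norm_inv_natCast_smul_lt hn hXY
  rw [smul_add] at hsmall
  have hL : L ((n : ℂ)⁻¹ • X) ((n : ℂ)⁻¹ • Y) = 0 := by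
    rw [map_smul, map_smul, smul_apply, h, smul_zero, smul_zero]
  have hmul := he.map_add _ _ (norm_inv_natCast_smul_lt hn hX) (norm_inv_natCast_smul_lt hn hY)
    hsmall hL
  have hmul' := he.map_add _ _ (norm_inv_natCast_smul_lt hn hY) (norm_inv_natCast_smul_lt hn hX)
    (by rwa [add_comm]) (by rw [C.skew, hL, neg_zero])
  rw [add_comm, hmul] at hmul'
  rw [hmul, Commute.mul_pow hmul']

lemma extendPow_eq_of_isOneParameter {γ : ℂ → G} {X : H} (hγ : ∀ s t, γ (s + t) = γ s * γ t)
    (hcont : ContinuousAt γ 0) (hρ : ∀ t, ρ (γ t) = exp (t • L X)) : γ 1 = extendPow e r X := by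
  have hγ_zero : γ 0 = 1 := by
    have h := hγ 0 0
    rw [add_zero] at h
    exact left_eq_mul.mp h
  have hγ_pow (n : ℕ) (t : ℂ) : γ (n * t) = γ t ^ n := by
    induction n with
    | zero => rw [Nat.cast_zero, zero_mul, hγ_zero, pow_zero]
    | succ n ih => rw [Nat.cast_succ, add_one_mul, hγ, ih, pow_succ]
  have hlim : Tendsto (fun n : ℕ ↦ γ (n : ℂ)⁻¹) atTop (𝓝 1) :=
    hγ_zero ▸ hcont.tendsto.comp tendsto_inv_atTop_nhds_zero_nat
  obtain ⟨n, hunique, hn, hlt⟩ := ((hlim.eventually he.unique).and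
    ((eventually_gt_atTop 0).and (eventually_gt_atTop ⌈‖X‖ / r⌉₊))).exists
  have hX : ‖X‖ < n * r := (div_lt_iff₀ hr).mp (Nat.lt_of_ceil_lt hlt)
  rw [extendPow_eq hr (he.map_nsmul C) hn hX, hunique _ (norm_inv_natCast_smul_lt hn hX)
    (by rw [hρ, map_smul]), ← hγ_pow, mul_inv_cancel₀ (Nat.cast_ne_zero.mpr hn.ne')]

end IsLocalExp

lemma CartanData.exists_log_of_isBracketHom {U : Set H} (hU : U ∈ 𝓝 0) :
    ∀ᶠ a in 𝓝 (1 : H →L[ℂ] H), IsBracketHom L a → ∃ X ∈ U, exp (L X) = a := by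
  have hexp : HasStrictFDerivAt exp (1 : (H →L[ℂ] H) →L[ℂ] H →L[ℂ] H)
      (LinearMap.toContinuousLinearMap L 0) := by
    rw [_root_.map_zero]
    exact hasStrictFDerivAt_exp_zero
  obtain ⟨Ψ, D, hΨ_one, -, -, -, hright, hcont⟩ :=
    C.exists_local_inverse (ContinuousLinearEquiv.refl ℂ H) (Φ := fun X ↦ exp (L X))
      (hexp.comp (0 : H) (LinearMap.toContinuousLinearMap L).hasStrictFDerivAt)
      (by rw [map_zero, exp_zero]) (Eventually.of_forall C.isBracketHom_exp)
  have hlim : Tendsto Ψ (𝓝 1) (𝓝 0) := hΨ_one ▸ hcont.self_of_nhds.tendsto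
  filter_upwards [hlim.eventually hU, hright] with a haU haΨ ha
  exact ⟨Ψ a, haU, haΨ ha⟩

lemma IsLocalExp.isExpMap_extendPow [IsTopologicalGroup G] {e : H → G} {r : ℝ} (hr : 0 < r)
    (he : IsLocalExp L ρ e r) (hρ : Continuous ρ) (hρL : ∀ g, IsBracketHom L (ρ g)) :
    IsExpMap L ρ (extendPow e r) where
  continuous := continuous_extendPow hr (he.map_nsmul C) he.continuousAt
  map_apply := he.apply_extendPow hr
  map_add _ _ := he.extendPow_add C hr
  unique _ _ := he.extendPow_eq_of_isOneParameter C hr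
  conj g X := by
    let a : (H →L[ℂ] H)ˣ := Units.map ρ (toUnits g)
    have hconj := he.extendPow_eq_of_isOneParameter C hr (X := ρ g X)
      (γ := fun t ↦ g * extendPow e r (t • X) * g⁻¹) (fun s t ↦ ?_)
      (Continuous.continuousAt ?_) fun t ↦ ?_
    · rwa [one_smul] at hconj
    · rw [add_smul, he.extendPow_add C hr (C.L_smul_smul s t X)]
      group
    · have := continuous_extendPow hr (he.map_nsmul C) he.continuousAt
      fun_prop
    · rw [map_mul, map_mul, he.apply_extendPow hr]
      change (a : H →L[ℂ] H) * exp (L (t • X)) * ↑a⁻¹ = exp (t • L ((a : H →L[ℂ] H) X))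
      rw [← exp_units_conj, IsBracketHom.conj_L (hρL g), map_smul, map_smul]
  exists_mem_eq U hU := by
    have hρ_one : Tendsto ρ (𝓝 1) (𝓝 1) := by simpa only [map_one] using hρ.tendsto 1
    filter_upwards [he.unique, hρ_one.eventually
      (C.exists_log_of_isBracketHom (inter_mem hU (Metric.ball_mem_nhds 0 hr)))] with g hunique hlog
    obtain ⟨X, ⟨hXU, hXr⟩, hX⟩ := hlog (hρL g)
    rw [mem_ball_zero_iff] at hXr
    exact ⟨X, hXU, (extendPow_eq_of_norm_lt hr (he.map_nsmul C) hXr).trans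
      (hunique X hXr hX.symm)⟩

lemma exists_isExpMap [IsTopologicalGroup G] {s : (H →L[ℂ] H) → G} (hρ : Continuous ρ)
    (hρL : ∀ g, IsBracketHom L (ρ g)) (hs : IsLocalSection L ρ s) :
    ∃ E : H → G, IsExpMap L ρ E ∧ ∀ᶠ X in 𝓝 0, E X = s (exp (L X)) := by
  obtain ⟨r, hr, he⟩ := hs.exists_isLocalExp C
  refine ⟨_, he.isExpMap_extendPow C hr hρ hρL, ?_⟩
  filter_upwards [Metric.ball_mem_nhds (0 : H) hr] with X hX
  exact extendPow_eq_of_norm_lt hr (he.map_nsmul C) (mem_ball_zero_iff.mp hX)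

end GroupExp

section LocalGroup

variable {E F F' : Type*} [NormedAddCommGroup E] [NormedSpace ℂ E] [NormedAddCommGroup F]
  [NormedSpace ℂ F] [NormedAddCommGroup F'] [NormedSpace ℂ F']

lemma eventually_fderiv_right {f : E × F → F'} {x : E} {y : F} (hf : ContDiffAt ℂ 1 f (x, y)) :
    ∀ᶠ z in 𝓝 x, HasFDerivAt (fun w ↦ f (z, w))
      ((fderiv ℂ f (z, y)).comp (ContinuousLinearMap.inr ℂ E F)) y := by
  have hlim : Tendsto (fun z : E ↦ (z, y)) (𝓝 x) (𝓝 (x, y)) :=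
    (Continuous.prodMk_left y).tendsto x
  filter_upwards [hlim.eventually (hf.eventually (by decide))] with z hz
  exact (hz.differentiableAt one_ne_zero).hasFDerivAt.comp y (hasFDerivAt_prodMk_right z y)

lemma contDiffAt_fderiv_right {f : E × F → F'} {x : E} {y : F} (hf : ContDiffAt ℂ ω f (x, y)) :
    ContDiffAt ℂ ω (fun z ↦ fderiv ℂ (fun w ↦ f (z, w)) y) x := by
  have hfderiv : ContDiffAt ℂ ω (fderiv ℂ f) (x, y) := hf.fderiv_right le_top
  have hcomp : ContDiffAt ℂ ω (fun z : E ↦ fderiv ℂ f (z, y)) x :=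
    ContDiffAt.comp (f := fun z : E ↦ (z, y)) x hfderiv (by fun_prop)
  exact (hcomp.clm_comp contDiffAt_const).congr_of_eventuallyEq
    ((eventually_fderiv_right (hf.of_le le_top)).mono fun z hz ↦ hz.fderiv)

lemma hasFDerivAt_fderiv_left_apply {f : E × F → F'} {x : E} {y : F}
    (hf : ContDiffAt ℂ ω f (x, y)) (w : E × F) :
    HasFDerivAt (fun z ↦ fderiv ℂ f (z, y) w) ((ContinuousLinearMap.apply ℂ F' w).comp
      ((fderiv ℂ (fderiv ℂ f) (x, y)).comp (ContinuousLinearMap.inl ℂ E F))) x := by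
  have hfderiv : HasFDerivAt (fderiv ℂ f) (fderiv ℂ (fderiv ℂ f) (x, y)) (x, y) :=
    ((hf.fderiv_right (m := 1) le_top).differentiableAt one_ne_zero).hasFDerivAt
  exact (ContinuousLinearMap.apply ℂ F' w).hasFDerivAt.comp x
    (HasFDerivAt.comp (f := fun z : E ↦ (z, y)) x hfderiv (hasFDerivAt_prodMk_left x y))

lemma fderiv_fderiv_right_apply {f : E × F → F'} {x : E} {y : F} (hf : ContDiffAt ℂ ω f (x, y))
    (u : E) (v : F) : fderiv ℂ (fun z ↦ fderiv ℂ (fun w ↦ f (z, w)) y v) x u =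
      fderiv ℂ (fderiv ℂ f) (x, y) (u, 0) (0, v) := by
  have heq : (fun z ↦ fderiv ℂ (fun w ↦ f (z, w)) y v) =ᶠ[𝓝 x]
      fun z ↦ fderiv ℂ f (z, y) (0, v) := by
    filter_upwards [eventually_fderiv_right (hf.of_le le_top)] with z hz
    rw [hz.fderiv, ContinuousLinearMap.comp_apply, ContinuousLinearMap.inr_apply]
  rw [heq.fderiv_eq, (hasFDerivAt_fderiv_left_apply hf (0, v)).fderiv]
  rfl

/-- `m` and `c` are the multiplication and the conjugation `(x, y) ↦ x y x⁻¹` of a Lie group near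
its neutral element `e`, read in a chart. -/
structure IsLocalMulConj (m c : E × E → E) (e : E) : Prop where
  contDiffAt_mul : ContDiffAt ℂ ω m (e, e)
  contDiffAt_conj : ContDiffAt ℂ ω c (e, e)
  mul_unit : ∀ᶠ x in 𝓝 e, m (x, e) = x
  conj_unit : ∀ᶠ x in 𝓝 e, c (x, e) = e
  unit_conj : ∀ᶠ y in 𝓝 e, c (e, y) = y
  conj_mul : ∀ᶠ p in 𝓝 (e, e), m (c p, p.1) = m p

namespace IsLocalMulConj

variable {m c : E × E → E} {e : E} (h : IsLocalMulConj m c e)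

include h

lemma fderiv_unit_conj : fderiv ℂ (fun y ↦ c (e, y)) e = ContinuousLinearMap.id ℂ E := by
  have heq : (fun y ↦ c (e, y)) =ᶠ[𝓝 e] id := h.unit_conj
  rw [heq.fderiv_eq, fderiv_id]

lemma fderiv_mul_left (z : E) : fderiv ℂ m (e, e) (z, 0) = z := by
  have hcomp := HasFDerivAt.comp (f := fun x : E ↦ (x, e)) e
    (h.contDiffAt_mul.differentiableAt (by decide)).hasFDerivAt (hasFDerivAt_prodMk_left e e)
  have hid := hcomp.unique ((hasFDerivAt_id e).congr_of_eventuallyEq h.mul_unit)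
  exact congrArg (fun T : E →L[ℂ] E ↦ T z) hid

lemma eventually_fderiv_mul_conj (v : E) : ∀ᶠ x in 𝓝 e,
    fderiv ℂ m (e, x) (fderiv ℂ (fun y ↦ c (x, y)) e v, 0) = fderiv ℂ m (x, e) (0, v) := by
  have hm : ∀ᶠ p in 𝓝 (e, e), DifferentiableAt ℂ m p :=
    (h.contDiffAt_mul.eventually (by decide)).mono fun _ hp ↦ hp.differentiableAt (by decide)
  have hleft : Tendsto (fun z : E ↦ (z, e)) (𝓝 e) (𝓝 (e, e)) :=
    (Continuous.prodMk_left e).tendsto e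
  have hright : Tendsto (fun z : E ↦ (e, z)) (𝓝 e) (𝓝 (e, e)) :=
    (Continuous.prodMk_right e).tendsto e
  filter_upwards [hright.eventually hm, hleft.eventually h.conj_mul.eventually_nhds, h.conj_unit,
    eventually_fderiv_right (h.contDiffAt_mul.of_le le_top),
    eventually_fderiv_right (h.contDiffAt_conj.of_le le_top)] with x hmx hrel hcx hmul hconj
  have hpair : HasFDerivAt (fun y ↦ (c (x, y), x)) ((fderiv ℂ (fun y ↦ c (x, y)) e).prod 0) e :=
    hconj.differentiableAt.hasFDerivAt.prodMk (hasFDerivAt_const x e)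
  have hm_ex : HasFDerivAt m (fderiv ℂ m (e, x)) ((fun y ↦ (c (x, y), x)) e) := by
    simpa only [hcx] using hmx.hasFDerivAt
  have hrel' : (fun y ↦ m (c (x, y), x)) =ᶠ[𝓝 e] fun y ↦ m (x, y) :=
    ((Continuous.prodMk_right x).tendsto e).eventually hrel
  have heq := (hm_ex.comp e hpair).unique (hmul.congr_of_eventuallyEq hrel')
  exact congrArg (fun T : E →L[ℂ] E ↦ T v) heq

lemma fderiv_conj_apply (u v : E) : fderiv ℂ (fun x ↦ fderiv ℂ (fun y ↦ c (x, y)) e) e u v =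
    fderiv ℂ (fderiv ℂ m) (e, e) (u, 0) (0, v) -
      fderiv ℂ (fderiv ℂ m) (e, e) (0, u) (v, 0) := by
  set F : E → E →L[ℂ] E := fun x ↦ fderiv ℂ (fun y ↦ c (x, y)) e
  have hF : HasFDerivAt F (fderiv ℂ F e) e :=
    ((contDiffAt_fderiv_right h.contDiffAt_conj).differentiableAt (by decide)).hasFDerivAt
  have hm : HasFDerivAt (fderiv ℂ m) (fderiv ℂ (fderiv ℂ m) (e, e)) (e, e) :=
    ((h.contDiffAt_mul.fderiv_right (m := 1) le_top).differentiableAt one_ne_zero).hasFDerivAt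
  have hFv : HasFDerivAt (fun x ↦ (F x v, (0 : E))) ((ContinuousLinearMap.inl ℂ E E).comp
      ((ContinuousLinearMap.apply ℂ E v).comp (fderiv ℂ F e))) e :=
    (ContinuousLinearMap.inl ℂ E E).hasFDerivAt.comp e
      ((ContinuousLinearMap.apply ℂ E v).hasFDerivAt.comp e hF)
  have hprod := (hm.comp e (hasFDerivAt_prodMk_right e e)).clm_apply hFv
  have heq := hprod.unique ((hasFDerivAt_fderiv_left_apply h.contDiffAt_mul
    (0, v)).congr_of_eventuallyEq (h.eventually_fderiv_mul_conj v))
  have happly : fderiv ℂ m (e, e) (fderiv ℂ F e u v, 0) +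
      fderiv ℂ (fderiv ℂ m) (e, e) (0, u) (F e v, 0) =
        fderiv ℂ (fderiv ℂ m) (e, e) (u, 0) (0, v) :=
    congrArg (fun T : E →L[ℂ] E ↦ T u) heq
  have hFe : F e = ContinuousLinearMap.id ℂ E := h.fderiv_unit_conj
  rw [h.fderiv_mul_left, hFe, ContinuousLinearMap.id_apply] at happly
  exact eq_sub_of_add_eq happly

lemma exists_hasStrictFDerivAt_conj : ∃ D : E →L[ℂ] E →L[ℂ] E,
    HasStrictFDerivAt (fun x ↦ fderiv ℂ (fun y ↦ c (x, y)) e) D e ∧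
      ∀ u v, D u v = fderiv ℂ (fun x ↦ fderiv ℂ (fun y ↦ m (x, y)) e v) e u -
        fderiv ℂ (fun x ↦ fderiv ℂ (fun y ↦ m (x, y)) e u) e v := by
  refine ⟨_, (contDiffAt_fderiv_right h.contDiffAt_conj).hasStrictFDerivAt (by decide),
    fun u v ↦ ?_⟩
  have hsymm : fderiv ℂ (fderiv ℂ m) (e, e) (0, u) (v, 0) =
      fderiv ℂ (fderiv ℂ m) (e, e) (v, 0) (0, u) :=
    h.contDiffAt_mul.isSymmSndFDerivAt_of_omega (0, u) (v, 0)
  rw [h.fderiv_conj_apply, hsymm, fderiv_fderiv_right_apply h.contDiffAt_mul,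
    fderiv_fderiv_right_apply h.contDiffAt_mul]

end IsLocalMulConj

end LocalGroup

section Chart

variable (E : Type*) [NormedAddCommGroup E] [NormedSpace ℂ E]
  (G : Type*) [TopologicalSpace G] [ChartedSpace E G]

/-- The preferred chart of `G` at `1`, as a map into the model space. -/
abbrev unitChart [One G] : PartialEquiv G E := extChartAt 𝓘(ℂ, E) (1 : G)

variable [Group G]

/-- The multiplication of `G` read in the chart at `1`. -/
def chartMul (p : E × E) : E :=
  unitChart E G ((unitChart E G).symm p.1 * (unitChart E G).symm p.2)

/-- The conjugation `(x, y) ↦ x y x⁻¹` of `G` read in the chart at `1`. -/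
def chartConj (p : E × E) : E :=
  unitChart E G ((unitChart E G).symm p.1 * (unitChart E G).symm p.2 *
    ((unitChart E G).symm p.1)⁻¹)

variable {G}

/-- The conjugation by `g` read in the chart at `1`. -/
def chartConjBy (g : G) (y : E) : E := unitChart E G (g * (unitChart E G).symm y * g⁻¹)

/-- The adjoint action of `g`, computed in the chart at `1`. -/
def adChart (g : G) : E →L[ℂ] E := fderiv ℂ (chartConjBy E g) (unitChart E G 1)

variable {E}

lemma unitChart_symm_one : (unitChart E G).symm (unitChart E G 1) = 1 :=
  extChartAt_to_inv (I := 𝓘(ℂ, E)) (1 : G)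

lemma chartConjBy_one (g : G) : chartConjBy E g (unitChart E G 1) = unitChart E G 1 := by
  rw [chartConjBy, unitChart_symm_one, mul_one, mul_inv_cancel]

lemma eventually_unitChart_symm_unitChart :
    ∀ᶠ g in 𝓝 (1 : G), (unitChart E G).symm (unitChart E G g) = g :=
  eventually_of_mem (extChartAt_source_mem_nhds (I := 𝓘(ℂ, E)) (1 : G))
    fun _ hg ↦ (unitChart E G).left_inv hg

lemma eventually_unitChart_unitChart_symm :
    ∀ᶠ x in 𝓝 (unitChart E G 1), unitChart E G ((unitChart E G).symm x) = x :=
  eventually_of_mem (extChartAt_target_mem_nhds (I := 𝓘(ℂ, E)) (1 : G))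
    fun _ hg ↦ (unitChart E G).right_inv hg

lemma tendsto_unitChart_symm : Tendsto (unitChart E G).symm (𝓝 (unitChart E G 1)) (𝓝 1) := by
  simpa only [unitChart_symm_one] using
    (continuousAt_extChartAt_symm (I := 𝓘(ℂ, E)) (1 : G)).tendsto

lemma tendsto_conj_one {G : Type*} [Group G] [TopologicalSpace G] [ContinuousMul G] (g : G) :
    Tendsto (fun k ↦ g * k * g⁻¹) (𝓝 1) (𝓝 1) := by
  have hcont : Continuous fun k ↦ g * k * g⁻¹ := by fun_prop
  simpa only [mul_one, mul_inv_cancel] using hcont.tendsto 1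

lemma contDiffAt_unitChart_comp {F : Type*} [NormedAddCommGroup F] [NormedSpace ℂ F] {f : F → G}
    {x : F} (hf : ContMDiffAt 𝓘(ℂ, F) 𝓘(ℂ, E) ω f x) (hx : f x = 1) :
    ContDiffAt ℂ ω (fun y ↦ unitChart E G (f y)) x := by
  have hchart : ContMDiffAt 𝓘(ℂ, E) 𝓘(ℂ, E) ω (unitChart E G) (f x) :=
    hx ▸ contMDiffAt_extChartAt
  exact contMDiffAt_iff_contDiffAt.mp (hchart.comp x hf)

lemma fderiv_chartMul_one (w : E) :
    fderiv ℂ (fun y ↦ chartMul E G (unitChart E G 1, y)) (unitChart E G 1) w = w := by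
  have heq : (fun y ↦ chartMul E G (unitChart E G 1, y)) =ᶠ[𝓝 (unitChart E G 1)] id := by
    filter_upwards [eventually_unitChart_unitChart_symm (E := E) (G := G)] with y hy
    rw [chartMul, unitChart_symm_one, one_mul, hy, id]
  rw [heq.fderiv_eq, fderiv_id, ContinuousLinearMap.id_apply]

section Smooth

variable [LieGroup 𝓘(ℂ, E) ω G]

lemma contMDiffAt_unitChart_symm :
    ContMDiffAt 𝓘(ℂ, E) 𝓘(ℂ, E) ω (unitChart E G).symm (unitChart E G 1) :=
  (contMDiffOn_extChartAt_symm (I := 𝓘(ℂ, E)) (n := ω) (1 : G)).contMDiffAt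
    (extChartAt_target_mem_nhds (I := 𝓘(ℂ, E)) (1 : G))

lemma contMDiffAt_unitChart_symm_comp {F : Type*} [NormedAddCommGroup F] [NormedSpace ℂ F]
    {f : F → E} {x : F} (hf : ContDiff ℂ ω f) (hx : f x = unitChart E G 1) :
    ContMDiffAt 𝓘(ℂ, F) 𝓘(ℂ, E) ω (fun y ↦ (unitChart E G).symm (f y)) x :=
  ContMDiffAt.comp x (hx ▸ contMDiffAt_unitChart_symm) hf.contMDiff.contMDiffAt

lemma contDiffAt_chartMul :
    ContDiffAt ℂ ω (chartMul E G) (unitChart E G 1, unitChart E G 1) :=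
  contDiffAt_unitChart_comp ((contMDiffAt_unitChart_symm_comp contDiff_fst rfl).mul
    (contMDiffAt_unitChart_symm_comp contDiff_snd rfl)) (by simp only [unitChart_symm_one, mul_one])

lemma contDiffAt_chartConj :
    ContDiffAt ℂ ω (chartConj E G) (unitChart E G 1, unitChart E G 1) :=
  contDiffAt_unitChart_comp (((contMDiffAt_unitChart_symm_comp contDiff_fst rfl).mul
    (contMDiffAt_unitChart_symm_comp contDiff_snd rfl)).mul
      (contMDiffAt_unitChart_symm_comp contDiff_fst rfl).inv)
    (by simp only [unitChart_symm_one, mul_one, inv_one])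

lemma contMDiff_conj (g : G) : ContMDiff 𝓘(ℂ, E) 𝓘(ℂ, E) ω fun h : G ↦ g * h * g⁻¹ :=
  (contMDiff_const.mul contMDiff_id).mul contMDiff_const

lemma contDiffAt_chartConjBy (g : G) : ContDiffAt ℂ ω (chartConjBy E g) (unitChart E G 1) :=
  contDiffAt_unitChart_comp ((contMDiff_conj g).contMDiffAt.comp _ contMDiffAt_unitChart_symm)
    (by simp only [unitChart_symm_one, mul_one, mul_inv_cancel])

lemma hasFDerivAt_chartConjBy (g : G) :
    HasFDerivAt (chartConjBy E g) (adChart E g) (unitChart E G 1) :=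
  ((contDiffAt_chartConjBy g).differentiableAt (by decide)).hasFDerivAt

lemma isLocalMulConj_chart : IsLocalMulConj (chartMul E G) (chartConj E G) (unitChart E G 1) where
  contDiffAt_mul := contDiffAt_chartMul
  contDiffAt_conj := contDiffAt_chartConj
  mul_unit := by
    filter_upwards [eventually_unitChart_unitChart_symm (E := E) (G := G)] with y hy
    rw [chartMul, unitChart_symm_one, mul_one, hy]
  conj_unit := .of_forall fun x ↦ by rw [chartConj, unitChart_symm_one, mul_one, mul_inv_cancel]
  unit_conj := by
    filter_upwards [eventually_unitChart_unitChart_symm (E := E) (G := G)] with y hy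
    rw [chartConj, unitChart_symm_one, one_mul, inv_one, mul_one, hy]
  conj_mul := by
    have := topologicalGroup_of_lieGroup 𝓘(ℂ, E) ω (G := G)
    have hsymm := (tendsto_unitChart_symm (E := E) (G := G)).prodMap
      (tendsto_unitChart_symm (E := E) (G := G))
    have hconj : Tendsto (fun q : G × G ↦ q.1 * q.2 * q.1⁻¹) (𝓝 1 ×ˢ 𝓝 1) (𝓝 1) := by
      have hcont : Continuous fun q : G × G ↦ q.1 * q.2 * q.1⁻¹ := by fun_prop
      simpa only [nhds_prod_eq, mul_one, inv_one] using hcont.tendsto (1, 1)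
    rw [nhds_prod_eq]
    filter_upwards [(hconj.comp hsymm).eventually
      (eventually_unitChart_symm_unitChart (E := E))] with p hp
    simp only [Function.comp_apply, Prod.map] at hp
    rw [chartMul, chartConj]
    exact congrArg (unitChart E G) (by simp only [hp, inv_mul_cancel_right])

lemma lieAd_eq_adChart (g : G) (X : GroupLieAlgebra 𝓘(ℂ, E) G) : lieAd g X = adChart E g X := by
  have hmfderiv := ((contMDiff_conj (E := E) g).mdifferentiable (by decide) (1 : G)).mfderiv
  have hchart : fderivWithin ℂ (writtenInExtChartAt 𝓘(ℂ, E) 𝓘(ℂ, E) (1 : G)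
      (fun h : G ↦ g * h * g⁻¹)) (Set.range 𝓘(ℂ, E)) (unitChart E G 1) = adChart E g := by
    have hone : g * 1 * g⁻¹ = 1 := by rw [mul_one, mul_inv_cancel]
    simp only [writtenInExtChartAt, hone, ModelWithCorners.range_eq_univ, fderivWithin_univ]
    rfl
  exact congrArg (fun D : E →L[ℂ] E ↦ D X) (hmfderiv.trans hchart)

lemma adChart_one : adChart E (1 : G) = 1 := by
  refine (hasFDerivAt_chartConjBy (E := E) (1 : G)).unique ?_
  refine (hasFDerivAt_id (𝕜 := ℂ) (unitChart E G 1)).congr_of_eventuallyEq ?_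
  filter_upwards [eventually_unitChart_unitChart_symm (E := E) (G := G)] with x hx
  rw [chartConjBy, one_mul, inv_one, mul_one, hx, id]

lemma eventually_unitChart_symm_chartConjBy (g : G) : ∀ᶠ x in 𝓝 (unitChart E G 1),
    (unitChart E G).symm (chartConjBy E g x) = g * (unitChart E G).symm x * g⁻¹ := by
  have := topologicalGroup_of_lieGroup 𝓘(ℂ, E) ω (G := G)
  exact tendsto_unitChart_symm.eventually
    ((tendsto_conj_one g).eventually eventually_unitChart_symm_unitChart)

lemma adChart_mul (g h : G) : adChart E (g * h) = adChart E g * adChart E h := by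
  have hg := hasFDerivAt_chartConjBy (E := E) g
  rw [← chartConjBy_one h] at hg
  refine (hasFDerivAt_chartConjBy (E := E) (g * h)).unique ((hg.comp _
    (hasFDerivAt_chartConjBy h)).congr_of_eventuallyEq ?_)
  filter_upwards [eventually_unitChart_symm_chartConjBy (E := E) h] with x hx
  rw [Function.comp_apply, chartConjBy, chartConjBy, hx, mul_inv_rev]
  simp only [mul_assoc]

lemma mfderiv_unitChart_mul_left (v : GroupLieAlgebra 𝓘(ℂ, E) G) {x : E}
    (hx : x ∈ (unitChart E G).target) :
    mfderiv 𝓘(ℂ, E) 𝓘(ℂ, E) (unitChart E G) ((unitChart E G).symm x)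
        (mulInvariantVectorField v ((unitChart E G).symm x)) =
      fderiv ℂ (fun y ↦ chartMul E G (x, y)) (unitChart E G 1) (v : E) := by
  have : IsManifold 𝓘(ℂ, E) 1 G := IsManifold.of_le (n := ω) le_top
  set g := (unitChart E G).symm x
  have hgs : g ∈ (chartAt E (1 : G)).source := by
    rw [← extChartAt_source (I := 𝓘(ℂ, E))]
    exact (unitChart E G).map_target hx
  have hchart : MDifferentiableAt 𝓘(ℂ, E) 𝓘(ℂ, E) (unitChart E G) g :=
    mdifferentiableAt_extChartAt hgs
  have hmul : MDifferentiableAt 𝓘(ℂ, E) 𝓘(ℂ, E) (fun h : G ↦ g * h) 1 :=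
    (contMDiff_mul_left (n := ω)).contMDiffAt.mdifferentiableAt (by decide)
  have hcomp := mfderiv_comp_of_eq (I' := 𝓘(ℂ, E)) (x := (1 : G)) (g := unitChart E G)
    hchart hmul (mul_one g)
  have hwritten : fderivWithin ℂ (writtenInExtChartAt 𝓘(ℂ, E) 𝓘(ℂ, E) (1 : G)
      (unitChart E G ∘ fun h : G ↦ g * h)) (Set.range 𝓘(ℂ, E)) (unitChart E G 1) =
      fderiv ℂ (fun y : E ↦ chartMul E G (x, y)) (unitChart E G 1) := by
    simp only [writtenInExtChartAt, ModelWithCorners.range_eq_univ, fderivWithin_univ]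
    rfl
  have hderiv := hcomp.symm.trans
    ((MDifferentiableAt.comp_of_eq (1 : G) hchart hmul (mul_one g)).mfderiv.trans hwritten)
  have hbase : ∀ k : G, k = g → (mfderiv 𝓘(ℂ, E) 𝓘(ℂ, E) (unitChart E G) k : E →L[ℂ] E) =
      mfderiv 𝓘(ℂ, E) 𝓘(ℂ, E) (unitChart E G) g := by
    rintro _ rfl
    rfl
  exact (congrArg (fun D : E →L[ℂ] E ↦ D (mulInvariantVectorField v g))
    (hbase (g * 1) (mul_one g)).symm).trans (congrArg (fun D : E →L[ℂ] E ↦ D v) hderiv)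

lemma eventually_mpullback_mulInvariantVectorField (v : GroupLieAlgebra 𝓘(ℂ, E) G) :
    ∀ᶠ x in 𝓝 (unitChart E G 1),
      VectorField.mpullbackWithin 𝓘(ℂ, E) 𝓘(ℂ, E) (unitChart E G).symm
        (mulInvariantVectorField v) (Set.range 𝓘(ℂ, E)) x =
      fderiv ℂ (fun y ↦ chartMul E G (x, y)) (unitChart E G 1) (v : E) := by
  filter_upwards [extChartAt_target_mem_nhds (I := 𝓘(ℂ, E)) (1 : G)] with x hx
  have : IsManifold 𝓘(ℂ, E) 1 G := IsManifold.of_le (n := ω) le_top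
  have hinv := ContinuousLinearMap.inverse_eq
    (mfderivWithin_extChartAt_symm_comp_mfderiv_extChartAt (I := 𝓘(ℂ, E)) hx)
    (mfderiv_extChartAt_comp_mfderivWithin_extChartAt_symm (I := 𝓘(ℂ, E)) hx)
  exact (congrArg (fun D : E →L[ℂ] E ↦ D (mulInvariantVectorField v ((unitChart E G).symm x)))
    hinv).trans (mfderiv_unitChart_mul_left v hx)

lemma lie_eq_lieBracket_chart (u v : GroupLieAlgebra 𝓘(ℂ, E) G) :
    (⁅u, v⁆ : GroupLieAlgebra 𝓘(ℂ, E) G) = VectorField.lieBracket ℂ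
      (fun x ↦ fderiv ℂ (fun y ↦ chartMul E G (x, y)) (unitChart E G 1) (u : E))
      (fun x ↦ fderiv ℂ (fun y ↦ chartMul E G (x, y)) (unitChart E G 1) (v : E))
      (unitChart E G 1) := by
  have : IsManifold 𝓘(ℂ, E) 1 G := IsManifold.of_le (n := ω) le_top
  have hchart : mfderiv 𝓘(ℂ, E) 𝓘(ℂ, E) (unitChart E G) (1 : G) = ContinuousLinearMap.id ℂ E :=
    mfderiv_extChartAt_self (I := 𝓘(ℂ, E)) (x := (1 : G))
  have hinv : (mfderiv 𝓘(ℂ, E) 𝓘(ℂ, E) (unitChart E G) (1 : G)).inverse =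
      ContinuousLinearMap.id ℂ E :=
    (congrArg (fun D : E →L[ℂ] E ↦ D.inverse) hchart).trans
      (ContinuousLinearMap.inverse_id (R := ℂ) (M := E))
  have hset : (unitChart E G).symm ⁻¹' Set.univ ∩ Set.range 𝓘(ℂ, E) = Set.univ := by
    rw [Set.preimage_univ, Set.univ_inter, ModelWithCorners.range_eq_univ]
  have hwithin {s : Set E} (hs : s = Set.univ) (V W : E → E) (x : E) :
      VectorField.lieBracketWithin ℂ V W s x = VectorField.lieBracket ℂ V W x := by
    rw [hs, VectorField.lieBracketWithin_univ]
  exact (congrArg (fun D : E →L[ℂ] E ↦ D _) hinv).trans ((hwithin hset _ _ _).trans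
    (EventuallyEq.lieBracket_vectorField_eq (𝕜 := ℂ) (E := E)
      (eventually_mpullback_mulInvariantVectorField u)
      (eventually_mpullback_mulInvariantVectorField v)))

lemma lie_eq_fderiv_chartMul (u v : GroupLieAlgebra 𝓘(ℂ, E) G) :
    (⁅u, v⁆ : GroupLieAlgebra 𝓘(ℂ, E) G) =
      fderiv ℂ (fun x ↦ fderiv ℂ (fun y ↦ chartMul E G (x, y)) (unitChart E G 1) (v : E))
        (unitChart E G 1) (u : E) -
      fderiv ℂ (fun x ↦ fderiv ℂ (fun y ↦ chartMul E G (x, y)) (unitChart E G 1) (u : E))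
        (unitChart E G 1) (v : E) :=
  (lie_eq_lieBracket_chart u v).trans (congrArg₂
    (fun a b : E ↦ fderiv ℂ (fun x ↦ fderiv ℂ (fun y ↦ chartMul E G (x, y)) _ (v : E)) _ a -
      fderiv ℂ (fun x ↦ fderiv ℂ (fun y ↦ chartMul E G (x, y)) _ (u : E)) _ b)
    (fderiv_chartMul_one (E := E) u) (fderiv_chartMul_one (E := E) v))

lemma exists_hasStrictFDerivAt_adChart : ∃ D : E →L[ℂ] E →L[ℂ] E,
    HasStrictFDerivAt (fun x ↦ adChart E ((unitChart E G).symm x)) D (unitChart E G 1) ∧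
      ∀ u v : GroupLieAlgebra 𝓘(ℂ, E) G,
        D (u : E) (v : E) = (⁅u, v⁆ : GroupLieAlgebra 𝓘(ℂ, E) G) := by
  obtain ⟨D, hD, hbracket⟩ :=
    (isLocalMulConj_chart (E := E) (G := G)).exists_hasStrictFDerivAt_conj
  exact ⟨D, hD, fun u v ↦ (hbracket u v).trans (lie_eq_fderiv_chartMul u v).symm⟩

lemma continuous_adChart : Continuous (adChart E : G → E →L[ℂ] E) := by
  have := topologicalGroup_of_lieGroup 𝓘(ℂ, E) ω (G := G)
  have hone : Tendsto (adChart E : G → E →L[ℂ] E) (𝓝 1) (𝓝 1) := by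
    obtain ⟨D, hD, -⟩ := exists_hasStrictFDerivAt_adChart (E := E) (G := G)
    have hlim := hD.continuousAt.tendsto.comp (continuousAt_extChartAt (I := 𝓘(ℂ, E)) (1 : G))
    rw [unitChart_symm_one, adChart_one] at hlim
    refine hlim.congr' ?_
    filter_upwards [eventually_unitChart_symm_unitChart (E := E) (G := G)] with g hg
    rw [Function.comp_apply, hg]
  refine continuous_iff_continuousAt.mpr fun g ↦ ?_
  have htranslate : (adChart E : G → E →L[ℂ] E) = fun h ↦ adChart E g * adChart E (g⁻¹ * h) := by
    funext h
    rw [← adChart_mul, mul_inv_cancel_left]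
  have hlim : Tendsto (fun h ↦ g⁻¹ * h) (𝓝 g) (𝓝 1) := by
    simpa only [inv_mul_cancel] using (continuous_const_mul g⁻¹).tendsto g
  rw [ContinuousAt, htranslate]
  simpa only [inv_mul_cancel, adChart_one, Function.comp_apply] using
    (hone.comp hlim).const_mul (adChart E g)

lemma lieAd_lie (g : G) (X Y : GroupLieAlgebra 𝓘(ℂ, E) G) :
    lieAd g ⁅X, Y⁆ = (⁅lieAd g X, lieAd g Y⁆ : GroupLieAlgebra 𝓘(ℂ, E) G) := by
  obtain ⟨D, hD, hbracket⟩ := exists_hasStrictFDerivAt_adChart (E := E) (G := G)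
  have hconj : HasFDerivAt (fun x ↦ adChart E ((unitChart E G).symm (chartConjBy E g x)))
      (D.comp (adChart E g)) (unitChart E G 1) := by
    have hD' := hD.hasFDerivAt
    rw [← chartConjBy_one g] at hD'
    exact hD'.comp _ (hasFDerivAt_chartConjBy g)
  have hright := ((ContinuousLinearMap.mul ℂ (E →L[ℂ] E)).flip (adChart E g)).hasFDerivAt.comp
    (unitChart E G 1) hconj
  have hleft := (ContinuousLinearMap.mul ℂ (E →L[ℂ] E) (adChart E g)).hasFDerivAt.comp
    (unitChart E G 1) hD.hasFDerivAt
  have heq := hleft.unique (hright.congr_of_eventuallyEq (by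
    filter_upwards [eventually_unitChart_symm_chartConjBy (E := E) g] with x hx
    simp only [Function.comp_apply, ContinuousLinearMap.flip_apply,
      ContinuousLinearMap.mul_apply', hx, ← adChart_mul, inv_mul_cancel_right]))
  have happly : adChart E g (D X Y) = D (adChart E g X) (adChart E g Y) :=
    congrArg (fun T : E →L[ℂ] E →L[ℂ] E ↦ T X Y) heq
  have hbracket_ad : (⁅lieAd g X, lieAd g Y⁆ : GroupLieAlgebra 𝓘(ℂ, E) G) =
      D (adChart E g X) (adChart E g Y) :=
    (hbracket (lieAd g X) (lieAd g Y)).symm.trans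
      (congrArg₂ (fun u v : E ↦ D u v) (lieAd_eq_adChart g X) (lieAd_eq_adChart g Y))
  exact (lieAd_eq_adChart g _).trans
    ((congrArg (adChart E g) (hbracket X Y).symm).trans (happly.trans hbracket_ad.symm))

end Smooth

end Chart

section CartanModel

variable {𝔤 : Type*}

lemma trace_eq_conj_trace_of_semiconj [AddCommGroup 𝔤] [Module ℂ 𝔤] [Module.Finite ℂ 𝔤]
    {σ : 𝔤 →ₛₗ[starRingEnd ℂ] 𝔤} (hσ : Function.Involutive σ) {T T' : Module.End ℂ 𝔤}
    (h : ∀ X, T' (σ X) = σ (T X)) :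
    LinearMap.trace ℂ 𝔤 T' = starRingEnd ℂ (LinearMap.trace ℂ 𝔤 T) := by
  let b := Module.finBasis ℂ 𝔤
  let ε : 𝔤 ≃ₗ[ℂ] (Fin (Module.finrank ℂ 𝔤) → ℂ) :=
    ((LinearEquiv.ofInvolutive σ hσ).trans b.equivFun).trans (starLinearEquiv ℂ)
  have hε (X : 𝔤) (i : Fin (Module.finrank ℂ 𝔤)) :
      ε (σ X) i = starRingEnd ℂ (b.equivFun X i) := by
    change starRingEnd ℂ (b.equivFun (σ (σ X)) i) = _
    rw [hσ]
  have hb (i : Fin (Module.finrank ℂ 𝔤)) : Module.Basis.ofEquivFun ε i = σ (b i) := by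
    refine ε.injective (funext fun j ↦ ?_)
    rw [hε, Module.Basis.equivFun_self, apply_ite (starRingEnd ℂ), map_one, map_zero,
      Module.Basis.coe_ofEquivFun, LinearEquiv.apply_symm_apply, Pi.single_apply]
    exact if_congr eq_comm rfl rfl
  rw [LinearMap.trace_eq_matrix_trace ℂ (Module.Basis.ofEquivFun ε),
    LinearMap.trace_eq_matrix_trace ℂ b, Matrix.trace, Matrix.trace, map_sum]
  refine Finset.sum_congr rfl fun i _ ↦ ?_
  rw [Matrix.diag_apply, Matrix.diag_apply, LinearMap.toMatrix_apply, LinearMap.toMatrix_apply,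
    hb, h]
  exact hε _ i

variable [LieRing 𝔤] [LieAlgebra ℂ 𝔤] {σ θ : 𝔤 →ₛₗ[starRingEnd ℂ] 𝔤}

lemma IsCartanInvolution.eq_zero_of_killingForm (hθ : IsCartanInvolution θ) {X : 𝔤}
    (hX : killingForm ℂ 𝔤 X (θ X) = 0) : X = 0 := by
  by_contra hne
  have hneg := hθ.neg_re_killing X hne
  rw [hX, Complex.zero_re] at hneg
  exact hneg.false

lemma IsCartanInvolution.isKilling (hθ : IsCartanInvolution θ) : LieAlgebra.IsKilling ℂ 𝔤 where
  killingCompl_top_eq_bot := (LieSubmodule.eq_bot_iff _).mpr fun X hX ↦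
    hθ.eq_zero_of_killingForm <| by
      rw [LieModule.traceForm_comm]
      exact (LieIdeal.mem_killingCompl ℂ 𝔤 ⊤).mp hX (θ X) trivial

variable {H : Type*} [NormedAddCommGroup H] [InnerProductSpace ℂ H]

/-- The antilinear map `τ` transported along `e : 𝔤 ≃ₗ[ℂ] H`. -/
def modelConj (e : 𝔤 ≃ₗ[ℂ] H) (τ : 𝔤 →ₛₗ[starRingEnd ℂ] 𝔤) : H →ₛₗ[starRingEnd ℂ] H :=
  e.toLinearMap.comp (τ.comp e.symm.toLinearMap)

lemma modelConj_apply (e : 𝔤 ≃ₗ[ℂ] H) (τ : 𝔤 →ₛₗ[starRingEnd ℂ] 𝔤) (X : H) :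
    modelConj e τ X = e (τ (e.symm X)) := rfl

/-- The adjoint representation of `𝔤` transported along `e : 𝔤 ≃ₗ[ℂ] H`. -/
def modelBracket [FiniteDimensional ℂ H] (e : 𝔤 ≃ₗ[ℂ] H) : H →ₗ[ℂ] (H →L[ℂ] H) :=
  LinearMap.toContinuousLinearMap.toLinearMap ∘ₗ e.conj.toLinearMap ∘ₗ
    (LieAlgebra.ad ℂ 𝔤 : 𝔤 →ₗ[ℂ] Module.End ℂ 𝔤) ∘ₗ e.symm.toLinearMap

lemma modelBracket_apply [FiniteDimensional ℂ H] (e : 𝔤 ≃ₗ[ℂ] H) (X Y : H) :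
    modelBracket e X Y = e ⁅e.symm X, e.symm Y⁆ := rfl

section Inner

variable {e : 𝔤 ≃ₗ[ℂ] H} (he : ∀ X Y, inner ℂ (e X) (e Y) = -killingForm ℂ 𝔤 Y (θ X))

include he

lemma inner_eq_neg_killingForm (X Y : H) :
    inner ℂ X Y = -killingForm ℂ 𝔤 (e.symm Y) (θ (e.symm X)) := by
  rw [← he, e.apply_symm_apply, e.apply_symm_apply]

variable [FiniteDimensional ℂ H]

lemma star_modelBracket (hθ : IsConjugation θ) (X : H) :
    star (modelBracket e X) = -modelBracket e (modelConj e θ X) := by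
  rw [ContinuousLinearMap.star_eq_adjoint, eq_comm, ContinuousLinearMap.eq_adjoint_iff]
  intro Y Z
  rw [neg_apply, inner_neg_left, inner_eq_neg_killingForm he, inner_eq_neg_killingForm he]
  simp only [modelBracket_apply, modelConj_apply, e.symm_apply_apply, hθ.map_lie, hθ.involutive _]
  rw [← lie_skew (e.symm X) (e.symm Z), map_neg, LinearMap.neg_apply,
    LieModule.traceForm_apply_lie_apply]

lemma star_apply_of_isBracketHom (hθ : IsConjugation θ) {a : (H →L[ℂ] H)ˣ}
    (ha : IsBracketHom (modelBracket e) a) (X : H) :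
    star (a : H →L[ℂ] H) X = modelConj e θ ((↑a⁻¹ : H →L[ℂ] H) (modelConj e θ X)) := by
  let α : 𝔤 ≃ₗ⁅ℂ⁆ 𝔤 :=
    { toFun := fun Z ↦ e.symm ((a : H →L[ℂ] H) (e Z))
      map_add' := fun Y Z ↦ by simp only [map_add]
      map_smul' := fun c Z ↦ by simp only [map_smul, RingHom.id_apply]
      map_lie' := fun {Y Z} ↦ by
        have hYZ := ha (e Y) (e Z)
        simp only [modelBracket_apply, e.symm_apply_apply] at hYZ
        rw [hYZ, e.symm_apply_apply]
      invFun := fun Z ↦ e.symm ((↑a⁻¹ : H →L[ℂ] H) (e Z))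
      left_inv := fun Z ↦ by
        simp only [e.apply_symm_apply, unit_inv_apply_apply, e.symm_apply_apply]
      right_inv := fun Z ↦ by
        simp only [e.apply_symm_apply, unit_apply_inv_apply, e.symm_apply_apply] }
  rw [ContinuousLinearMap.star_eq_adjoint]
  refine ext_inner_right ℂ fun Y ↦ ?_
  rw [ContinuousLinearMap.adjoint_inner_left, inner_eq_neg_killingForm he,
    inner_eq_neg_killingForm he]
  have hα : e.symm ((a : H →L[ℂ] H) Y) = α (e.symm Y) := by
    change _ = e.symm ((a : H →L[ℂ] H) (e (e.symm Y)))
    rw [e.apply_symm_apply]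
  have hα_symm : θ (e.symm (modelConj e θ ((↑a⁻¹ : H →L[ℂ] H) (modelConj e θ X)))) =
      α.symm (θ (e.symm X)) := by
    rw [modelConj_apply, e.symm_apply_apply, hθ.involutive]
    rfl
  rw [hα, hα_symm, ← LieAlgebra.killingForm_of_equiv_apply α (e.symm Y), α.apply_symm_apply]

end Inner

variable [Module.Finite ℂ 𝔤] [FiniteDimensional ℂ H]

lemma IsConjugation.killingForm_apply_apply (hσ : IsConjugation σ) (X Y : 𝔤) :
    killingForm ℂ 𝔤 (σ X) (σ Y) = starRingEnd ℂ (killingForm ℂ 𝔤 X Y) := by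
  rw [_root_.killingForm_apply_apply, _root_.killingForm_apply_apply]
  refine trace_eq_conj_trace_of_semiconj hσ.involutive fun Z ↦ ?_
  simp only [LinearMap.comp_apply, LieAlgebra.ad_apply, hσ.map_lie]

lemma IsConjugation.killingForm_apply_right (hσ : IsConjugation σ) (X Y : 𝔤) :
    killingForm ℂ 𝔤 X (σ Y) = starRingEnd ℂ (killingForm ℂ 𝔤 (σ X) Y) := by
  rw [← hσ.killingForm_apply_apply, hσ.involutive]

lemma IsCartanInvolution.exists_orthonormal_coordinates (hθ : IsCartanInvolution θ) :
    ∃ e : 𝔤 ≃ₗ[ℂ] EuclideanSpace ℂ (Fin (Module.finrank ℂ 𝔤)),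
      ∀ X Y, inner ℂ (e X) (e Y) = -killingForm ℂ 𝔤 Y (θ X) := by
  let core : InnerProductSpace.Core ℂ 𝔤 :=
    { inner := fun X Y ↦ -killingForm ℂ 𝔤 Y (θ X)
      conj_inner_symm := fun X Y ↦ by
        rw [map_neg, hθ.killingForm_apply_right, Complex.conj_conj, LieModule.traceForm_comm]
      re_inner_nonneg := fun X ↦ by
        rw [map_neg, neg_nonneg]
        rcases eq_or_ne X 0 with rfl | hX
        · simp only [map_zero, le_refl]
        · exact (hθ.neg_re_killing X hX).le
      add_left := fun X Y Z ↦ by rw [map_add, map_add, neg_add]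
      smul_left := fun X Y c ↦ by rw [map_smulₛₗ, map_smul, smul_eq_mul, mul_neg]
      definite := fun X hX ↦ hθ.eq_zero_of_killingForm (neg_eq_zero.mp hX) }
  let : NormedAddCommGroup 𝔤 := core.toNormedAddCommGroup
  let : InnerProductSpace ℂ 𝔤 := InnerProductSpace.ofCore core.toCore
  exact ⟨(stdOrthonormalBasis ℂ 𝔤).repr.toLinearEquiv,
    (stdOrthonormalBasis ℂ 𝔤).repr.inner_map_map⟩

lemma modelBracket_injective [LieAlgebra.IsKilling ℂ 𝔤] (e : 𝔤 ≃ₗ[ℂ] H) :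
    Function.Injective (modelBracket e) := by
  let : LieRing (Module.End ℂ 𝔤) := LieRing.ofAssociativeRing
  have had : Function.Injective (LieAlgebra.ad ℂ 𝔤 : 𝔤 →ₗ[ℂ] Module.End ℂ 𝔤) :=
    (LieHom.ker_eq_bot _).mp (LieAlgebra.ad_ker_eq_bot_of_hasTrivialRadical ℂ 𝔤)
  exact LinearMap.toContinuousLinearMap.injective.comp
    (e.conj.injective.comp (had.comp e.symm.injective))

lemma exists_modelBracket_eq_of_derivation [LieAlgebra.IsKilling ℂ 𝔤] (e : 𝔤 ≃ₗ[ℂ] H)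
    {D : H →L[ℂ] H} (hD : ∀ X Y, D (modelBracket e X Y) =
      modelBracket e (D X) Y + modelBracket e X (D Y)) : ∃ X, modelBracket e X = D := by
  let D' : LieDerivation ℂ 𝔤 𝔤 :=
    { toLinearMap := e.symm.toLinearMap ∘ₗ (D : H →ₗ[ℂ] H) ∘ₗ e.toLinearMap
      leibniz' := fun X Y ↦ by
        have hXY := hD (e X) (e Y)
        simp only [modelBracket_apply, e.symm_apply_apply] at hXY
        simp only [LinearMap.comp_apply, LinearEquiv.coe_coe, ContinuousLinearMap.coe_coe, hXY,
          map_add, e.symm_apply_apply]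
        rw [← lie_skew Y, sub_neg_eq_add, add_comm] }
  obtain ⟨X, hX⟩ := LieDerivation.IsKilling.exists_eq_ad D'
  refine ⟨e X, ContinuousLinearMap.ext fun Z ↦ ?_⟩
  have hXZ : ⁅X, e.symm Z⁆ = e.symm (D (e (e.symm Z))) := by
    have hT := congrArg (fun T : LieDerivation ℂ 𝔤 𝔤 ↦ T (e.symm Z)) hX
    rwa [LieDerivation.ad_apply_apply] at hT
  rw [modelBracket_apply, e.symm_apply_apply, hXZ, e.apply_symm_apply, e.apply_symm_apply]

/-- `e` identifies `𝔤`, with its bracket, its real form and its Cartan involution, with the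
data `L`, `σ'`, `θ'` on the Hilbert space `H`. -/
structure IsCartanModel (σ θ : 𝔤 →ₛₗ[starRingEnd ℂ] 𝔤) (e : 𝔤 ≃ₗ[ℂ] H)
    (L : H →ₗ[ℂ] (H →L[ℂ] H)) (σ' θ' : H →ₛₗ[starRingEnd ℂ] H) : Prop where
  map_lie : ∀ X Y, L (e X) (e Y) = e ⁅X, Y⁆
  map_σ : ∀ X, σ' (e X) = e (σ X)
  map_θ : ∀ X, θ' (e X) = e (θ X)
  cartanData : CartanData L σ' θ'

lemma cartanData_model (hσ : IsConjugation σ) (hθ : IsCartanInvolution θ)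
    (hσθ : ∀ X, σ (θ X) = θ (σ X)) {e : 𝔤 ≃ₗ[ℂ] H}
    (he : ∀ X Y, inner ℂ (e X) (e Y) = -killingForm ℂ 𝔤 Y (θ X)) :
    CartanData (modelBracket e) (modelConj e σ) (modelConj e θ) := by
  have := hθ.isKilling
  exact
    { skew := fun X Y ↦ by rw [modelBracket_apply, modelBracket_apply, ← lie_skew, map_neg]
      lie := fun X Y ↦ ContinuousLinearMap.ext fun Z ↦ by
        simp only [sub_apply, mul_apply_eq_comp, modelBracket_apply, e.symm_apply_apply, lie_lie,
          map_sub]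
      injective := modelBracket_injective e
      inner_derivation := fun D hD ↦ exists_modelBracket_eq_of_derivation e hD
      σ_invol := fun X ↦ by
        simp only [modelConj_apply, e.symm_apply_apply, hσ.involutive _, e.apply_symm_apply]
      θ_invol := fun X ↦ by
        simp only [modelConj_apply, e.symm_apply_apply, hθ.involutive _, e.apply_symm_apply]
      σ_θ := fun X ↦ by simp only [modelConj_apply, e.symm_apply_apply, hσθ]
      σ_lie := fun X Y ↦ by
        simp only [modelBracket_apply, modelConj_apply, e.symm_apply_apply, hσ.map_lie]
      θ_lie := fun X Y ↦ by
        simp only [modelBracket_apply, modelConj_apply, e.symm_apply_apply, hθ.map_lie]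
      star_L := star_modelBracket he hθ.toIsConjugation
      star_aut := fun _ ↦ star_apply_of_isBracketHom he hθ.toIsConjugation }

lemma exists_isCartanModel (hσ : IsConjugation σ) (hθ : IsCartanInvolution θ)
    (hσθ : ∀ X, σ (θ X) = θ (σ X)) :
    ∃ (e : 𝔤 ≃ₗ[ℂ] EuclideanSpace ℂ (Fin (Module.finrank ℂ 𝔤))) (L : _) (σ' θ' : _),
      IsCartanModel σ θ e L σ' θ' := by
  obtain ⟨e, he⟩ := hθ.exists_orthonormal_coordinates
  refine ⟨e, modelBracket e, modelConj e σ, modelConj e θ, fun X Y ↦ ?_, fun X ↦ ?_, fun X ↦ ?_,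
    cartanData_model hσ hθ hσθ he⟩
  · rw [modelBracket_apply, e.symm_apply_apply, e.symm_apply_apply]
  · rw [modelConj_apply, e.symm_apply_apply]
  · rw [modelConj_apply, e.symm_apply_apply]

end CartanModel

section Norm

lemma exists_hasEigenvalue_norm_eq {H : Type*} [NormedAddCommGroup H] [InnerProductSpace ℂ H]
    [FiniteDimensional ℂ H] {S : H →L[ℂ] H} (hS : IsSelfAdjoint S) (hS₀ : S ≠ 0) :
    ∃ c, Module.End.HasEigenvalue (S : H →ₗ[ℂ] H) c ∧ ‖S‖ = ‖c‖ := by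
  have : Nontrivial (H →L[ℂ] H) := nontrivial_of_ne _ _ hS₀
  obtain ⟨c, hc, hnorm⟩ := spectrum.exists_nnnorm_eq_spectralRadius S
  rw [hS.spectralRadius_eq_nnnorm, ENNReal.coe_inj] at hnorm
  rw [ContinuousLinearMap.spectrum_eq] at hc
  exact ⟨c, .of_mem_spectrum hc, congrArg NNReal.toReal hnorm.symm⟩

lemma exists_joint_eigenvector {𝕜 V ι : Type*} [RCLike 𝕜] [NormedAddCommGroup V]
    [InnerProductSpace 𝕜 V] [FiniteDimensional 𝕜 V] {T : ι → Module.End 𝕜 V}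
    (hT : ∀ i, (T i).IsSymmetric) (hcomm : ∀ i j, Commute (T i) (T j)) {i : ι} {c : 𝕜}
    (hc : (T i).HasEigenvalue c) :
    ∃ (χ : ι → 𝕜) (Y : V), Y ≠ 0 ∧ χ i = c ∧ ∀ j, T j Y = χ j • Y := by
  by_contra! hnone
  have htop : (⊤ : Submodule 𝕜 V) ≤ ⨆ (ν : 𝕜) (_ : ν ≠ c), (T i).eigenspace ν := by
    rw [← LinearMap.IsSymmetric.iSup_iInf_eq_top_of_commute hT fun j k _ ↦ hcomm j k]
    refine iSup_le fun χ ↦ ?_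
    rcases ne_or_eq (χ i) c with hχ | hχ
    · exact (iInf_le _ i).trans (le_iSup₂_of_le (χ i) hχ le_rfl)
    · intro Y hY
      rcases eq_or_ne Y 0 with rfl | hY₀
      · exact Submodule.zero_mem _
      · obtain ⟨j, hj⟩ := hnone χ Y hY₀ hχ
        exact absurd (Module.End.mem_eigenspace_iff.mp ((Submodule.mem_iInf _).mp hY j)) hj
  obtain ⟨X, hX⟩ := hc.exists_hasEigenvector
  exact hX.2 (Submodule.disjoint_def.mp ((T i).eigenspaces_iSupIndep c) X hX.1 (htop trivial))

variable {H : Type*} [NormedAddCommGroup H] [InnerProductSpace ℂ H] [FiniteDimensional ℂ H]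
  {L : H →ₗ[ℂ] (H →L[ℂ] H)} {σ' θ' : H →ₛₗ[starRingEnd ℂ] H}

/- If `Y + σ Y = 0`, then `Y` lies in `i 𝔤₀` and `i Y` is the required vector. -/
lemma CartanData.exists_fixed_joint_eigenvector (C : CartanData L σ' θ') {ι : Type*} {X : ι → H}
    (hX : ∀ i, σ' (X i) = X i) {χ : ι → ℝ} {Y : H} (hY : Y ≠ 0)
    (hLY : ∀ i, L (X i) Y = (χ i : ℂ) • Y) :
    ∃ W, W ≠ 0 ∧ σ' W = W ∧ ∀ i, L (X i) W = (χ i : ℂ) • W := by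
  have hLσY (i : ι) : L (X i) (σ' Y) = (χ i : ℂ) • σ' Y := by
    have h := C.σ_lie (X i) Y
    rw [hX, hLY, map_smulₛₗ, Complex.conj_ofReal] at h
    exact h.symm
  rcases eq_or_ne (Y + σ' Y) 0 with hadd | hadd
  · refine ⟨Complex.I • Y, smul_ne_zero Complex.I_ne_zero hY, ?_, fun i ↦ ?_⟩
    · rw [map_smulₛₗ, Complex.conj_I, ← neg_eq_iff_add_eq_zero.mpr hadd, smul_neg, neg_smul,
        neg_neg]
    · rw [map_smul, hLY, smul_comm]
  · refine ⟨Y + σ' Y, hadd, ?_, fun i ↦ ?_⟩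
    · rw [map_add, C.σ_invol, add_comm]
    · rw [map_add, hLY, hLσY, smul_add]

namespace IsCartanModel

variable {𝔤 : Type*} [LieRing 𝔤] [LieAlgebra ℂ 𝔤] {σ θ : 𝔤 →ₛₗ[starRingEnd ℂ] 𝔤}
  {e : 𝔤 ≃ₗ[ℂ] H} (hM : IsCartanModel σ θ e L σ' θ')

include hM

lemma map_σ_of_mem_noncompactPart {X : 𝔤} (hX : X ∈ noncompactPart σ θ) : σ' (e X) = e X := by
  rw [hM.map_σ]
  exact congrArg e hX.2

lemma map_θ_of_mem_noncompactPart {X : 𝔤} (hX : X ∈ noncompactPart σ θ) : θ' (e X) = -e X := by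
  rw [hM.map_θ, ← map_neg]
  exact congrArg e (neg_eq_iff_eq_neg.mp hX.1)

variable {𝔞₀ : Submodule ℝ 𝔤}

lemma exists_isRestrictedRoot {χ : 𝔞₀ → ℝ} {W : H} (hW : W ≠ 0) (hσW : σ' W = W)
    (hLW : ∀ ζ : 𝔞₀, L (e ζ) W = (χ ζ : ℂ) • W) {ξ : 𝔞₀} (hξ : χ ξ ≠ 0) :
    ∃ α, IsRestrictedRoot σ 𝔞₀ α ∧ α ξ = χ ξ := by
  simp only [Complex.coe_smul] at hLW
  let α : Module.Dual ℝ 𝔞₀ :=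
    { toFun := χ
      map_add' := fun ζ η ↦ smul_left_injective ℝ hW <| by
        simp only [add_smul, ← hLW, Submodule.coe_add, map_add, add_apply]
      map_smul' := fun c ζ ↦ smul_left_injective ℝ hW <| by
        simp only [smul_eq_mul, RingHom.id_apply, mul_smul, ← hLW]
        rw [Submodule.coe_smul, ← Complex.coe_smul, map_smul, map_smul, smul_apply,
          Complex.coe_smul] }
  refine ⟨α, ⟨fun hα ↦ hξ (LinearMap.congr_fun hα ξ), e.symm W, e.injective ?_, ?_, fun ζ ↦
    e.injective ?_⟩, rfl⟩
  · change e (σ (e.symm W)) = _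
    rw [← hM.map_σ, e.apply_symm_apply, hσW]
  · exact (map_ne_zero_iff e.symm e.symm.injective).mpr hW
  · rw [← hM.map_lie, e.apply_symm_apply, hLW, ← Complex.coe_smul, ← Complex.coe_smul, map_smul,
      e.apply_symm_apply]
    rfl

lemma norm_lt_of_mem_polyhedron (h𝔞₀ : 𝔞₀ ≤ noncompactPart σ θ)
    (hab : ∀ X ∈ 𝔞₀, ∀ Y ∈ 𝔞₀, ⁅X, Y⁆ = 0) {X : 𝔤} (hX : X ∈ polyhedron σ 𝔞₀) :
    ‖L (e X)‖ < Real.pi / 2 := by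
  obtain ⟨ξ, rfl, hξ⟩ := hX
  have C := hM.cartanData
  rcases eq_or_ne (L (e ξ)) 0 with hξ₀ | hξ₀
  · rw [hξ₀, norm_zero]
    positivity
  have hsa (ζ : 𝔞₀) : IsSelfAdjoint (L (e ζ)) :=
    C.isSelfAdjoint (hM.map_θ_of_mem_noncompactPart (h𝔞₀ ζ.2))
  have hsymm (ζ : 𝔞₀) : (L (e ζ) : H →ₗ[ℂ] H).IsSymmetric :=
    ContinuousLinearMap.isSelfAdjoint_iff_isSymmetric.mp (hsa ζ)
  have hcomm (ζ η : 𝔞₀) : Commute (L (e ζ) : H →ₗ[ℂ] H) (L (e η) : H →ₗ[ℂ] H) :=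
    congrArg ContinuousLinearMap.toLinearMap <|
      (C.commute_L (by rw [hM.map_lie, hab _ ζ.2 _ η.2, map_zero])).eq
  obtain ⟨c, hc, hnorm⟩ := exists_hasEigenvalue_norm_eq (hsa ξ) hξ₀
  obtain ⟨χ, Y, hY, hχξ, hLY⟩ := exists_joint_eigenvector hsymm hcomm hc
  have hχ_re (ζ : 𝔞₀) : ((χ ζ).re : ℂ) = χ ζ := Complex.conj_eq_iff_re.mp <|
    (hsymm ζ).conj_eigenvalue_eq_self <|
      Module.End.hasEigenvalue_of_hasEigenvector ⟨Module.End.mem_eigenspace_iff.mpr (hLY ζ), hY⟩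
  obtain ⟨W, hW, hσW, hLW⟩ := C.exists_fixed_joint_eigenvector (X := fun ζ : 𝔞₀ ↦ e ζ)
    (fun ζ ↦ hM.map_σ_of_mem_noncompactPart (h𝔞₀ ζ.2)) hY fun ζ ↦ (hLY ζ).trans (by rw [hχ_re])
  have hnorm_χ : ‖L (e ξ)‖ = |(χ ξ).re| := by
    rw [hnorm, ← hχξ, ← hχ_re, Complex.norm_real, Real.norm_eq_abs, Complex.ofReal_re]
  have hχξ₀ : (χ ξ).re ≠ 0 := by
    rwa [← abs_ne_zero, ← hnorm_χ, norm_ne_zero_iff]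
  obtain ⟨α, hα, hαξ⟩ := hM.exists_isRestrictedRoot hW hσW hLW hχξ₀
  rw [hnorm_χ, ← hαξ]
  exact hξ α hα

end IsCartanModel

end Norm

section OneParameter

variable {E : Type*} [NormedAddCommGroup E] [NormedSpace ℂ E]
  {G : Type*} [TopologicalSpace G] [ChartedSpace E G] [Group G] {γ : ℂ → G}
  {X : GroupLieAlgebra 𝓘(ℂ, E) G}

lemma IsOneParameter.map_zero (hγ : IsOneParameter γ X) : γ 0 = 1 := by
  have h := hγ.map_add 0 0
  rw [add_zero] at h
  exact left_eq_mul.mp h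

lemma IsOneParameter.hasFDerivAt_unitChart (hγ : IsOneParameter γ X) :
    HasFDerivAt (fun t ↦ unitChart E G (γ t))
      (ContinuousLinearMap.toSpanSingleton ℂ (X : E)) 0 := by
  have h := hγ.hasMFDerivAt.2
  simp only [writtenInExtChartAt, hγ.map_zero, ModelWithCorners.range_eq_univ] at h
  exact h.hasFDerivAt_of_univ

lemma isOneParameter_of_hasFDerivAt (hadd : ∀ s t, γ (s + t) = γ s * γ t) (hone : γ 0 = 1)
    (hcont : ContinuousAt γ 0) (hderiv : HasFDerivAt (fun t ↦ unitChart E G (γ t))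
      (ContinuousLinearMap.toSpanSingleton ℂ (X : E)) 0) : IsOneParameter γ X := by
  refine ⟨hadd, hcont, ?_⟩
  simp only [writtenInExtChartAt, hone, ModelWithCorners.range_eq_univ]
  exact hderiv.hasFDerivWithinAt

end OneParameter

section LieGroupModel

variable {E : Type*} [NormedAddCommGroup E] [NormedSpace ℂ E]
  {G : Type*} [TopologicalSpace G] [ChartedSpace E G] [Group G]
  {H : Type*} [NormedAddCommGroup H] [InnerProductSpace ℂ H]

/-- The exponential map of `G` in the coordinates `e` on its Lie algebra. -/
def modelExp (e : GroupLieAlgebra 𝓘(ℂ, E) G ≃ₗ[ℂ] H) (Y : H) : G := lieExp (e.symm Y)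

lemma lieExp_eq_modelExp (e : GroupLieAlgebra 𝓘(ℂ, E) G ≃ₗ[ℂ] H)
    (X : GroupLieAlgebra 𝓘(ℂ, E) G) : lieExp X = modelExp e (e X) := by
  rw [modelExp, e.symm_apply_apply]

variable [FiniteDimensional ℂ E]

/-- The coordinates `e` on the Lie algebra of `G`, as a continuous linear equivalence from the
model space `E` of `G`. -/
def modelEquiv (e : GroupLieAlgebra 𝓘(ℂ, E) G ≃ₗ[ℂ] H) : E ≃L[ℂ] H :=
  LinearEquiv.toContinuousLinearEquiv (E := E) (F := H) e

lemma continuous_modelEquiv (e : GroupLieAlgebra 𝓘(ℂ, E) G ≃ₗ[ℂ] H) :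
    Continuous fun X : GroupLieAlgebra 𝓘(ℂ, E) G ↦ e X :=
  (modelEquiv e).continuous

lemma continuous_modelEquiv_symm (e : GroupLieAlgebra 𝓘(ℂ, E) G ≃ₗ[ℂ] H) :
    Continuous fun Y : H ↦ (e.symm Y : GroupLieAlgebra 𝓘(ℂ, E) G) :=
  (modelEquiv e).symm.continuous

variable [LieGroup 𝓘(ℂ, E) ω G] (e : GroupLieAlgebra 𝓘(ℂ, E) G ≃ₗ[ℂ] H)

/-- The adjoint representation of `G` transported along the coordinates `e`. -/
def modelAd : G →* (H →L[ℂ] H) where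
  toFun g := ((modelEquiv e : E →L[ℂ] H).comp (adChart E g)).comp ((modelEquiv e).symm : H →L[ℂ] E)
  map_one' := by
    rw [adChart_one]
    exact ContinuousLinearMap.ext (modelEquiv e).apply_symm_apply
  map_mul' g h := by
    rw [adChart_mul]
    ext1 Y
    simp only [mul_apply_eq_comp, ContinuousLinearMap.comp_apply, ContinuousLinearEquiv.coe_coe,
      ContinuousLinearEquiv.symm_apply_apply]

variable {e}

lemma modelAd_apply (g : G) (X : GroupLieAlgebra 𝓘(ℂ, E) G) :
    modelAd e g (e X) = e (lieAd g X) := by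
  rw [lieAd_eq_adChart]
  exact congrArg (fun Z ↦ modelEquiv e (adChart E g Z)) (e.symm_apply_apply X)

lemma continuous_modelAd : Continuous (modelAd e) :=
  (continuous_const.clm_comp continuous_adChart).clm_comp continuous_const

variable [FiniteDimensional ℂ H] [CompleteSpace E] {L : H →ₗ[ℂ] (H →L[ℂ] H)}
  {σ θ : GroupLieAlgebra 𝓘(ℂ, E) G →ₛₗ[starRingEnd ℂ] GroupLieAlgebra 𝓘(ℂ, E) G}
  {σ' θ' : H →ₛₗ[starRingEnd ℂ] H}

namespace IsCartanModel

variable (hM : IsCartanModel σ θ e L σ' θ')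

include hM

lemma isBracketHom_modelAd (g : G) : IsBracketHom L (modelAd e g) := by
  intro X Y
  obtain ⟨X, rfl⟩ := e.surjective X
  obtain ⟨Y, rfl⟩ := e.surjective Y
  rw [hM.map_lie, modelAd_apply, modelAd_apply, modelAd_apply, hM.map_lie, lieAd_lie]

lemma hasStrictFDerivAt_modelAd :
    HasStrictFDerivAt (fun x : E ↦ modelAd e ((unitChart E G).symm x))
      ((LinearMap.toContinuousLinearMap L).comp (modelEquiv e : E →L[ℂ] H)) (unitChart E G 1) := by
  obtain ⟨D, hD, hD_lie⟩ := exists_hasStrictFDerivAt_adChart (E := E) (G := G)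
  let T : (E →L[ℂ] E) →L[ℂ] (H →L[ℂ] H) :=
    ((ContinuousLinearMap.compL ℂ H E H).flip ((modelEquiv e).symm : H →L[ℂ] E)).comp
      (ContinuousLinearMap.compL ℂ E E H (modelEquiv e : E →L[ℂ] H))
  refine (T.hasStrictFDerivAt.comp (unitChart E G 1) hD).congr_fderiv ?_
  ext1 u
  ext1 Y
  have hlie := (hM.map_lie u (e.symm Y)).symm
  rw [e.apply_symm_apply] at hlie
  exact (congrArg (modelEquiv e) (hD_lie u (e.symm Y))).trans hlie

lemma modelAd_of_isOneParameter {γ : ℂ → G} {Y : H} (hγ : IsOneParameter γ (e.symm Y)) (t : ℂ) :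
    modelAd e (γ t) = exp (t • L Y) := by
  refine eq_exp_smul_of_map_add (f := fun t ↦ modelAd e (γ t)) (fun s t ↦ ?_) ?_ ?_ t
  · rw [hγ.map_add, map_mul]
  · rw [hγ.map_zero, map_one]
  · have hAd := hM.hasStrictFDerivAt_modelAd.hasFDerivAt
    rw [← hγ.map_zero] at hAd
    have hcomp := (hAd.comp (0 : ℂ) hγ.hasFDerivAt_unitChart).hasDerivAt
    have hcont : Tendsto γ (𝓝 0) (𝓝 1) := hγ.map_zero ▸ hγ.hasMFDerivAt.1
    have heq : (fun t ↦ modelAd e (γ t)) =ᶠ[𝓝 0]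
        fun t ↦ modelAd e ((unitChart E G).symm (unitChart E G (γ t))) := by
      filter_upwards [hcont.eventually (eventually_unitChart_symm_unitChart (E := E))] with t ht
      rw [ht]
    refine (hcomp.congr_of_eventuallyEq heq).congr_deriv ?_
    refine congrArg L ((congrArg e (one_smul ℂ (e.symm Y))).trans (e.apply_symm_apply Y))

lemma exists_isLocalSection_modelAd :
    ∃ (s : (H →L[ℂ] H) → G) (D : (H →L[ℂ] H) →L[ℂ] E), IsLocalSection L (modelAd e) s ∧
      HasFDerivAt (fun a ↦ unitChart E G (s a)) D 1 ∧ ∀ X, D (L X) = (modelEquiv e).symm X := by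
  obtain ⟨Ψ, D, hΨ_one, hΨ_deriv, hDL, hleft, hright, hΨ_cont⟩ :=
    hM.cartanData.exists_local_inverse (modelEquiv e) hM.hasStrictFDerivAt_modelAd
      (by rw [unitChart_symm_one, map_one]) (.of_forall fun x ↦ hM.isBracketHom_modelAd _)
  have hΨ : Tendsto Ψ (𝓝 1) (𝓝 (unitChart E G 1)) := hΨ_one ▸ hΨ_deriv.continuousAt.tendsto
  have hchart : Tendsto (unitChart E G) (𝓝 1) (𝓝 (unitChart E G 1)) :=
    continuousAt_extChartAt (I := 𝓘(ℂ, E)) (1 : G)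
  have hchart_symm : ∀ᶠ x in 𝓝 (unitChart E G 1), ContinuousAt (unitChart E G).symm x := by
    filter_upwards [extChartAt_target_mem_nhds (I := 𝓘(ℂ, E)) (1 : G)] with x hx
    exact continuousAt_extChartAt_symm'' hx
  refine ⟨fun a ↦ (unitChart E G).symm (Ψ a), D, ⟨?_, ?_, hright, ?_⟩, ?_, hDL⟩
  · rw [hΨ_one, unitChart_symm_one]
  · filter_upwards [eventually_unitChart_symm_unitChart (E := E), hchart.eventually hleft]
      with g hg hΨg
    rw [hg] at hΨg
    rw [hΨg, hg]
  · filter_upwards [hΨ_cont, hΨ.eventually hchart_symm] with a hΨa hsymm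
    exact hsymm.comp hΨa
  · exact hΨ_deriv.congr_of_eventuallyEq
      (hΨ.eventually (eventually_unitChart_unitChart_symm (E := E) (G := G)))

lemma isOneParameter_of_isExpMap {F : H → G} (hF : IsExpMap L (modelAd e) F)
    {s : (H →L[ℂ] H) → G} (hFs : ∀ᶠ X in 𝓝 0, F X = s (exp (L X))) {D : (H →L[ℂ] H) →L[ℂ] E}
    (hD : HasFDerivAt (fun a ↦ unitChart E G (s a)) D 1)
    (hDL : ∀ X, D (L X) = (modelEquiv e).symm X) (Y : H) :
    IsOneParameter (fun t : ℂ ↦ F (t • Y)) (e.symm Y) := by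
  have hadd (s t : ℂ) : F ((s + t) • Y) = F (s • Y) * F (t • Y) := by
    rw [add_smul, hF.map_add _ _ (hM.cartanData.L_smul_smul s t Y)]
  have hone : F ((0 : ℂ) • Y) = 1 := by
    have h := hadd 0 0
    rw [add_zero] at h
    exact left_eq_mul.mp h
  have hline : Continuous fun t : ℂ ↦ t • Y := by fun_prop
  have hline_zero : Tendsto (fun t : ℂ ↦ t • Y) (𝓝 0) (𝓝 0) := by
    simpa only [zero_smul] using hline.tendsto 0
  refine isOneParameter_of_hasFDerivAt hadd hone (hF.continuous.comp hline).continuousAt ?_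
  have hexp : HasDerivAt (fun t : ℂ ↦ exp (t • L Y)) (L Y) 0 := by
    simpa only [zero_smul, exp_zero, one_mul] using hasDerivAt_exp_smul_const (L Y) (0 : ℂ)
  have hD' : HasFDerivAt (fun a ↦ unitChart E G (s a)) D (exp ((0 : ℂ) • L Y)) := by
    rwa [zero_smul, exp_zero]
  have heq : (fun t : ℂ ↦ unitChart E G (F (t • Y))) =ᶠ[𝓝 0]
      fun t : ℂ ↦ unitChart E G (s (exp (t • L Y))) := by
    filter_upwards [hline_zero.eventually hFs] with t ht
    rw [ht, map_smul]
  refine ((hD'.comp_hasDerivAt (0 : ℂ) hexp).hasFDerivAt.congr_of_eventuallyEq heq).congr_fderiv ?_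
  rw [hDL]
  rfl

lemma isExpMap_modelExp : IsExpMap L (modelAd e) (modelExp e) := by
  have := topologicalGroup_of_lieGroup 𝓘(ℂ, E) ω (G := G)
  obtain ⟨s, D, hs, hD, hDL⟩ := hM.exists_isLocalSection_modelAd
  obtain ⟨F, hF, hFs⟩ := exists_isExpMap hM.cartanData continuous_modelAd hM.isBracketHom_modelAd hs
  have heq (Y : H) : modelExp e Y = F Y := by
    have hex : ∃ γ : ℂ → G, IsOneParameter γ (e.symm Y) :=
      ⟨_, hM.isOneParameter_of_isExpMap hF hFs hD hDL Y⟩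
    rw [modelExp, lieExp, dif_pos hex]
    exact hF.unique _ Y hex.choose_spec.map_add hex.choose_spec.hasMFDerivAt.1
      (hM.modelAd_of_isOneParameter hex.choose_spec)
  exact (funext heq : modelExp e = F) ▸ hF

end IsCartanModel

end LieGroupModel

section CartanDecomposition

variable {H : Type*} [NormedAddCommGroup H] [InnerProductSpace ℂ H]
  {L : H →ₗ[ℂ] (H →L[ℂ] H)} {σ θ : H →ₛₗ[starRingEnd ℂ] H} {G : Type*} [Group G]
  {ρ : G →* (H →L[ℂ] H)} {E : H → G}

/-- The operator `ρ g` as a unit of the algebra of operators, with inverse `ρ g⁻¹`. -/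
abbrev unitOf (ρ : G →* (H →L[ℂ] H)) (g : G) : (H →L[ℂ] H)ˣ := Units.map ρ (toUnits g)

/-- The elements of `G` whose adjoint action commutes with `τ`. -/
def adCommutant (ρ : G →* (H →L[ℂ] H)) (τ : H →ₛₗ[starRingEnd ℂ] H) : Subgroup G where
  carrier := {g | Function.Commute (ρ g) τ}
  one_mem' X := by rw [map_one]; rfl
  mul_mem' {g h} hg hh X := by rw [map_mul]; exact Function.Commute.comp_left hg hh X
  inv_mem' {g} hg := commute_unit_inv (a := unitOf ρ g) hg

/-- The connected subgroup for the real form `σ`. -/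
def realGroup (E : H → G) (σ : H →ₛₗ[starRingEnd ℂ] H) : Subgroup G :=
  Subgroup.closure (E '' {X | σ X = X})

/-- The connected subgroup for the intersection of the real forms of `σ` and `θ`. -/
def compactGroup (E : H → G) (σ θ : H →ₛₗ[starRingEnd ℂ] H) : Subgroup G :=
  Subgroup.closure (E '' {X | θ X = X ∧ σ X = X})

lemma exists_injOn_exp (A : Type*) [NormedRing A] [NormedAlgebra ℂ A] [CompleteSpace A] :
    ∃ V ∈ 𝓝 (0 : A), Set.InjOn exp V := by
  have hexp : HasStrictFDerivAt (exp : A → A) ((ContinuousLinearEquiv.refl ℂ A : A →L[ℂ] A)) 0 :=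
    hasStrictFDerivAt_exp_zero (𝕂 := ℂ)
  exact ⟨_, (hexp.toOpenPartialHomeomorph exp).open_source.mem_nhds
    hexp.mem_toOpenPartialHomeomorph_source, (hexp.toOpenPartialHomeomorph exp).injOn⟩

variable [FiniteDimensional ℂ H]

lemma CartanData.eventually_apply_eq_of_commute_exp (C : CartanData L σ θ)
    {τ : H →ₛₗ[starRingEnd ℂ] H} (hτ : Function.Involutive τ)
    (hτL : ∀ X Y, τ (L X Y) = L (τ X) (τ Y)) :
    ∀ᶠ X in 𝓝 0, Function.Commute (exp (L X) : H →L[ℂ] H) τ → τ X = X := by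
  obtain ⟨V, hV, hinj⟩ := exists_injOn_exp (H →L[ℂ] H)
  have hLτ : Tendsto (fun X ↦ L (τ X)) (𝓝 0) (𝓝 0) := by
    have h := (L.continuous_of_finiteDimensional.comp (continuous_antilinear τ)).tendsto 0
    rwa [Function.comp_apply, map_zero, map_zero] at h
  have hL : Tendsto L (𝓝 0) (𝓝 0) := by
    simpa only [map_zero] using L.continuous_of_finiteDimensional.tendsto 0
  filter_upwards [hL.eventually hV, hLτ.eventually hV] with X hX hτX hcomm
  refine C.injective (hinj hτX hX (ContinuousLinearMap.ext fun Y ↦ ?_))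
  rw [← hτ Y, hcomm, antilinear_exp (hτL X)]

lemma IsExpMap.realGroup_le [TopologicalSpace G] (hE : IsExpMap L ρ E) (C : CartanData L σ θ) :
    realGroup E σ ≤ adCommutant ρ σ := by
  refine (Subgroup.closure_le _).mpr ?_
  rintro _ ⟨X, hX, rfl⟩
  change Function.Commute _ _
  rw [hE.map_apply]
  exact C.commute_exp_σ hX

namespace IsExpMap

variable [TopologicalSpace G] (hE : IsExpMap L ρ E)

include hE

lemma map_zero : E 0 = 1 := by
  have h := hE.map_add 0 0 (_root_.map_zero _)
  rw [add_zero] at h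
  exact left_eq_mul.mp h

variable (C : CartanData L σ θ)

include C

lemma map_neg (X : H) : E (-X) = (E X)⁻¹ := by
  have hLX : L (-X) X = 0 := by simpa using C.L_smul_smul (-1) 1 X
  rw [eq_inv_iff_mul_eq_one, ← hE.map_add _ _ hLX, neg_add_cancel, hE.map_zero]

lemma compactGroup_le : compactGroup E σ θ ≤ adCommutant ρ σ ⊓ adCommutant ρ θ := by
  refine (Subgroup.closure_le _).mpr ?_
  rintro _ ⟨X, ⟨hθX, hσX⟩, rfl⟩
  refine ⟨?_, ?_⟩ <;> change Function.Commute _ _ <;> rw [hE.map_apply]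
  exacts [C.commute_exp_σ hσX, C.commute_exp_θ hθX]

lemma eventually_mem_compactGroup :
    ∀ᶠ k in 𝓝 (1 : G), k ∈ adCommutant ρ σ ⊓ adCommutant ρ θ → k ∈ compactGroup E σ θ := by
  filter_upwards [hE.exists_mem_eq _ ((C.eventually_apply_eq_of_commute_exp C.θ_invol C.θ_lie).and
    (C.eventually_apply_eq_of_commute_exp C.σ_invol C.σ_lie))]
  rintro _ ⟨X, ⟨hθX, hσX⟩, rfl⟩ ⟨hσ, hθ⟩
  rw [← hE.map_apply] at hθX hσX
  exact Subgroup.subset_closure ⟨X, ⟨hθX hθ, hσX hσ⟩, rfl⟩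

lemma mem_compactGroup_of_preconnectedSpace [IsTopologicalGroup G] {T : Type*}
    [TopologicalSpace T] [PreconnectedSpace T] {γ : T → G} (hγ : Continuous γ)
    (hmem : ∀ t, γ t ∈ adCommutant ρ σ ⊓ adCommutant ρ θ) {s : T}
    (hs : γ s ∈ compactGroup E σ θ) (t : T) : γ t ∈ compactGroup E σ θ := by
  suffices IsLocallyConstant fun t ↦ γ t ∈ compactGroup E σ θ from
    (this.apply_eq_of_isPreconnected isPreconnected_univ (Set.mem_univ s) (Set.mem_univ t)).mp hs
  rw [IsLocallyConstant.iff_eventually_eq]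
  intro t
  have hquot : Tendsto (fun s ↦ (γ t)⁻¹ * γ s) (𝓝 t) (𝓝 1) := by
    have h := (hγ.const_mul (γ t)⁻¹).tendsto t
    rwa [inv_mul_cancel] at h
  filter_upwards [hquot.eventually (hE.eventually_mem_compactGroup C)] with s hs
  have hk := hs (Subgroup.mul_mem _ (Subgroup.inv_mem _ (hmem t)) (hmem s))
  rw [← mul_inv_cancel_left (γ t) (γ s), Subgroup.mul_mem_cancel_right _ hk]

end IsExpMap

namespace CartanData

variable (C : CartanData L σ θ) (hρL : ∀ g, IsBracketHom L (ρ g))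

include C hρL

lemma isUnitaryAut_map {k : G} (hk : k ∈ adCommutant ρ σ ⊓ adCommutant ρ θ) :
    IsUnitaryAut L σ θ (ρ k) := by
  refine ⟨?_, hρL k, hk.1, hk.2⟩
  have hstar : star (ρ k) = ρ k⁻¹ := ContinuousLinearMap.ext fun X ↦ by
    rw [show star (ρ k) X = θ (ρ k⁻¹ (θ X)) from C.star_aut (unitOf ρ k) (hρL k) X,
      ((adCommutant ρ θ).inv_mem hk.2 : Function.Commute (ρ k⁻¹) θ), C.θ_invol]
  rw [Unitary.mem_iff, hstar, ← map_mul, ← map_mul, inv_mul_cancel, mul_inv_cancel, map_one]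
  exact ⟨rfl, rfl⟩

variable {Λ : (H →L[ℂ] H) →L[ℂ] H} (hΛ : Function.LeftInverse Λ L) [TopologicalSpace G]
  (hE : IsExpMap L ρ E)

include hΛ hE

lemma polarLog_map_exp_mul {X : H} (hX : θ X = -X) {k : G} (hk : k ∈ compactGroup E σ θ) :
    polarLog Λ (ρ (E X * k)) = X := by
  rw [map_mul, hE.map_apply]
  exact C.polarLog_exp_mul hΛ hX
    (Unitary.mem_iff.mp (C.isUnitaryAut_map hρL (hE.compactGroup_le C hk)).mem_unitary).2

lemma exp_neg_polarLog_mul_mem {g : G} (hg : g ∈ adCommutant ρ σ) :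
    E (-polarLog Λ (ρ g)) * g ∈ adCommutant ρ σ ⊓ adCommutant ρ θ := by
  have h := C.isUnitaryAut_polar hΛ (a := unitOf ρ g) (hρL g) hg
  have hmap : ρ (E (-polarLog Λ (ρ g)) * g) = exp (-L (polarLog Λ (ρ g))) * ρ g := by
    rw [map_mul, hE.map_apply, map_neg]
  refine ⟨?_, ?_⟩ <;> change Function.Commute _ _ <;> rw [hmap]
  exacts [h.commute_σ, h.commute_θ]

end CartanData

variable [TopologicalSpace G]

lemma continuous_polarLog_map (hρ : Continuous ρ) (Λ : (H →L[ℂ] H) →L[ℂ] H) :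
    Continuous fun g ↦ polarLog Λ (ρ g) :=
  continuous_iff_continuousAt.mpr fun g ↦ tendsto_polarLog Λ (unitOf ρ g).isUnit
    (fun h ↦ (unitOf ρ h).isUnit) (hρ.tendsto g)

lemma CartanData.exp_neg_polarLog_mul_mem_compactGroup [IsTopologicalGroup G]
    (C : CartanData L σ θ) {Λ : (H →L[ℂ] H) →L[ℂ] H} (hΛ : Function.LeftInverse Λ L)
    (hρ : Continuous ρ) (hρL : ∀ g, IsBracketHom L (ρ g)) (hE : IsExpMap L ρ E) {g : G}
    (hg : g ∈ realGroup E σ) : E (-polarLog Λ (ρ g)) * g ∈ compactGroup E σ θ := by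
  -- Along `t ↦ g exp (t X)` the compact factor moves in the commutant of `σ` and `θ`, where the
  -- cosets of `compactGroup E σ θ` are open.
  let κ (g : G) : G := E (-polarLog Λ (ρ g)) * g
  have hκ : Continuous κ :=
    (hE.continuous.comp (continuous_polarLog_map hρ Λ).neg).mul continuous_id
  have hstep {g : G} (hg : g ∈ realGroup E σ) {X : H} (hX : σ X = X)
      (hκg : κ g ∈ compactGroup E σ θ) : κ (g * E X) ∈ compactGroup E σ θ := by
    let γ (t : ℝ) : G := κ (g * E ((t : ℂ) • X))
    have hγ : Continuous γ :=
      hκ.comp (continuous_const.mul (hE.continuous.comp (by fun_prop)))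
    have hγmem (t : ℝ) : γ t ∈ adCommutant ρ σ ⊓ adCommutant ρ θ := by
      have htX : σ ((t : ℂ) • X) = (t : ℂ) • X := by rw [map_smulₛₗ, Complex.conj_ofReal, hX]
      exact C.exp_neg_polarLog_mul_mem hρL hΛ hE
        (hE.realGroup_le C (mul_mem hg (Subgroup.subset_closure ⟨_, htX, rfl⟩)))
    have hγ_zero : γ 0 = κ g := by
      simp only [γ, Complex.ofReal_zero, zero_smul, hE.map_zero, mul_one]
    have hγ_one : γ 1 = κ (g * E X) := by simp only [γ, Complex.ofReal_one, one_smul]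
    rw [← hγ_zero] at hκg
    exact hγ_one ▸ hE.mem_compactGroup_of_preconnectedSpace C hγ hγmem hκg 1
  induction hg using Subgroup.closure_induction_right with
  | one =>
    have hlog := C.polarLog_map_exp_mul hρL hΛ hE (X := 0) (by rw [map_zero, neg_zero])
      (compactGroup E σ θ).one_mem
    rw [hE.map_zero, mul_one] at hlog
    rw [hlog, neg_zero, hE.map_zero, mul_one]
    exact one_mem _
  | mul_right g hg y hy ih =>
    obtain ⟨X, hX, rfl⟩ := hy
    exact hstep hg hX ih
  | mul_inv_cancel g hg y hy ih =>
    obtain ⟨X, hX, rfl⟩ := hy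
    rw [← hE.map_neg C]
    exact hstep hg (by rw [map_neg, show σ X = X from hX]) ih

end CartanDecomposition

section CartanImmersion

variable {H : Type*} [NormedAddCommGroup H] [InnerProductSpace ℂ H]
  {L : H →ₗ[ℂ] (H →L[ℂ] H)} {σ θ : H →ₛₗ[starRingEnd ℂ] H} {G : Type*} [Group G]
  {ρ : G →* (H →L[ℂ] H)} {E : H → G}

/-- The connected subgroup for the complexification of the intersection of two real forms. -/
def complexGroup (E : H → G) (σ θ : H →ₛₗ[starRingEnd ℂ] H) : Subgroup G :=
  Subgroup.closure (E '' (Submodule.span ℂ {X | θ X = X ∧ σ X = X} : Submodule ℂ H))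

variable [FiniteDimensional ℂ H]

/-- The complex linear involution `σ ∘ θ`. -/
def complexInvolution (σ θ : H →ₛₗ[starRingEnd ℂ] H) : H →L[ℂ] H :=
  LinearMap.toContinuousLinearMap (σ.comp θ : H →ₗ[ℂ] H)

lemma complexInvolution_apply (X : H) : complexInvolution σ θ X = σ (θ X) := rfl

/-- The map `g K ↦ g τ g⁻¹ τ`, where `τ = σ ∘ θ` is the complex linear involution fixing `K`. -/
def cartanImmersion (ρ : G →* (H →L[ℂ] H)) (σ θ : H →ₛₗ[starRingEnd ℂ] H) (g : G) : H →L[ℂ] H :=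
  ρ g * complexInvolution σ θ * ρ g⁻¹ * complexInvolution σ θ

lemma complexInvolution_eq_neg {X : H} (hσ : σ X = X) (hθ : θ X = -X) :
    complexInvolution σ θ X = -X := by
  rw [complexInvolution_apply, hθ, map_neg, hσ]

lemma complexInvolution_eq_self {X : H} (hX : X ∈ Submodule.span ℂ {X | θ X = X ∧ σ X = X}) :
    complexInvolution σ θ X = X := by
  have hle : Submodule.span ℂ {X | θ X = X ∧ σ X = X} ≤
      (LinearMap.eqLocus (complexInvolution σ θ : H →ₗ[ℂ] H) LinearMap.id) :=
    Submodule.span_le.mpr fun Y hY ↦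
      show complexInvolution σ θ Y = Y by rw [complexInvolution_apply, hY.1, hY.2]
  exact hle hX

namespace CartanData

variable (C : CartanData L σ θ)

include C

lemma complexInvolution_mul_self : complexInvolution σ θ * complexInvolution σ θ = 1 := by
  ext1 X
  simp only [mul_apply_eq_comp, complexInvolution_apply, ← C.σ_θ (θ X), C.σ_invol _,
    C.θ_invol _, one_apply_eq_self]

lemma complexInvolution_mul_exp (X : H) :
    complexInvolution σ θ * exp (L X) =
      exp (L (complexInvolution σ θ X)) * complexInvolution σ θ := by
  ext1 Y
  simp only [mul_apply_eq_comp, complexInvolution_apply]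
  rw [antilinear_exp (C.θ_lie X), antilinear_exp (C.σ_lie (θ X))]

end CartanData

section Topology

variable [TopologicalSpace G]

lemma continuous_cartanImmersion [ContinuousInv G] (hρ : Continuous ρ) :
    Continuous (cartanImmersion ρ σ θ) :=
  ((hρ.mul continuous_const).mul (hρ.comp continuous_inv)).mul continuous_const

namespace IsExpMap

variable (hE : IsExpMap L ρ E) (C : CartanData L σ θ)

include hE C

lemma commute_complexInvolution {k : G} (hk : k ∈ complexGroup E σ θ) :
    Commute (ρ k) (complexInvolution σ θ) := by
  induction hk using Subgroup.closure_induction with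
  | mem k hk =>
    obtain ⟨X, hX, rfl⟩ := hk
    rw [hE.map_apply, commute_iff_eq, C.complexInvolution_mul_exp, complexInvolution_eq_self hX]
  | one => rw [map_one]; exact Commute.one_left _
  | mul g h _ _ hg hh => rw [map_mul]; exact hg.mul_left hh
  | inv g _ hg => exact Commute.units_inv_left (u := unitOf ρ g) hg

lemma cartanImmersion_mul (g : G) {k : G} (hk : k ∈ complexGroup E σ θ) :
    cartanImmersion ρ σ θ (g * k) = cartanImmersion ρ σ θ g := by
  have hinv : ρ k * ρ k⁻¹ = 1 := by rw [← map_mul, mul_inv_cancel, map_one]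
  simp only [cartanImmersion, mul_inv_rev, map_mul]
  calc _ = ρ g * (ρ k * complexInvolution σ θ) * ρ k⁻¹ * ρ g⁻¹ * complexInvolution σ θ := by
        noncomm_ring
    _ = ρ g * complexInvolution σ θ * (ρ k * ρ k⁻¹) * ρ g⁻¹ * complexInvolution σ θ := by
        rw [(hE.commute_complexInvolution C hk).eq]; noncomm_ring
    _ = _ := by rw [hinv, mul_one]

lemma cartanImmersion_exp_mul_exp {X Y : H} (hXσ : σ X = X) (hXθ : θ X = -X) (hYσ : σ Y = Y)
    (hYθ : θ Y = -Y) : cartanImmersion ρ σ θ (E X * E (Complex.I • Y)) =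
      exp (L X) * exp (L ((2 * Complex.I) • Y)) * exp (L X) := by
  have hmove {Z : H} (hZ : complexInvolution σ θ Z = -Z) :
      complexInvolution σ θ * exp (L (-Z)) = exp (L Z) * complexInvolution σ θ := by
    rw [C.complexInvolution_mul_exp, _root_.map_neg, hZ, neg_neg]
  have hX := hmove (complexInvolution_eq_neg hXσ hXθ)
  have hY := hmove (Z := Complex.I • Y)
    (by rw [map_smul, complexInvolution_eq_neg hYσ hYθ, smul_neg])
  have hexp : exp (L ((2 * Complex.I) • Y)) =
      exp (L (Complex.I • Y)) * exp (L (Complex.I • Y)) := by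
    rw [← exp_add_self, ← _root_.map_add, ← two_smul ℂ, smul_smul]
  have hE_neg (Z : H) : ρ (E Z)⁻¹ = exp (L (-Z)) := by rw [← hE.map_neg C, hE.map_apply]
  rw [cartanImmersion, mul_inv_rev, map_mul, map_mul, hE.map_apply, hE.map_apply, hE_neg, hE_neg,
    hexp]
  set τ := complexInvolution σ θ
  calc _ = exp (L X) * exp (L (Complex.I • Y)) * (τ * exp (L (-(Complex.I • Y)))) *
        exp (L (-X)) * τ := by noncomm_ring
    _ = exp (L X) * exp (L (Complex.I • Y)) * exp (L (Complex.I • Y)) *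
        (τ * exp (L (-X))) * τ := by rw [hY]; noncomm_ring
    _ = exp (L X) * (exp (L (Complex.I • Y)) * exp (L (Complex.I • Y))) * exp (L X) *
        (τ * τ) := by rw [hX]; noncomm_ring
    _ = _ := by rw [C.complexInvolution_mul_self, mul_one]

end IsExpMap

end Topology

end CartanImmersion

section Tangent

variable {E : Type*} [NormedAddCommGroup E] [NormedSpace ℂ E]
  {G : Type*} [TopologicalSpace G] [ChartedSpace E G] [Group G]
  {H : Type*} [NormedAddCommGroup H] [InnerProductSpace ℂ H]
  {σ θ : GroupLieAlgebra 𝓘(ℂ, E) G →ₛₗ[starRingEnd ℂ] GroupLieAlgebra 𝓘(ℂ, E) G}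
  {σ' θ' : H →ₛₗ[starRingEnd ℂ] H}

lemma analyticSubgroup_eq_closure (e : GroupLieAlgebra 𝓘(ℂ, E) G ≃ₗ[ℂ] H)
    (W : Set (GroupLieAlgebra 𝓘(ℂ, E) G)) :
    analyticSubgroup W = Subgroup.closure (modelExp e '' (e '' W)) := by
  rw [analyticSubgroup, Set.image_image]
  exact congrArg Subgroup.closure (Set.image_congr fun X _ ↦ lieExp_eq_modelExp e X)

/-- The intersection of the real form of `σ'` with the `-1`-eigenspace of `θ'`. In the model it
stands for `𝔰₀`. -/
def noncompactSet (σ' θ' : H →ₛₗ[starRingEnd ℂ] H) : Set H := {X | σ' X = X ∧ θ' X = -X}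

lemma starConvex_noncompactSet : StarConvex ℝ 0 (noncompactSet σ' θ') := by
  rw [starConvex_zero_iff]
  rintro X ⟨hσ, hθ⟩ a - -
  rw [← Complex.coe_smul]
  constructor
  · rw [map_smulₛₗ, Complex.conj_ofReal, hσ]
  · rw [map_smulₛₗ, Complex.conj_ofReal, hθ, smul_neg]

lemma zero_mem_noncompactSet : (0 : H) ∈ noncompactSet σ' θ' :=
  ⟨map_zero σ', by rw [map_zero, neg_zero]⟩

variable [LieGroup 𝓘(ℂ, E) ω G]

section CartanFactors

variable [FiniteDimensional ℂ E] [FiniteDimensional ℂ H]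
  {e : GroupLieAlgebra 𝓘(ℂ, E) G ≃ₗ[ℂ] H} {Λ : (H →L[ℂ] H) →L[ℂ] H}

/-- The element `η` of `𝔰₀` in the Cartan decomposition `g = exp η k` of `g ∈ G₀`. -/
def cartanLog (e : GroupLieAlgebra 𝓘(ℂ, E) G ≃ₗ[ℂ] H) (Λ : (H →L[ℂ] H) →L[ℂ] H) (g : G) : H :=
  polarLog Λ (modelAd e g)

/-- The factor `k ∈ K₀` in the Cartan decomposition `g = exp η k` of `g ∈ G₀`. -/
def cartanCompact (e : GroupLieAlgebra 𝓘(ℂ, E) G ≃ₗ[ℂ] H) (Λ : (H →L[ℂ] H) →L[ℂ] H) (g : G) : G :=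
  modelExp e (-cartanLog e Λ g) * g

lemma continuous_cartanLog : Continuous (cartanLog (G := G) e Λ) :=
  continuous_polarLog_map continuous_modelAd Λ

end CartanFactors

variable [CompleteSpace E]

lemma K₀_le_K : K₀ σ θ ≤ K σ θ :=
  Subgroup.closure_mono (Set.image_mono Submodule.subset_span)

lemma K₀_le_G₀ : K₀ σ θ ≤ G₀ σ :=
  Subgroup.closure_mono (Set.image_mono fun _ hX ↦ hX.2)

lemma tangentMk_mul (g : G₀ σ) {k : G} (hk : k ∈ K₀ σ θ) {ξ ζ : noncompactPart σ θ}
    (h : (ξ : GroupLieAlgebra 𝓘(ℂ, E) G) = lieAd k (ζ : GroupLieAlgebra 𝓘(ℂ, E) G)) :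
    tangentMk (g * ⟨k, K₀_le_G₀ hk⟩) ζ = tangentMk g ξ :=
  (Quot.sound ⟨k, hk, rfl, h⟩).symm

variable [FiniteDimensional ℂ H] {e : GroupLieAlgebra 𝓘(ℂ, E) G ≃ₗ[ℂ] H}
  {L : H →ₗ[ℂ] (H →L[ℂ] H)}

namespace IsCartanModel

section Subgroups

variable (hM : IsCartanModel σ θ e L σ' θ')

include hM

lemma image_realForm : e '' (realForm σ : Set (GroupLieAlgebra 𝓘(ℂ, E) G)) = {X | σ' X = X} := by
  ext Y
  obtain ⟨X, rfl⟩ := e.surjective Y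
  rw [e.injective.mem_set_image]
  change σ X = X ↔ σ' (e X) = e X
  rw [hM.map_σ, e.injective.eq_iff]

lemma image_compactPart :
    e '' (compactPart σ θ : Set (GroupLieAlgebra 𝓘(ℂ, E) G)) = {X | θ' X = X ∧ σ' X = X} := by
  ext Y
  obtain ⟨X, rfl⟩ := e.surjective Y
  rw [e.injective.mem_set_image]
  change θ X = X ∧ σ X = X ↔ θ' (e X) = e X ∧ σ' (e X) = e X
  rw [hM.map_σ, hM.map_θ, e.injective.eq_iff, e.injective.eq_iff]

lemma G₀_eq_realGroup : G₀ σ = realGroup (modelExp e) σ' := by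
  rw [realGroup, ← hM.image_realForm]
  exact analyticSubgroup_eq_closure e _

lemma K₀_eq_compactGroup : K₀ σ θ = compactGroup (modelExp e) σ' θ' := by
  rw [compactGroup, ← hM.image_compactPart]
  exact analyticSubgroup_eq_closure e _

lemma K_eq_complexGroup : K σ θ = complexGroup (modelExp e) σ' θ' := by
  rw [complexGroup, ← hM.image_compactPart]
  refine (analyticSubgroup_eq_closure e _).trans ?_
  congr 2
  exact (Submodule.map_coe e.toLinearMap _).symm.trans
    (congrArg _ (Submodule.map_span e.toLinearMap _))

lemma mem_noncompactSet (ξ : noncompactPart σ θ) : e ξ ∈ noncompactSet σ' θ' :=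
  ⟨hM.map_σ_of_mem_noncompactPart ξ.2, hM.map_θ_of_mem_noncompactPart ξ.2⟩

lemma symm_mem_noncompactPart {Y : H} (hY : Y ∈ noncompactSet σ' θ') :
    e.symm Y ∈ noncompactPart σ θ := by
  obtain ⟨X, rfl⟩ := e.surjective Y
  rw [e.symm_apply_apply]
  refine ⟨neg_eq_iff_eq_neg.mpr (e.injective ?_), e.injective ?_⟩
  · exact (hM.map_θ X).symm.trans (hY.2.trans (map_neg e X).symm)
  · exact (hM.map_σ X).symm.trans hY.1

lemma modelExp_mem_G₀ {Y : H} (hY : Y ∈ noncompactSet σ' θ') : modelExp e Y ∈ G₀ σ := by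
  rw [hM.G₀_eq_realGroup]
  exact Subgroup.subset_closure ⟨Y, hY.1, rfl⟩

end Subgroups

variable [FiniteDimensional ℂ E] (hM : IsCartanModel σ θ e L σ' θ')

include hM

lemma isUnitaryAut_modelAd {k : G} (hk : k ∈ K₀ σ θ) : IsUnitaryAut L σ' θ' (modelAd e k) := by
  rw [hM.K₀_eq_compactGroup] at hk
  exact hM.cartanData.isUnitaryAut_map hM.isBracketHom_modelAd
    (hM.isExpMap_modelExp.compactGroup_le hM.cartanData hk)

lemma modelAd_mem_noncompactSet {Y : H} (hY : Y ∈ noncompactSet σ' θ') {k : G}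
    (hk : k ∈ K₀ σ θ) : modelAd e k Y ∈ noncompactSet σ' θ' := by
  have hAd := hM.isUnitaryAut_modelAd hk
  constructor
  · rw [← hAd.commute_σ, hY.1]
  · rw [← hAd.commute_θ, hY.2, map_neg]

end IsCartanModel

variable [FiniteDimensional ℂ E] {Λ : (H →L[ℂ] H) →L[ℂ] H}

namespace IsCartanModel

section CartanFactors

variable (hM : IsCartanModel σ θ e L σ' θ')

include hM

lemma continuous_cartanCompact : Continuous (cartanCompact (G := G) e Λ) := by
  have := topologicalGroup_of_lieGroup 𝓘(ℂ, E) ω (G := G)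
  exact (hM.isExpMap_modelExp.continuous.comp continuous_cartanLog.neg).mul continuous_id

lemma exp_cartanLog_mul_cartanCompact (g : G) :
    modelExp e (cartanLog e Λ g) * cartanCompact e Λ g = g := by
  rw [cartanCompact, hM.isExpMap_modelExp.map_neg hM.cartanData, mul_inv_cancel_left]

variable (hΛ : Function.LeftInverse Λ L)

include hΛ

lemma cartanLog_mem {g : G} (hg : g ∈ G₀ σ) : cartanLog e Λ g ∈ noncompactSet σ' θ' := by
  rw [hM.G₀_eq_realGroup] at hg
  obtain ⟨hσ, hθ, -⟩ := hM.cartanData.polarLog_spec hΛ (a := unitOf (modelAd e) g)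
    (hM.isBracketHom_modelAd g) (hM.isExpMap_modelExp.realGroup_le hM.cartanData hg)
  exact ⟨hσ, hθ⟩

lemma cartanCompact_mem {g : G} (hg : g ∈ G₀ σ) : cartanCompact e Λ g ∈ K₀ σ θ := by
  have := topologicalGroup_of_lieGroup 𝓘(ℂ, E) ω (G := G)
  rw [hM.G₀_eq_realGroup] at hg
  rw [hM.K₀_eq_compactGroup]
  exact hM.cartanData.exp_neg_polarLog_mul_mem_compactGroup hΛ continuous_modelAd
    hM.isBracketHom_modelAd hM.isExpMap_modelExp hg

section Uniqueness

variable {Y : H} (hY : Y ∈ noncompactSet σ' θ')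

include hY

lemma cartanLog_exp_mul {k : G} (hk : k ∈ K₀ σ θ) : cartanLog e Λ (modelExp e Y * k) = Y := by
  rw [hM.K₀_eq_compactGroup] at hk
  exact hM.cartanData.polarLog_map_exp_mul hM.isBracketHom_modelAd hΛ hM.isExpMap_modelExp hY.2 hk

lemma cartanCompact_exp_mul {k : G} (hk : k ∈ K₀ σ θ) :
    cartanCompact e Λ (modelExp e Y * k) = k := by
  rw [cartanCompact, hM.cartanLog_exp_mul hΛ hY hk, hM.isExpMap_modelExp.map_neg hM.cartanData,
    inv_mul_cancel_left]

lemma cartanLog_exp : cartanLog e Λ (modelExp e Y) = Y := by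
  simpa only [mul_one] using hM.cartanLog_exp_mul hΛ hY (K₀ σ θ).one_mem

lemma cartanCompact_exp : cartanCompact e Λ (modelExp e Y) = 1 := by
  simpa only [mul_one] using hM.cartanCompact_exp_mul hΛ hY (K₀ σ θ).one_mem

end Uniqueness

variable {g k : G} (hg : g ∈ G₀ σ) (hk : k ∈ K₀ σ θ)

include hg hk

lemma cartanLog_mul : cartanLog e Λ (g * k) = cartanLog e Λ g := by
  conv_lhs => rw [← hM.exp_cartanLog_mul_cartanCompact (Λ := Λ) g, mul_assoc]
  exact hM.cartanLog_exp_mul hΛ (hM.cartanLog_mem hΛ hg)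
    ((K₀ σ θ).mul_mem (hM.cartanCompact_mem hΛ hg) hk)

lemma cartanCompact_mul : cartanCompact e Λ (g * k) = cartanCompact e Λ g * k := by
  rw [cartanCompact, hM.cartanLog_mul hΛ hg hk, cartanCompact, mul_assoc]

end CartanFactors

end IsCartanModel

/-- The trivialization `[g, ξ] ↦ (η, Ad(k) ξ)` of `TM`, where `g = exp η k` is the Cartan
decomposition, on representatives. -/
def tangentCoord (e : GroupLieAlgebra 𝓘(ℂ, E) G ≃ₗ[ℂ] H) (Λ : (H →L[ℂ] H) →L[ℂ] H)
    (p : G₀ σ × noncompactPart σ θ) : H × H :=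
  (cartanLog e Λ (p.1 : G), modelAd e (cartanCompact e Λ (p.1 : G)) (e p.2))

lemma tangentCoord_smul (t : ℝ) (g : G₀ σ) (ξ : noncompactPart σ θ) :
    tangentCoord e Λ (g, t • ξ) =
      ((tangentCoord e Λ (g, ξ)).1, t • (tangentCoord e Λ (g, ξ)).2) := by
  refine Prod.ext rfl ?_
  change modelAd e _ (e (t • (ξ : GroupLieAlgebra 𝓘(ℂ, E) G))) = t • modelAd e _ (e ξ)
  rw [← Complex.coe_smul, ← Complex.coe_smul, map_smul, map_smul]

namespace IsCartanModel

section TangentCoord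

variable (hM : IsCartanModel σ θ e L σ' θ')

include hM

lemma continuous_tangentCoord :
    Continuous (tangentCoord (G := G) (σ := σ) (θ := θ) e Λ) := by
  have hfst : Continuous fun p : G₀ σ × noncompactPart σ θ ↦ (p.1 : G) :=
    continuous_subtype_val.comp continuous_fst
  exact (continuous_cartanLog.comp hfst).prodMk
    (((continuous_modelAd.comp hM.continuous_cartanCompact).comp hfst).clm_apply
      ((continuous_modelEquiv e).comp (continuous_subtype_val.comp continuous_snd)))

variable (hΛ : Function.LeftInverse Λ L)

include hΛ

lemma tangentCoord_mem (p : G₀ σ × noncompactPart σ θ) :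
    tangentCoord e Λ p ∈ noncompactSet σ' θ' ×ˢ noncompactSet σ' θ' :=
  ⟨hM.cartanLog_mem hΛ p.1.2,
    hM.modelAd_mem_noncompactSet (hM.mem_noncompactSet p.2) (hM.cartanCompact_mem hΛ p.1.2)⟩

lemma tangentCoord_eq_of_tangentRel {p q : G₀ σ × noncompactPart σ θ}
    (h : tangentRel σ θ p q) : tangentCoord e Λ p = tangentCoord e Λ q := by
  obtain ⟨k, hk, hfst, hsnd⟩ := h
  rw [tangentCoord, tangentCoord, hfst, hM.cartanLog_mul hΛ p.1.2 hk,
    hM.cartanCompact_mul hΛ p.1.2 hk, hsnd, map_mul, mul_apply_eq_comp, ← modelAd_apply k]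

end TangentCoord

/-- The Cartan decomposition trivializes the tangent bundle of `G₀ / K₀`: `TM ≃ₜ 𝔰₀ × 𝔰₀`. -/
def tangentHomeomorph (hM : IsCartanModel σ θ e L σ' θ') (hΛ : Function.LeftInverse Λ L) :
    TangentM σ θ ≃ₜ (noncompactSet σ' θ' ×ˢ noncompactSet σ' θ' : Set (H × H)) where
  toFun := Quot.lift (fun p ↦ ⟨tangentCoord e Λ p, hM.tangentCoord_mem hΛ p⟩) fun _ _ h ↦
    Subtype.ext (hM.tangentCoord_eq_of_tangentRel hΛ h)
  invFun p := tangentMk ⟨modelExp e p.1.1, hM.modelExp_mem_G₀ p.2.1⟩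
    ⟨e.symm p.1.2, hM.symm_mem_noncompactPart p.2.2⟩
  left_inv := by
    rintro ⟨g, ξ⟩
    refine (tangentMk_mul _ (hM.cartanCompact_mem hΛ g.2) ?_).symm.trans
      (congrArg (fun h ↦ tangentMk h ξ) (Subtype.ext ?_))
    · exact e.symm_apply_eq.mpr (modelAd_apply _ _)
    · exact hM.exp_cartanLog_mul_cartanCompact (g : G)
  right_inv := by
    rintro ⟨⟨η, ζ⟩, hη, hζ⟩
    refine Subtype.ext (Prod.ext (hM.cartanLog_exp hΛ hη) ?_)
    change modelAd e (cartanCompact e Λ (modelExp e η)) (e (e.symm ζ)) = ζ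
    rw [hM.cartanCompact_exp hΛ hη, map_one, e.apply_symm_apply, one_apply_eq_self]
  continuous_toFun := continuous_quot_lift _ (hM.continuous_tangentCoord.subtype_mk _)
  continuous_invFun := continuous_quot_mk.comp
    (((hM.isExpMap_modelExp.continuous.comp
      (continuous_fst.comp continuous_subtype_val)).subtype_mk _).prodMk
    (((continuous_modelEquiv_symm e).comp
      (continuous_snd.comp continuous_subtype_val)).subtype_mk _))

/-- The Cartan decomposition identifies `G₀ / K₀` with `𝔰₀`. -/
def symmetricSpaceHomeomorph (hM : IsCartanModel σ θ e L σ' θ')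
    (hΛ : Function.LeftInverse Λ L) : SymmetricSpace σ θ ≃ₜ noncompactSet σ' θ' where
  toFun := Quotient.lift (fun g : G₀ σ ↦ ⟨cartanLog e Λ (g : G), hM.cartanLog_mem hΛ g.2⟩) <| by
    intro g h hgh
    have hk : (g : G)⁻¹ * h ∈ K₀ σ θ :=
      (QuotientGroup.leftRel_apply.mp hgh : g⁻¹ * h ∈ (K₀ σ θ).subgroupOf (G₀ σ))
    refine Subtype.ext ((hM.cartanLog_mul hΛ g.2 hk).symm.trans ?_)
    rw [mul_inv_cancel_left]
  invFun Y := QuotientGroup.mk ⟨modelExp e Y, hM.modelExp_mem_G₀ Y.2⟩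
  left_inv := by
    rintro ⟨g⟩
    refine QuotientGroup.eq.mpr ?_
    change (modelExp e (cartanLog e Λ (g : G)))⁻¹ * (g : G) ∈ K₀ σ θ
    rw [← hM.isExpMap_modelExp.map_neg hM.cartanData]
    exact hM.cartanCompact_mem hΛ g.2
  right_inv Y := Subtype.ext (hM.cartanLog_exp hΛ Y.2)
  continuous_toFun :=
    ((continuous_cartanLog.comp continuous_subtype_val).subtype_mk _).quotient_lift _
  continuous_invFun := QuotientGroup.continuous_mk.comp
    ((hM.isExpMap_modelExp.continuous.comp continuous_subtype_val).subtype_mk _)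

lemma contractibleSpace_symmetricSpace (hM : IsCartanModel σ θ e L σ' θ') :
    ContractibleSpace (SymmetricSpace σ θ) := by
  obtain ⟨Λ, hΛ⟩ := exists_continuous_leftInverse hM.cartanData.injective
  have : ContractibleSpace (noncompactSet σ' θ') :=
    starConvex_noncompactSet.contractibleSpace ⟨0, zero_mem_noncompactSet⟩
  exact (hM.symmetricSpaceHomeomorph hΛ).contractibleSpace

end IsCartanModel

end Tangent

section Domain

variable {E : Type*} [NormedAddCommGroup E] [NormedSpace ℂ E]
  {G : Type*} [TopologicalSpace G] [ChartedSpace E G] [Group G]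
  {σ θ : GroupLieAlgebra 𝓘(ℂ, E) G →ₛₗ[starRingEnd ℂ] GroupLieAlgebra 𝓘(ℂ, E) G}
  {𝔞₀ : Submodule ℝ (GroupLieAlgebra 𝓘(ℂ, E) G)}

lemma lieAd_zero (k : G) : lieAd k (0 : GroupLieAlgebra 𝓘(ℂ, E) G) = 0 :=
  map_zero (mfderiv 𝓘(ℂ, E) 𝓘(ℂ, E) (fun h : G ↦ k * h * k⁻¹) 1)

lemma lieAd_real_smul (k : G) (t : ℝ) (X : GroupLieAlgebra 𝓘(ℂ, E) G) :
    lieAd k (t • X) = t • lieAd k X := by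
  rw [← Complex.coe_smul, ← Complex.coe_smul]
  exact map_smul (mfderiv 𝓘(ℂ, E) 𝓘(ℂ, E) (fun h : G ↦ k * h * k⁻¹) 1) (t : ℂ) X

variable [CompleteSpace E] [LieGroup 𝓘(ℂ, E) ω G]

section Polyhedron

lemma mem_noncompactPart_of_mem_polyhedron (h𝔞₀ : 𝔞₀ ≤ noncompactPart σ θ)
    {X : GroupLieAlgebra 𝓘(ℂ, E) G} (hX : X ∈ polyhedron σ 𝔞₀) : X ∈ noncompactPart σ θ := by
  obtain ⟨ξ, rfl, -⟩ := hX
  exact h𝔞₀ ξ.2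

lemma smul_mem_polyhedron {X : GroupLieAlgebra 𝓘(ℂ, E) G} (hX : X ∈ polyhedron σ 𝔞₀) {t : ℝ}
    (ht₀ : 0 ≤ t) (ht₁ : t ≤ 1) : t • X ∈ polyhedron σ 𝔞₀ := by
  obtain ⟨ξ, rfl, hξ⟩ := hX
  refine ⟨t • ξ, rfl, fun α hα ↦ ?_⟩
  rw [map_smul, smul_eq_mul, abs_mul, abs_of_nonneg ht₀]
  exact (mul_le_of_le_one_left (abs_nonneg _) ht₁).trans_lt (hξ α hα)

lemma zero_mem_polyhedron : (0 : GroupLieAlgebra 𝓘(ℂ, E) G) ∈ polyhedron σ 𝔞₀ :=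
  ⟨0, rfl, fun α _ ↦ by rw [map_zero, abs_zero]; positivity⟩

lemma zeroSection_subset_tube : zeroSection σ θ ⊆ tube σ θ 𝔞₀ := by
  rintro _ ⟨g, rfl⟩
  exact ⟨g, 0, zero_mem_polyhedron, rfl⟩

end Polyhedron

lemma exists_zeroSection_homeomorph :
    ∃ z : SymmetricSpace σ θ ≃ₜ zeroSection σ θ, ∀ g : G₀ σ,
      (z (QuotientGroup.mk g) : TangentM σ θ) = tangentMk g 0 := by
  let s (g : G₀ σ) : zeroSection σ θ := ⟨tangentMk g 0, g, rfl⟩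
  have hs : Continuous s :=
    (continuous_quot_mk.comp (continuous_id.prodMk continuous_const)).subtype_mk _
  have hs_eq (g h : G₀ σ) (hgh : QuotientGroup.leftRel ((K₀ σ θ).subgroupOf (G₀ σ)) g h) :
      s g = s h := by
    have hk : (g : G)⁻¹ * h ∈ K₀ σ θ :=
      (QuotientGroup.leftRel_apply.mp hgh : g⁻¹ * h ∈ (K₀ σ θ).subgroupOf (G₀ σ))
    refine Subtype.ext (Quot.sound ⟨_, hk, ?_, ?_⟩)
    · exact (mul_inv_cancel_left (g : G) h).symm
    · exact (lieAd_zero _).symm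
  let π (p : G₀ σ × noncompactPart σ θ) : SymmetricSpace σ θ := QuotientGroup.mk p.1
  have hπ : Continuous π := QuotientGroup.continuous_mk.comp continuous_fst
  have hπ_eq (p q : G₀ σ × noncompactPart σ θ) (hpq : tangentRel σ θ p q) : π p = π q := by
    obtain ⟨k, hk, hfst, -⟩ := hpq
    refine QuotientGroup.eq.mpr ?_
    rw [Subgroup.mem_subgroupOf, Subgroup.coe_mul, InvMemClass.coe_inv, hfst, inv_mul_cancel_left]
    exact hk
  refine ⟨⟨⟨Quotient.lift s hs_eq, fun v ↦ Quot.lift π hπ_eq v.1, ?_, ?_⟩, hs.quotient_lift hs_eq,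
    (continuous_quot_lift hπ_eq hπ).comp continuous_subtype_val⟩, fun g ↦ rfl⟩
  · rintro ⟨g⟩
    rfl
  · rintro ⟨_, g, rfl⟩
    rfl

section Scaling

/-- The scaling `[g, ξ] ↦ [g, t ξ]` of the fibres of the tangent bundle. -/
def tangentScale (t : ℝ) : TangentM σ θ → TangentM σ θ :=
  Quot.map (fun p ↦ (p.1, t • p.2)) fun _ _ ⟨k, hk, hfst, hsnd⟩ ↦
    ⟨k, hk, hfst, (congrArg (t • ·) hsnd).trans (lieAd_real_smul k t _).symm⟩

lemma tangentScale_mk (t : ℝ) (g : G₀ σ) (ξ : noncompactPart σ θ) :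
    tangentScale t (tangentMk g ξ) = tangentMk g (t • ξ) := rfl

lemma tangentScale_mem_tube {t : ℝ} (ht₀ : 0 ≤ t) (ht₁ : t ≤ 1) {v : TangentM σ θ}
    (hv : v ∈ tube σ θ 𝔞₀) : tangentScale t v ∈ tube σ θ 𝔞₀ := by
  obtain ⟨g, ξ, hξ, rfl⟩ := hv
  exact ⟨g, t • ξ, smul_mem_polyhedron hξ ht₀ ht₁, rfl⟩

end Scaling

variable {H : Type*} [NormedAddCommGroup H] [InnerProductSpace ℂ H]
  {e : GroupLieAlgebra 𝓘(ℂ, E) G ≃ₗ[ℂ] H}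

lemma polarPoint_eq_mk (e : GroupLieAlgebra 𝓘(ℂ, E) G ≃ₗ[ℂ] H) (g : G)
    (ξ : GroupLieAlgebra 𝓘(ℂ, E) G) :
    polarPoint σ θ g ξ = QuotientGroup.mk (g * modelExp e (Complex.I • e ξ)) := by
  rw [polarPoint, lieExp_eq_modelExp e, map_smul]

variable [FiniteDimensional ℂ E] [FiniteDimensional ℂ H] {L : H →ₗ[ℂ] (H →L[ℂ] H)}
  {σ' θ' : H →ₛₗ[starRingEnd ℂ] H} {Λ : (H →L[ℂ] H) →L[ℂ] H}

namespace IsCartanModel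

section PolarMap

lemma polarPoint_mul (hM : IsCartanModel σ θ e L σ' θ') (g : G) {k : G} (hk : k ∈ K₀ σ θ)
    (ξ : GroupLieAlgebra 𝓘(ℂ, E) G) :
    polarPoint σ θ (g * k) ξ = polarPoint σ θ g (lieAd k ξ) := by
  rw [polarPoint_eq_mk e, polarPoint_eq_mk e, ← modelAd_apply, ← map_smul (modelAd e k),
    ← hM.isExpMap_modelExp.conj, ← mul_assoc, ← mul_assoc]
  exact (QuotientGroup.mk_mul_of_mem _ ((K σ θ).inv_mem (K₀_le_K hk))).symm

lemma continuous_polarPoint (hM : IsCartanModel σ θ e L σ' θ') :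
    Continuous fun p : G₀ σ × noncompactPart σ θ ↦ polarPoint σ θ (p.1 : G) p.2 := by
  have := topologicalGroup_of_lieGroup 𝓘(ℂ, E) ω (G := G)
  simp only [polarPoint_eq_mk e]
  have hξ : Continuous fun p : G₀ σ × noncompactPart σ θ ↦ Complex.I • e p.2 :=
    ((continuous_modelEquiv e).comp (continuous_subtype_val.comp continuous_snd)).const_smul _
  exact QuotientGroup.continuous_mk.comp ((continuous_subtype_val.comp continuous_fst).mul
    (hM.isExpMap_modelExp.continuous.comp hξ))

/-- The polar coordinate map `Π : TM → G / K`. -/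
def polarMap (hM : IsCartanModel σ θ e L σ' θ') : C(TangentM σ θ, G ⧸ K σ θ) where
  toFun := Quot.lift (fun p ↦ polarPoint σ θ (p.1 : G) p.2) fun p q ⟨k, hk, hfst, hsnd⟩ ↦ by
    rw [hfst, hsnd, hM.polarPoint_mul _ hk]
  continuous_toFun := continuous_quot_lift _ hM.continuous_polarPoint

lemma polarMap_mk (hM : IsCartanModel σ θ e L σ' θ') (g : G₀ σ) (ξ : noncompactPart σ θ) :
    hM.polarMap (tangentMk g ξ) = polarPoint σ θ g ξ := rfl

lemma image_polarMap_tube (hM : IsCartanModel σ θ e L σ' θ') (h𝔞₀ : 𝔞₀ ≤ noncompactPart σ θ) :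
    hM.polarMap '' tube σ θ 𝔞₀ = universalDomain σ θ 𝔞₀ := by
  refine Set.Subset.antisymm ?_ ?_
  · rintro _ ⟨_, ⟨g, ξ, hξ, rfl⟩, rfl⟩
    exact ⟨g, g.2, ξ, hξ, rfl⟩
  · rintro _ ⟨g, hg, ξ, hξ, rfl⟩
    exact ⟨tangentMk ⟨g, hg⟩ ⟨ξ, mem_noncompactPart_of_mem_polyhedron h𝔞₀ hξ⟩,
      ⟨_, _, hξ, rfl⟩, rfl⟩

/-- The map `G / K → Aut 𝔤` induced by the Cartan immersion. -/
def quotientImmersion (hM : IsCartanModel σ θ e L σ' θ') : G ⧸ K σ θ → (H →L[ℂ] H) :=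
  Quotient.lift (cartanImmersion (modelAd e) σ' θ') fun g h hgh ↦ by
    have hk : g⁻¹ * h ∈ complexGroup (modelExp e) σ' θ' := by
      rw [← hM.K_eq_complexGroup]
      exact QuotientGroup.leftRel_apply.mp hgh
    rw [← hM.isExpMap_modelExp.cartanImmersion_mul hM.cartanData g hk, mul_inv_cancel_left]

lemma continuous_quotientImmersion (hM : IsCartanModel σ θ e L σ' θ') :
    Continuous hM.quotientImmersion := by
  have := topologicalGroup_of_lieGroup 𝓘(ℂ, E) ω (G := G)
  exact (continuous_cartanImmersion continuous_modelAd).quotient_lift _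

end PolarMap

section Tube

variable (hM : IsCartanModel σ θ e L σ' θ') (hΛ : Function.LeftInverse Λ L)

include hM hΛ

lemma polarPoint_eq_mk_tangentCoord (g : G₀ σ) (ξ : noncompactPart σ θ) :
    polarPoint σ θ (g : G) ξ = QuotientGroup.mk (modelExp e (tangentCoord e Λ (g, ξ)).1 *
      modelExp e (Complex.I • (tangentCoord e Λ (g, ξ)).2)) := by
  conv_lhs => rw [← hM.exp_cartanLog_mul_cartanCompact (Λ := Λ) (g : G),
    hM.polarPoint_mul _ (hM.cartanCompact_mem hΛ g.2), polarPoint_eq_mk e, ← modelAd_apply]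
  rfl

lemma quotientImmersion_polarMap (v : TangentM σ θ) :
    hM.quotientImmersion (hM.polarMap v) = exp (L (hM.tangentHomeomorph hΛ v : H × H).1) *
      exp (L ((2 * Complex.I) • (hM.tangentHomeomorph hΛ v : H × H).2)) *
      exp (L (hM.tangentHomeomorph hΛ v : H × H).1) := by
  obtain ⟨⟨g, ξ⟩, rfl⟩ := Quot.exists_rep v
  obtain ⟨⟨hησ, hηθ⟩, hξσ, hξθ⟩ := (hM.tangentHomeomorph hΛ (tangentMk g ξ)).2
  refine Eq.trans ?_
    (hM.isExpMap_modelExp.cartanImmersion_exp_mul_exp hM.cartanData hησ hηθ hξσ hξθ)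
  exact congrArg hM.quotientImmersion (hM.polarPoint_eq_mk_tangentCoord hΛ g ξ)

variable (h𝔞₀ : 𝔞₀ ≤ noncompactPart σ θ) (hab : ∀ X ∈ 𝔞₀, ∀ Y ∈ 𝔞₀, ⁅X, Y⁆ = 0)

include h𝔞₀ hab

lemma norm_L_tangentHomeomorph_lt {v : TangentM σ θ} (hv : v ∈ tube σ θ 𝔞₀) :
    ‖L (hM.tangentHomeomorph hΛ v : H × H).2‖ < Real.pi / 2 := by
  obtain ⟨g, ξ, hξ, rfl⟩ := hv
  exact ((hM.isUnitaryAut_modelAd (hM.cartanCompact_mem hΛ g.2)).norm_L_apply (e ξ)).trans_lt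
    (hM.norm_lt_of_mem_polyhedron h𝔞₀ hab hξ)

omit hΛ in
lemma tendsto_of_tendsto_quotientImmersion {ι : Type*} {l : Filter ι} {w : ι → tube σ θ 𝔞₀}
    {v : tube σ θ 𝔞₀}
    (h : Tendsto (fun i ↦ hM.quotientImmersion (hM.polarMap (w i))) l
      (𝓝 (hM.quotientImmersion (hM.polarMap v)))) : Tendsto w l (𝓝 v) := by
  obtain ⟨Λ, hΛ⟩ := exists_continuous_leftInverse hM.cartanData.injective
  let Θ := hM.tangentHomeomorph hΛ
  simp only [hM.quotientImmersion_polarMap hΛ] at h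
  obtain ⟨hη, hξ⟩ := hM.cartanData.tendsto_of_tendsto_polar (fun i ↦ (Θ (w i)).2.1.1)
    (fun i ↦ (Θ (w i)).2.1.2) (fun i ↦ (Θ (w i)).2.2.2)
    (fun i ↦ hM.norm_L_tangentHomeomorph_lt hΛ h𝔞₀ hab (w i).2) (Θ v).2.1.1 (Θ v).2.1.2
    (Θ v).2.2.2 (hM.norm_L_tangentHomeomorph_lt hΛ h𝔞₀ hab v.2) h
  have hΘ : Tendsto (fun i ↦ (Θ (w i) : H × H)) l (𝓝 (Θ v)) := hη.prodMk_nhds hξ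
  exact ((IsEmbedding.subtypeVal.comp Θ.isEmbedding).comp .subtypeVal).tendsto_nhds_iff.mpr hΘ

end Tube

variable (hM : IsCartanModel σ θ e L σ' θ')

include hM

lemma isEmbedding_quotientImmersion_polarMap (h𝔞₀ : 𝔞₀ ≤ noncompactPart σ θ)
    (hab : ∀ X ∈ 𝔞₀, ∀ Y ∈ 𝔞₀, ⁅X, Y⁆ = 0) :
    IsEmbedding fun v : tube σ θ 𝔞₀ ↦ hM.quotientImmersion (hM.polarMap v) := by
  obtain ⟨Λ, hΛ⟩ := exists_continuous_leftInverse hM.cartanData.injective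
  have : T2Space (TangentM σ θ) := (hM.tangentHomeomorph hΛ).symm.t2Space
  have hcont : Continuous fun v : tube σ θ 𝔞₀ ↦ hM.quotientImmersion (hM.polarMap v) :=
    hM.continuous_quotientImmersion.comp (hM.polarMap.continuous.comp continuous_subtype_val)
  exact (isInducing_iff_nhds.mpr fun v ↦ (hcont.tendsto v).le_comap.antisymm <|
    hM.tendsto_of_tendsto_quotientImmersion h𝔞₀ hab (w := id) tendsto_comap).isEmbedding

lemma exists_tube_homeomorph (h𝔞₀ : 𝔞₀ ≤ noncompactPart σ θ)
    (hab : ∀ X ∈ 𝔞₀, ∀ Y ∈ 𝔞₀, ⁅X, Y⁆ = 0) :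
    ∃ f : tube σ θ 𝔞₀ ≃ₜ universalDomain σ θ 𝔞₀, ∀ v, (f v : G ⧸ K σ θ) = hM.polarMap v := by
  have himage := hM.image_polarMap_tube h𝔞₀
  let f : tube σ θ 𝔞₀ → universalDomain σ θ 𝔞₀ :=
    Set.MapsTo.restrict hM.polarMap _ _ (Set.mapsTo_iff_image_subset.mpr himage.subset)
  have hf : IsEmbedding f := .of_comp (hM.polarMap.continuous.restrict _)
    (hM.continuous_quotientImmersion.comp continuous_subtype_val)
    (hM.isEmbedding_quotientImmersion_polarMap h𝔞₀ hab)
  have hsurj : Function.Surjective f :=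
    Set.MapsTo.restrict_surjective_iff _ |>.mpr himage.superset
  exact ⟨hf.toHomeomorphOfSurjective hsurj, fun v ↦ rfl⟩

lemma contractibleSpace_tube : ContractibleSpace (tube σ θ 𝔞₀) := by
  obtain ⟨Λ, hΛ⟩ := exists_continuous_leftInverse hM.cartanData.injective
  let Θ (v : TangentM σ θ) : H × H := hM.tangentHomeomorph hΛ v
  have hΘ : IsEmbedding Θ := IsEmbedding.subtypeVal.comp (hM.tangentHomeomorph hΛ).isEmbedding
  have hstar : StarConvex ℝ 0 (Θ '' tube σ θ 𝔞₀) := by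
    rw [starConvex_zero_iff]
    rintro _ ⟨_, ⟨g, ξ, hξ, rfl⟩, rfl⟩ t ht₀ ht₁
    have hk := hM.cartanCompact_mem hΛ g.2
    have htη : t • cartanLog e Λ (g : G) ∈ noncompactSet σ' θ' :=
      starConvex_zero_iff.mp starConvex_noncompactSet (hM.cartanLog_mem hΛ g.2) ht₀ ht₁
    let h : G₀ σ := ⟨modelExp e (t • cartanLog e Λ (g : G)) * cartanCompact e Λ (g : G),
      (G₀ σ).mul_mem (hM.modelExp_mem_G₀ htη) (K₀_le_G₀ hk)⟩
    refine ⟨tangentMk h (t • ξ), ⟨_, _, smul_mem_polyhedron hξ ht₀ ht₁, rfl⟩, ?_⟩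
    refine (tangentCoord_smul t h ξ).trans (Prod.ext (hM.cartanLog_exp_mul hΛ htη hk) ?_)
    change t • modelAd e (cartanCompact e Λ (h : G)) (e ξ) = _
    rw [hM.cartanCompact_exp_mul hΛ htη hk]
    rfl
  have : ContractibleSpace (Θ '' tube σ θ 𝔞₀) :=
    hstar.contractibleSpace ⟨_, Set.mem_image_of_mem _ (zeroSection_subset_tube ⟨1, rfl⟩)⟩
  exact (hΘ.homeomorphImage (tube σ θ 𝔞₀)).contractibleSpace

lemma continuous_tangentScale :
    Continuous fun p : ℝ × TangentM σ θ ↦ tangentScale p.1 p.2 := by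
  obtain ⟨Λ, hΛ⟩ := exists_continuous_leftInverse hM.cartanData.injective
  let Θ := hM.tangentHomeomorph hΛ
  rw [← Θ.comp_continuous_iff, IsInducing.subtypeVal.continuous_iff]
  have hcoord : Continuous fun p : ℝ × TangentM σ θ ↦
      (((Θ p.2 : H × H).1, p.1 • (Θ p.2 : H × H).2) : H × H) := by fun_prop
  refine hcoord.congr fun ⟨t, v⟩ ↦ ?_
  obtain ⟨⟨g, ξ⟩, rfl⟩ := Quot.exists_rep v
  exact (tangentCoord_smul t g ξ).symm

lemma exists_deformationRetraction :
    ∃ φ : unitInterval × tube σ θ 𝔞₀ → tube σ θ 𝔞₀,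
      (∀ (t : unitInterval) (v : tube σ θ 𝔞₀) (g : G₀ σ) (ξ : noncompactPart σ θ),
        (v : TangentM σ θ) = tangentMk g ξ →
        (φ (t, v) : TangentM σ θ) = tangentMk g ((t : ℝ) • ξ)) ∧
      IsStrongDeformationRetraction
        {v : tube σ θ 𝔞₀ | (v : TangentM σ θ) ∈ zeroSection σ θ} φ := by
  refine ⟨fun p ↦ ⟨tangentScale (p.1 : ℝ) p.2, tangentScale_mem_tube p.1.2.1 p.1.2.2 p.2.2⟩,
    fun t v g ξ hv ↦ (congrArg _ hv).trans (tangentScale_mk _ g ξ), ?_, ?_, ?_, ?_⟩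
  · exact Continuous.subtype_mk (hM.continuous_tangentScale.comp
      ((continuous_subtype_val.comp continuous_fst).prodMk
        (continuous_subtype_val.comp continuous_snd))) _
  · rintro ⟨_, g, ξ, hξ, rfl⟩
    exact Subtype.ext ((tangentScale_mk 1 g ξ).trans (by rw [one_smul]))
  · rintro ⟨_, g, ξ, hξ, rfl⟩
    exact ⟨g, (tangentScale_mk 0 g ξ).trans (by rw [zero_smul])⟩
  · rintro t ⟨_, hv⟩ ⟨g, rfl⟩
    exact Subtype.ext ((tangentScale_mk _ g 0).trans (by rw [smul_zero]))

end IsCartanModel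

end Domain

end UniversalDomain

end

theorem mainTheorem9_general
    {E : Type*} [NormedAddCommGroup E] [NormedSpace ℂ E] [FiniteDimensional ℂ E] [CompleteSpace E]
    {G : Type*} [TopologicalSpace G] [ChartedSpace E G] [Group G] [LieGroup 𝓘(ℂ, E) ω G]
    (σ θ : GroupLieAlgebra 𝓘(ℂ, E) G →ₛₗ[starRingEnd ℂ] GroupLieAlgebra 𝓘(ℂ, E) G)
    (hσ : UniversalDomain.IsConjugation σ)
    (hθ : UniversalDomain.IsCartanInvolution θ)
    (hσθ : ∀ X, σ (θ X) = θ (σ X))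
    (𝔞₀ : Submodule ℝ (GroupLieAlgebra 𝓘(ℂ, E) G))
    (h𝔞₀ : 𝔞₀ ≤ UniversalDomain.noncompactPart σ θ) (hab : ∀ X ∈ 𝔞₀, ∀ Y ∈ 𝔞₀, ⁅X, Y⁆ = 0) :
    ContractibleSpace (UniversalDomain.universalDomain σ θ 𝔞₀) ∧
    (∃ polar : C(UniversalDomain.TangentM σ θ, G ⧸ UniversalDomain.K σ θ),
      (∀ (g : UniversalDomain.G₀ σ) (ξ : UniversalDomain.noncompactPart σ θ),
        polar (UniversalDomain.tangentMk g ξ) = UniversalDomain.polarPoint σ θ g ξ) ∧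
      ∃ e : UniversalDomain.tube σ θ 𝔞₀ ≃ₜ UniversalDomain.universalDomain σ θ 𝔞₀,
        ∀ v, (e v : G ⧸ UniversalDomain.K σ θ) = polar v) ∧
    (UniversalDomain.zeroSection σ θ ⊆ UniversalDomain.tube σ θ 𝔞₀ ∧
      ∃ φ : unitInterval × UniversalDomain.tube σ θ 𝔞₀ → UniversalDomain.tube σ θ 𝔞₀,
        (∀ (t : unitInterval) (v : UniversalDomain.tube σ θ 𝔞₀) (g : UniversalDomain.G₀ σ)
          (ξ : UniversalDomain.noncompactPart σ θ),
          (v : UniversalDomain.TangentM σ θ) = UniversalDomain.tangentMk g ξ →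
          (φ (t, v) : UniversalDomain.TangentM σ θ) =
            UniversalDomain.tangentMk g ((t : ℝ) • ξ)) ∧
        UniversalDomain.IsStrongDeformationRetraction
          {v : UniversalDomain.tube σ θ 𝔞₀ | (v : UniversalDomain.TangentM σ θ) ∈
            UniversalDomain.zeroSection σ θ} φ) ∧
    (∃ z : UniversalDomain.SymmetricSpace σ θ ≃ₜ UniversalDomain.zeroSection σ θ,
      ∀ g : UniversalDomain.G₀ σ,
        (z (QuotientGroup.mk g) : UniversalDomain.TangentM σ θ) =
          UniversalDomain.tangentMk g 0) ∧
    ContractibleSpace (UniversalDomain.SymmetricSpace σ θ) := by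
  have : Module.Finite ℂ (GroupLieAlgebra 𝓘(ℂ, E) G) := inferInstanceAs (Module.Finite ℂ E)
  obtain ⟨e, L, σ', θ', hM⟩ := UniversalDomain.exists_isCartanModel hσ hθ hσθ
  obtain ⟨f, hf⟩ := hM.exists_tube_homeomorph h𝔞₀ hab
  have : ContractibleSpace (UniversalDomain.tube σ θ 𝔞₀) := hM.contractibleSpace_tube
  exact ⟨f.symm.contractibleSpace, ⟨hM.polarMap, hM.polarMap_mk, f, hf⟩,
    ⟨UniversalDomain.zeroSection_subset_tube, hM.exists_deformationRetraction⟩,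
    UniversalDomain.exists_zeroSection_homeomorph, hM.contractibleSpace_symmetricSpace⟩

theorem mainTheorem9
    {E : Type*} [NormedAddCommGroup E] [NormedSpace ℂ E] [FiniteDimensional ℂ E] [CompleteSpace E]
    {G : Type*} [TopologicalSpace G] [ChartedSpace E G] [Group G] [LieGroup 𝓘(ℂ, E) ω G]
    [LieAlgebra.IsSemisimple ℂ (GroupLieAlgebra 𝓘(ℂ, E) G)]
    (σ θ : GroupLieAlgebra 𝓘(ℂ, E) G →ₛₗ[starRingEnd ℂ] GroupLieAlgebra 𝓘(ℂ, E) G)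
    (hσ : UniversalDomain.IsConjugation σ)
    (hθ : UniversalDomain.IsCartanInvolution θ)
    (hσθ : ∀ X, σ (θ X) = θ (σ X))
    (𝔞₀ : Submodule ℝ (GroupLieAlgebra 𝓘(ℂ, E) G))
    (h𝔞₀ : UniversalDomain.IsMaximalAbelian σ θ 𝔞₀) :
    -- the universal domain is contractible
    ContractibleSpace (UniversalDomain.universalDomain σ θ 𝔞₀) ∧
    -- polar coordinates are well defined on `TM` and identify the tube over `V` with the domain
    (∃ polar : C(UniversalDomain.TangentM σ θ, G ⧸ UniversalDomain.K σ θ),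
      (∀ (g : UniversalDomain.G₀ σ) (ξ : UniversalDomain.noncompactPart σ θ),
        polar (UniversalDomain.tangentMk g ξ) = UniversalDomain.polarPoint σ θ g ξ) ∧
      ∃ e : UniversalDomain.tube σ θ 𝔞₀ ≃ₜ UniversalDomain.universalDomain σ θ 𝔞₀,
        ∀ v, (e v : G ⧸ UniversalDomain.K σ θ) = polar v) ∧
    -- scaling of the fibres is a strong deformation retraction of the tube onto the zero section
    (UniversalDomain.zeroSection σ θ ⊆ UniversalDomain.tube σ θ 𝔞₀ ∧
      ∃ φ : unitInterval × UniversalDomain.tube σ θ 𝔞₀ → UniversalDomain.tube σ θ 𝔞₀,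
        (∀ (t : unitInterval) (v : UniversalDomain.tube σ θ 𝔞₀) (g : UniversalDomain.G₀ σ)
          (ξ : UniversalDomain.noncompactPart σ θ),
          (v : UniversalDomain.TangentM σ θ) = UniversalDomain.tangentMk g ξ →
          (φ (t, v) : UniversalDomain.TangentM σ θ) =
            UniversalDomain.tangentMk g ((t : ℝ) • ξ)) ∧
        UniversalDomain.IsStrongDeformationRetraction
          {v : UniversalDomain.tube σ θ 𝔞₀ | (v : UniversalDomain.TangentM σ θ) ∈
            UniversalDomain.zeroSection σ θ} φ) ∧
    -- the zero section is a copy of `M = G₀ / K₀`, and `M` is contractible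
    (∃ z : UniversalDomain.SymmetricSpace σ θ ≃ₜ UniversalDomain.zeroSection σ θ,
      ∀ g : UniversalDomain.G₀ σ,
        (z (QuotientGroup.mk g) : UniversalDomain.TangentM σ θ) =
          UniversalDomain.tangentMk g 0) ∧
    ContractibleSpace (UniversalDomain.SymmetricSpace σ θ) :=
  mainTheorem9_general σ θ hσ hθ hσθ 𝔞₀ h𝔞₀.prop.1 h𝔞₀.prop.2
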